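/- **Setting.** Let $\mathscr L$ be a $\mathbb Z_{\ge 0}$-graded vertex Lie algebra over $\mathbb C$: a graded vector space $\mathscr L=\bigoplus_{n\ge0}\mathscr L_{(n)}$ with a linear operator $\mathcal D$ of degree $1$ and bilinear products $a_{(n)}b$ ($n\in\mathbb Z_{\ge0}$) such that $a_{(n)}b=0$ for $n\gg0$, $(\mathcal Da)_{(n)}b=-n\,a_{(n-1)}b$, $a_{(n)}b=-\sum_{k\ge0}\frac{(-1)^{n+k}}{k!}\mathcal D^k(b_{(n+k)}a)$, $a_{(m)}(b_{(n)}c)-b_{(n)}(a_{(m)}c)=\sum_{k\ge0}\binom mk(a_{(k)}b)_{(m+n-k)}c$, and $\deg(a_{(n)}b)=\deg a+\deg b-n-1$. Assume $\ker\mathcal D=\mathbb C\mathsf c$ with $\mathsf c\notin\operatorname{Im}\mathcal D$ and $\deg\mathsf c=0$. Let $\Gamma=\langle\omega\rangle\subset\mathbb C^\times$ be the group of $T$-th roots of unity ($T\geq 1$), with $\omega$ a generator, acting on $\mathscr L$ by $\omega\mapsto\sigma$, where $\sigma$ is a degree-preserving automorphism commuting with $\mathcal D$ and preserving all the products, with $\sigma(\mathsf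 c)=\mathsf c$ and $\sigma^T=\mathrm{id}$. For $\alpha=\omega^k$ put $R_\alpha a=\alpha^{\deg a}\sigma^k a$ ($a$ homogeneous). Fix a graded subspace $\mathscr L^o$ with $\mathscr L=\mathscr L^o\oplus\mathbb C\mathsf c\oplus\operatorname{Im}\mathcal D$ that is $\sigma$-stable modulo $\operatorname{Im}\mathcal D$. For a commutative associative algebra $\mathcal A$ with a derivation $\delta$ let $\mathrm{Lie}_{\mathcal A}\mathscr L=(\mathscr L\otimes\mathcal A)/\operatorname{Im}(\mathcal D\otimes1+1\otimes\delta)$, with quotient map $\rho$ and bracket $[\rho(a\otimes f),\rho(b\otimes g)]=\sum_{n\ge0}\frac1{n!}\rho(a_{(n)}b\otimes(\delta^nf)g)$. Let $\mathsf L(\mathscr L)=\mathrm{Lie}_{\mathbb C((t))}\mathscr L$ with $\delta=\partial_t$, and $a(n)=\rho(a\otimes t^n)$. Whenever it makes sense on $\mathcal A$, $\Gamma$ acts on $\mathrm{Lie}_{\mathcal A}\mathscr L$ by $\alpha.\rho(a\otimes f(t))=\rho(\alpha^{-1}R_\alpha a\otimes f(\alpha^{-1}t))$. Let $\mathsf L(\mathscr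 L)^\Gamma$ be the algebra of invariants in $\mathsf L(\mathscr L)$ and $a^\Gamma(n)=\sum_{\alpha\in\Gamma}\alpha.a(n)$. Modules over $\mathsf L(\mathscr L)$ have level $1$ ($\mathsf c(-1)$ acts as $1$), and modules over $\mathsf L(\mathscr L)^\Gamma$ have level $1/T$ ($\mathsf c(-1)$ acts as $1/T$). Such a module is *smooth* if for all $v$ in it and all $a\in\mathscr L$ one has $a(n)v=0$ (respectively $a^\Gamma(n)v=0$) for $n\gg0$. The *allowed* modules are the smooth ones, the inverse limits of inverse systems $(M^k)_{k\in\mathbb N}$ of smooth modules, and the submodules of such limits. *Marked points* are finitely many points $\boldsymbol z=(z_i)$ of $\mathbb C^\times$ with pairwise disjoint $\Gamma$-orbits, to each of which a module $M_{z_i}$ over $\mathsf L(\mathscr L)$ is assigned; in addition the origin may be a marked point, with a module $M_0$ over $\mathsf L(\mathscr L)^\Gamma$. Let $\mathcal A_{\boldsymbol z}$ and $\mathcal A_{\boldsymbol z,0}$ be the algebras of rational functions of $t$ that vanish at infinity and have poles at most in $\Gamma\boldsymbol z$, respectively in $\Gamma\boldsymbol z\cup\{0\}$, with $\delta=\partial_t$.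 Let $I_{\Gamma\boldsymbol z}\subset\mathrm{Lie}_{\mathcal A_{\boldsymbol z}}\mathscr L$ be spanned by all $\sum_{\alpha\in\Gamma}\rho(\mathsf c\otimes\frac1{t-\alpha z_i})-\sum_{\alpha\in\Gamma}\rho(\mathsf c\otimes\frac1{t-\alpha z_j})$, and $I_{\Gamma\boldsymbol z,0}\subset\mathrm{Lie}_{\mathcal A_{\boldsymbol z,0}}\mathscr L$ by all $\sum_{\alpha\in\Gamma}\rho(\mathsf c\otimes\frac1{t-\alpha z_i})-T\rho(\mathsf c\otimes\frac1t)$. Let $\mathsf L^\Gamma_{\boldsymbol z}(\mathscr L)$ and $\mathsf L^\Gamma_{\boldsymbol z,0}(\mathscr L)$ be the $\Gamma$-invariants in the images of $\rho(\mathscr L^o\otimes\mathcal A_{\boldsymbol z})$ in $\mathrm{Lie}_{\mathcal A_{\boldsymbol z}}\mathscr L/I_{\Gamma\boldsymbol z}$ and of $\rho(\mathscr L^o\otimes\mathcal A_{\boldsymbol z,0})$ in $\mathrm{Lie}_{\mathcal A_{\boldsymbol z,0}}\mathscr L/I_{\Gamma\boldsymbol z,0}$. They act on $\bigotimes_iM_{z_i}$,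 respectively on $\bigotimes_iM_{z_i}\otimes M_0$, an element acting on the factor at each marked point $w$ through its Laurent expansion in $t-w$ and on the whole by the sum of these actions. The *space of cyclotomic coinvariants* is the quotient of the tensor product by the span of all $X.v$, with $X$ in the Lie algebra and $v$ in the tensor product. Write $[\cdots]$ for classes in it. **Proposition.** 1. Let $x\in\mathbb C^\times$, let $M_x$ be a smooth module over $\mathsf L(\mathscr L)$ and let $m\in M_x$. Suppose that, for all choices of further marked points (possibly none, possibly including the origin) such that together with $x$ the nonzero marked points have pairwise disjoint $\Gamma$-orbits, of allowed modules assigned to the further points and of vectors in these modules, the class of the tensor product of $m$ (at $x$) with these vectors vanishes in the space of coinvariants. Then $m=0$. 2. Let $M_0$ be a smooth module over $\mathsf L(\mathscr L)^\Gamma$ and let $m_0\in M_0$. Suppose that, for all choices of nonzero marked points (possibly none) with pairwise disjoint $\Gamma$-orbits, of allowed modules assigned to them and of vectors in these modules, the class of the tensor product of these vectors with $m_0$ (at the origin) vanishes in the space of coinvariants. Then $m_0=0$. -/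

import Mathlib

universe u

noncomputable section

open scoped TensorProduct

set_option linter.unusedSectionVars false

/-- A `ℤ_{≥0}`-graded vertex Lie algebra on the complex vector space `V`, with translation operator
`D` and `n`-th products `prod n a b = a_(n) b`.  As in the standing conventions, the kernel of `D` is
one-dimensional, spanned by `cent`, which does not lie in the image of `D`, and a homogeneous
subspace `Lo` with `V = Lo ⊕ ℂ cent ⊕ Im D` is chosen. -/
structure VertexLieAlgebra (V : Type u) [AddCommGroup V] [Module ℂ V] where
  /-- the translation operator -/
  D : V →ₗ[ℂ] V
  /-- the `n`-th products -/
  prod : ℕ → V →ₗ[ℂ] V →ₗ[ℂ] V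
  locality : ∀ a b, ∃ N, ∀ n, N ≤ n → prod n a b = 0
  translation : ∀ a b n, prod n (D a) b = -((n : ℂ) • prod (n - 1) a b)
  skew : ∀ a b n, prod n a b =
    -∑ᶠ k : ℕ, ((-1 : ℂ) ^ (n + k) / (k.factorial : ℂ)) • (D ^ k) (prod (n + k) b a)
  commutator : ∀ a b c m n, prod m a (prod n b c) - prod n b (prod m a c) =
    ∑ k ∈ Finset.range (m + 1), (m.choose k : ℂ) • prod (m + n - k) (prod k a b) c
  /-- the generator of the kernel of `D` -/
  cent : V
  ker_D : LinearMap.ker D = Submodule.span ℂ {cent}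
  cent_notMem : cent ∉ LinearMap.range D
  /-- the homogeneous components -/
  grade : ℕ → Submodule ℂ V
  isInternal : DirectSum.IsInternal grade
  D_grade : ∀ n, ∀ a ∈ grade n, D a ∈ grade (n + 1)
  prod_grade : ∀ p q n r, r + n + 1 = p + q →
    ∀ a ∈ grade p, ∀ b ∈ grade q, prod n a b ∈ grade r
  prod_grade_neg : ∀ p q n, p + q < n + 1 →
    ∀ a ∈ grade p, ∀ b ∈ grade q, prod n a b = 0
  cent_grade : cent ∈ grade 0
  /-- the chosen complement `Lo` of `ℂ cent ⊕ Im D` -/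
  Lo : Submodule ℂ V
  Lo_isCompl : IsCompl Lo (Submodule.span ℂ {cent} ⊔ LinearMap.range D)
  Lo_homogeneous : Lo ≤ ⨆ n, Lo ⊓ grade n

/-- A derivation of a commutative associative (not necessarily unital) complex algebra. -/
structure AlgDeriv (A : Type*) [NonUnitalCommRing A] [Module ℂ A] where
  /-- the underlying linear map -/
  toLin : A →ₗ[ℂ] A
  leibniz : ∀ f g, toLin (f * g) = toLin f * g + f * toLin g

namespace AlgDeriv

variable {A : Type*} [NonUnitalCommRing A] [Module ℂ A] [IsScalarTower ℂ A A] [SMulCommClass ℂ A A]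
  (d : AlgDeriv A)

/-- multiplication as a map on the tensor square -/
def mulT (A : Type*) [NonUnitalCommRing A] [Module ℂ A] [IsScalarTower ℂ A A]
    [SMulCommClass ℂ A A] : A ⊗[ℂ] A →ₗ[ℂ] A := TensorProduct.lift (LinearMap.mul ℂ A)

lemma mulT_pow (n : ℕ) (t : A ⊗[ℂ] A) :
    (d.toLin ^ n) (mulT A t) =
      mulT A (((d.toLin.rTensor A + d.toLin.lTensor A) ^ n) t) := by
  induction n generalizing t with
  | zero => simp
  | succ n ih =>
    rw [pow_succ, pow_succ, Module.End.mul_apply, Module.End.mul_apply, ← ih]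
    congr 1
    induction t with
    | zero => simp
    | add x y hx hy => simp only [map_add, hx, hy]
    | tmul f g => simp [mulT, d.leibniz]

lemma commute_T : Commute (d.toLin.rTensor A) (d.toLin.lTensor A) := by
  ext f g
  simp

lemma pow_mul (n : ℕ) (f g : A) : (d.toLin ^ n) (f * g) =
    ∑ j ∈ Finset.range (n + 1),
      (n.choose j : ℂ) • ((d.toLin ^ j) f * (d.toLin ^ (n - j)) g) := by
  have h := d.mulT_pow n (f ⊗ₜ g)
  rw [d.commute_T.add_pow] at h
  simp only [mulT, TensorProduct.lift.tmul, LinearMap.mul_apply'] at h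
  rw [h]
  simp only [LinearMap.coe_sum, Finset.sum_apply, map_sum]
  refine Finset.sum_congr rfl fun j _ => ?_
  rw [← nsmul_eq_mul', LinearMap.smul_apply, map_nsmul, Nat.cast_smul_eq_nsmul,
    Module.End.mul_apply, LinearMap.lTensor_pow, LinearMap.rTensor_pow]
  simp

lemma alt_sum (p : ℕ) (f g : A) :
    ∑ j ∈ Finset.range (p + 1), ((-1 : ℂ) ^ j * (p.choose j : ℂ)) •
      (d.toLin ^ (p - j)) ((d.toLin ^ j) f * g) = f * (d.toLin ^ p) g := by
  have hc : Commute (-(d.toLin.rTensor A)) (d.toLin.rTensor A + d.toLin.lTensor A) :=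
    ((Commute.refl _).add_right d.commute_T).neg_left
  have h := hc.add_pow p
  rw [neg_add_cancel_left] at h
  have h2 := congrArg (fun φ => mulT A (φ (f ⊗ₜ[ℂ] g))) h
  simp only [LinearMap.lTensor_pow, LinearMap.lTensor_tmul, mulT, TensorProduct.lift.tmul,
    LinearMap.mul_apply'] at h2
  rw [h2]
  simp only [LinearMap.coe_sum, Finset.sum_apply, map_sum]
  refine Finset.sum_congr rfl fun j _ => ?_
  have key : mulT A (((-(d.toLin.rTensor A)) ^ j * (d.toLin.rTensor A + d.toLin.lTensor A) ^ (p - j))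
      (f ⊗ₜ[ℂ] g)) = ((-1 : ℂ) ^ j) • (d.toLin ^ (p - j)) ((d.toLin ^ j) f * g) := by
    have e : (-(d.toLin.rTensor A)) ^ j = ((-1 : ℂ) ^ j) • (d.toLin.rTensor A) ^ j := by
      rw [← smul_pow, neg_one_smul]
    rw [(hc.pow_pow _ _).eq, Module.End.mul_apply, ← d.mulT_pow, e, LinearMap.rTensor_pow]
    simp [mulT]
  simp only [mulT] at key
  rw [Module.End.mul_apply, Module.End.natCast_apply, map_nsmul, map_nsmul, key,
    ← Nat.cast_smul_eq_nsmul ℂ, smul_smul, mul_comm]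

end AlgDeriv

namespace VertexLieAlgebra

variable {V : Type u} [AddCommGroup V] [Module ℂ V] (L : VertexLieAlgebra V)
  {A : Type*} [NonUnitalCommRing A] [Module ℂ A] [IsScalarTower ℂ A A] [SMulCommClass ℂ A A]
  (d : AlgDeriv A)

/-- The operator `∂ = D ⊗ 1 + 1 ⊗ δ` on `V ⊗ A`. -/
def del : V ⊗[ℂ] A →ₗ[ℂ] V ⊗[ℂ] A := L.D.rTensor A + d.toLin.lTensor V

/-- The `n`-th summand `a ⊗ f, b ⊗ g ↦ (1 / n!) a_(n) b ⊗ (δ^n f) g` of the Lie bracket. -/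
def brkTerm (n : ℕ) : V ⊗[ℂ] A →ₗ[ℂ] V ⊗[ℂ] A →ₗ[ℂ] V ⊗[ℂ] A :=
  ((n.factorial : ℂ)⁻¹) • TensorProduct.map₂ (L.prod n) ((LinearMap.mul ℂ A).comp (d.toLin ^ n))

lemma brkTerm_tmul (n : ℕ) (a b : V) (f g : A) : L.brkTerm d n (a ⊗ₜ f) (b ⊗ₜ g) =
    ((n.factorial : ℂ)⁻¹) • (L.prod n a b ⊗ₜ[ℂ] ((d.toLin ^ n) f * g)) := by
  simp [brkTerm]

lemma brkTerm_bound (x y : V ⊗[ℂ] A) : ∃ N, ∀ n, N ≤ n → L.brkTerm d n x y = 0 := by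
  induction x with
  | zero => exact ⟨0, by simp⟩
  | add x₁ x₂ h₁ h₂ =>
    obtain ⟨N₁, h₁⟩ := h₁
    obtain ⟨N₂, h₂⟩ := h₂
    exact ⟨max N₁ N₂, fun n hn => by
      simp [h₁ n (le_trans (le_max_left _ _) hn), h₂ n (le_trans (le_max_right _ _) hn)]⟩
  | tmul a f =>
    induction y with
    | zero => exact ⟨0, by simp⟩
    | add x₁ x₂ h₁ h₂ =>
      obtain ⟨N₁, h₁⟩ := h₁
      obtain ⟨N₂, h₂⟩ := h₂
      exact ⟨max N₁ N₂, fun n hn => by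
        simp [h₁ n (le_trans (le_max_left _ _) hn), h₂ n (le_trans (le_max_right _ _) hn)]⟩
    | tmul b g =>
      obtain ⟨N, h⟩ := L.locality a b
      exact ⟨N, fun n hn => by simp [brkTerm_tmul, h n hn]⟩

lemma finite_support_brkTerm (x y : V ⊗[ℂ] A) :
    (Function.support fun n => L.brkTerm d n x y).Finite := by
  obtain ⟨N, h⟩ := L.brkTerm_bound d x y
  refine (Set.finite_Iio N).subset fun n hn => ?_
  by_contra hc
  exact hn (h n (not_lt.mp hc))

/-- The bracket `∑ₙ (1 / n!) a_(n) b ⊗ (δ^n f) g` on `V ⊗ A` before passing to the quotient. -/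
def brk : V ⊗[ℂ] A →ₗ[ℂ] V ⊗[ℂ] A →ₗ[ℂ] V ⊗[ℂ] A :=
  LinearMap.mk₂ ℂ (fun x y => ∑ᶠ n : ℕ, L.brkTerm d n x y)
    (fun x₁ x₂ y => by
      simp only [map_add, LinearMap.add_apply]
      exact finsum_add_distrib (L.finite_support_brkTerm d x₁ y) (L.finite_support_brkTerm d x₂ y))
    (fun c x y => by
      simp only [map_smul, LinearMap.smul_apply]
      exact (smul_finsum c _).symm)
    (fun x y₁ y₂ => by
      simp only [map_add]
      exact finsum_add_distrib (L.finite_support_brkTerm d x y₁) (L.finite_support_brkTerm d x y₂))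
    (fun c x y => by
      simp only [map_smul]
      exact (smul_finsum c _).symm)

lemma brk_eq_sum (x y : V ⊗[ℂ] A) {N : ℕ} (h : ∀ n, N ≤ n → L.brkTerm d n x y = 0) :
    L.brk d x y = ∑ n ∈ Finset.range N, L.brkTerm d n x y := by
  refine finsum_eq_sum_of_support_subset _ fun n hn => ?_
  simp only [Finset.coe_range, Set.mem_Iio]
  by_contra hc
  exact hn (h n (not_lt.mp hc))

lemma brk_tmul (a b : V) (f g : A) {N : ℕ} (h : ∀ n, N ≤ n → L.prod n a b = 0) :
    L.brk d (a ⊗ₜ f) (b ⊗ₜ g) = ∑ n ∈ Finset.range N,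
      ((n.factorial : ℂ)⁻¹) • (L.prod n a b ⊗ₜ[ℂ] ((d.toLin ^ n) f * g)) := by
  rw [L.brk_eq_sum d _ _ (N := N) fun n hn => by simp [brkTerm_tmul, h n hn]]
  simp [brkTerm_tmul]

lemma brk_del_left (x y : V ⊗[ℂ] A) : L.brk d (L.del d x) y = 0 := by
  induction x with
  | zero => simp
  | add x₁ x₂ h₁ h₂ => simp [h₁, h₂]
  | tmul a f =>
    induction y with
    | zero => simp
    | add x₁ x₂ h₁ h₂ => simp [h₁, h₂]
    | tmul b g =>
      obtain ⟨N, h⟩ := L.locality a b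
      have e : L.del d (a ⊗ₜ f) = L.D a ⊗ₜ f + a ⊗ₜ d.toLin f := by simp [del]
      rw [e, map_add, LinearMap.add_apply,
        L.brk_tmul d _ _ _ _ (N := N + 1) (fun n hn => by
          rw [L.translation, h (n - 1) (by omega)]; simp),
        L.brk_tmul d _ _ _ _ (N := N) h, Finset.sum_range_succ']
      rw [L.translation a b 0]
      simp only [Nat.cast_zero, zero_smul, neg_zero, TensorProduct.zero_tmul, smul_zero, add_zero]
      rw [← Finset.sum_add_distrib]
      refine Finset.sum_eq_zero fun n _ => ?_
      rw [L.translation, Nat.add_sub_cancel, TensorProduct.neg_tmul, ← TensorProduct.smul_tmul',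
        pow_succ, Module.End.mul_apply, smul_neg, smul_smul, Nat.factorial_succ]
      have hn : ((n : ℂ) + 1) ≠ 0 := by exact_mod_cast Nat.succ_ne_zero n
      have : (((n + 1) * n.factorial : ℕ) : ℂ)⁻¹ * ((n + 1 : ℕ) : ℂ) = (n.factorial : ℂ)⁻¹ := by
        push_cast
        field_simp
      rw [this, neg_add_cancel]

lemma mkQ_D_pow (k : ℕ) (a : V) (f : A) :
    (LinearMap.range (L.del d)).mkQ ((L.D ^ k) a ⊗ₜ f) =
      (-1 : ℂ) ^ k • (LinearMap.range (L.del d)).mkQ (a ⊗ₜ (d.toLin ^ k) f) := by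
  induction k generalizing a f with
  | zero => simp
  | succ k ih =>
    have h : (LinearMap.range (L.del d)).mkQ (L.D a ⊗ₜ (d.toLin ^ k) f) =
        - (LinearMap.range (L.del d)).mkQ (a ⊗ₜ (d.toLin ^ (k + 1)) f) := by
      rw [eq_neg_iff_add_eq_zero, ← map_add, Submodule.mkQ_apply, Submodule.Quotient.mk_eq_zero]
      exact ⟨a ⊗ₜ (d.toLin ^ k) f, by simp [del, pow_succ']⟩
    rw [pow_succ, Module.End.mul_apply, ih, h, pow_succ (-1 : ℂ), mul_smul, neg_one_smul]

lemma brk_skew (x y : V ⊗[ℂ] A) : (LinearMap.range (L.del d)).mkQ (L.brk d x y) =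
    -(LinearMap.range (L.del d)).mkQ (L.brk d y x) := by
  induction x with
  | zero => simp
  | add x₁ x₂ h₁ h₂ => simp only [map_add, LinearMap.add_apply, h₁, h₂]; abel
  | tmul a f =>
    induction y with
    | zero => simp
    | add x₁ x₂ h₁ h₂ => simp only [map_add, LinearMap.add_apply, h₁, h₂]; abel
    | tmul b g =>
      obtain ⟨N₁, h₁⟩ := L.locality a b
      obtain ⟨N₂, h₂⟩ := L.locality b a
      set N := max N₁ N₂ with hN
      have h₁' : ∀ n, N ≤ n → L.prod n a b = 0 := fun n hn => h₁ n (by omega)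
      have h₂' : ∀ n, N ≤ n → L.prod n b a = 0 := fun n hn => h₂ n (by omega)
      rw [L.brk_tmul d a b f g h₁', L.brk_tmul d b a g f h₂', map_sum, map_sum,
        ← Finset.sum_neg_distrib]
      set q := (LinearMap.range (L.del d)).mkQ with hq
      have hs : ∀ n, L.prod n a b = -∑ k ∈ Finset.range N,
          ((-1 : ℂ) ^ (n + k) / (k.factorial : ℂ)) • (L.D ^ k) (L.prod (n + k) b a) := by
        intro n
        rw [L.skew]
        congr 1
        refine finsum_eq_sum_of_support_subset _ fun k hk => ?_
        simp only [Finset.coe_range, Set.mem_Iio]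
        by_contra hc
        refine hk ?_
        simp only [h₂' (n + k) (by omega), map_zero, smul_zero]
      let G : ℕ → ℕ → V ⊗[ℂ] A ⧸ LinearMap.range (L.del d) := fun n k =>
        ((n.factorial : ℂ)⁻¹ * ((-1) ^ n * (k.factorial : ℂ)⁻¹)) •
          q (L.prod (n + k) b a ⊗ₜ[ℂ] (d.toLin ^ k) ((d.toLin ^ n) f * g))
      have hG : ∀ n k, N ≤ n + k → G n k = 0 := fun n k hnk => by
        simp [G, h₂' (n + k) hnk]
      have e₁ : ∀ n, q ((n.factorial : ℂ)⁻¹ • (L.prod n a b ⊗ₜ[ℂ] ((d.toLin ^ n) f * g))) =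
          -∑ k ∈ Finset.range N, G n k := by
        intro n
        rw [hs, TensorProduct.neg_tmul, TensorProduct.sum_tmul, smul_neg, map_neg, map_smul,
          map_sum, Finset.smul_sum]
        congr 1
        refine Finset.sum_congr rfl fun k _ => ?_
        rw [← TensorProduct.smul_tmul', map_smul, hq, L.mkQ_D_pow, smul_smul, smul_smul]
        simp only [G]
        congr 1
        rw [pow_add, div_eq_mul_inv]
        have : ((-1 : ℂ) ^ k) * (-1) ^ k = 1 := by rw [← mul_pow]; simp
        linear_combination ((n.factorial : ℂ)⁻¹ * (-1) ^ n * (k.factorial : ℂ)⁻¹) * this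
      rw [Finset.sum_congr rfl fun n _ => e₁ n, Finset.sum_neg_distrib, Finset.sum_neg_distrib]
      congr 1
      have e₂ : ∑ n ∈ Finset.range N, ∑ k ∈ Finset.range N, G n k =
          ∑ n ∈ Finset.range N, ∑ k ∈ Finset.range (N - n), G n k := by
        refine Finset.sum_congr rfl fun n _ => ?_
        symm
        refine Finset.sum_subset (by intro k; simp; omega) fun k _ hk => hG n k ?_
        simp at hk
        omega
      rw [e₂, ← Finset.sum_range_diag_flip]
      refine Finset.sum_congr rfl fun p _ => ?_
      rw [mul_comm ((d.toLin ^ p) g) f, ← d.alt_sum p f g, TensorProduct.tmul_sum, map_smul,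
        map_sum, Finset.smul_sum]
      refine Finset.sum_congr rfl fun n hn => ?_
      have hnp : n ≤ p := by simp at hn; omega
      rw [TensorProduct.tmul_smul, map_smul, smul_smul]
      simp only [G]
      rw [Nat.add_sub_cancel' hnp]
      congr 1
      rw [Nat.cast_choose ℂ hnp]
      have := Nat.cast_ne_zero (R := ℂ).mpr p.factorial_ne_zero
      field_simp

lemma brk_jacobi (x y z : V ⊗[ℂ] A) : L.brk d x (L.brk d y z) =
    L.brk d (L.brk d x y) z + L.brk d y (L.brk d x z) := by
  induction x with
  | zero => simp
  | add x₁ x₂ h₁ h₂ => simp only [map_add, LinearMap.add_apply, h₁, h₂]; abel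
  | tmul a f =>
  induction y with
  | zero => simp
  | add x₁ x₂ h₁ h₂ => simp only [map_add, LinearMap.add_apply, h₁, h₂]; abel
  | tmul b g =>
  induction z with
  | zero => simp
  | add x₁ x₂ h₁ h₂ => simp only [map_add, h₁, h₂]; abel
  | tmul c h =>
    -- a uniform bound
    have bd : ∀ (x y : V), ∃ N, ∀ n, N ≤ n → L.prod n x y = 0 := L.locality
    have bdf : ∀ (K : ℕ) (u v : ℕ → V), ∃ N, ∀ n, N ≤ n → ∀ k < K, L.prod n (u k) (v k) = 0 := by
      intro K u v
      induction K with
      | zero => exact ⟨0, by simp⟩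
      | succ K ih =>
        obtain ⟨N, hN⟩ := ih
        obtain ⟨N', hN'⟩ := bd (u K) (v K)
        refine ⟨max N N', fun n hn k hk => ?_⟩
        rcases Nat.lt_succ_iff_lt_or_eq.mp hk with hk | rfl
        · exact hN n (by omega) k hk
        · exact hN' n (by omega)
    obtain ⟨K, hK⟩ := bd a b
    obtain ⟨P, hP⟩ := bdf K (fun k => L.prod k a b) (fun _ => c)
    obtain ⟨N₁, hN₁⟩ := bd b c
    obtain ⟨N₂, hN₂⟩ := bd a c
    obtain ⟨N₃, hN₃⟩ := bdf N₁ (fun _ => a) (fun n => L.prod n b c)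
    obtain ⟨N₄, hN₄⟩ := bdf N₂ (fun _ => b) (fun n => L.prod n a c)
    set N := K + P + N₁ + N₂ + N₃ + N₄ with hN
    have h3 : ∀ m n, N ≤ m → L.prod m a (L.prod n b c) = 0 := by
      intro m n hm
      rcases lt_or_ge n N₁ with hn | hn
      · exact hN₃ m (by omega) n hn
      · rw [hN₁ n hn, map_zero]
    have h4 : ∀ m n, N ≤ m → L.prod m b (L.prod n a c) = 0 := by
      intro m n hm
      rcases lt_or_ge n N₂ with hn | hn
      · exact hN₄ m (by omega) n hn
      · rw [hN₂ n hn, map_zero]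
    have h5 : ∀ k p, (N ≤ k ∨ N ≤ p) → L.prod p (L.prod k a b) c = 0 := by
      intro k p hkp
      rcases lt_or_ge k K with hk | hk
      · exact hP p (by omega) k hk
      · rw [hK k hk]; simp
    have h5' : ∀ k p, (K ≤ k ∨ P ≤ p) → L.prod p (L.prod k a b) c = 0 := by
      intro k p hkp
      rcases lt_or_ge k K with hk | hk
      · exact hP p (by omega) k hk
      · rw [hK k hk]; simp
    have E₁ : L.brk d (a ⊗ₜ f) (L.brk d (b ⊗ₜ g) (c ⊗ₜ h)) =
        ∑ n ∈ Finset.range N, ∑ m ∈ Finset.range N,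
          ((m.factorial : ℂ)⁻¹ * (n.factorial : ℂ)⁻¹) •
            (L.prod m a (L.prod n b c) ⊗ₜ[ℂ] ((d.toLin ^ m) f * ((d.toLin ^ n) g * h))) := by
      rw [L.brk_tmul d b c g h (N := N) fun n hn => hN₁ n (by omega), map_sum]
      refine Finset.sum_congr rfl fun n _ => ?_
      rw [map_smul, L.brk_tmul d a _ f _ (N := N) fun m hm => h3 m n hm, Finset.smul_sum]
      refine Finset.sum_congr rfl fun m _ => ?_
      rw [smul_smul, mul_comm]
    have E₂ : L.brk d (b ⊗ₜ g) (L.brk d (a ⊗ₜ f) (c ⊗ₜ h)) =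
        ∑ n ∈ Finset.range N, ∑ m ∈ Finset.range N,
          ((m.factorial : ℂ)⁻¹ * (n.factorial : ℂ)⁻¹) •
            (L.prod n b (L.prod m a c) ⊗ₜ[ℂ] ((d.toLin ^ m) f * ((d.toLin ^ n) g * h))) := by
      rw [L.brk_tmul d a c f h (N := N) fun n hn => hN₂ n (by omega), map_sum, Finset.sum_comm]
      refine Finset.sum_congr rfl fun m _ => ?_
      rw [map_smul, L.brk_tmul d b _ g _ (N := N) fun n hn => h4 n m hn, Finset.smul_sum]
      refine Finset.sum_congr rfl fun n _ => ?_
      rw [smul_smul, mul_left_comm]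
    let G : ℕ → ℕ → ℕ → V ⊗[ℂ] A := fun k j n =>
      ((k.factorial : ℂ)⁻¹ * (j.factorial : ℂ)⁻¹ * (n.factorial : ℂ)⁻¹) •
        (L.prod (j + n) (L.prod k a b) c ⊗ₜ[ℂ]
          ((d.toLin ^ (k + j)) f * ((d.toLin ^ n) g * h)))
    have hG : ∀ k j n, (K ≤ k ∨ P ≤ j + n) → G k j n = 0 := by
      intro k j n hk
      simp [G, h5' k (j + n) hk]
    have E₃ : L.brk d (L.brk d (a ⊗ₜ f) (b ⊗ₜ g)) (c ⊗ₜ h) =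
        ∑ k ∈ Finset.range N, ∑ j ∈ Finset.range N, ∑ n ∈ Finset.range N, G k j n := by
      rw [L.brk_tmul d a b f g (N := N) fun n hn => hK n (by omega), map_sum,
        LinearMap.sum_apply]
      refine Finset.sum_congr rfl fun k _ => ?_
      rw [map_smul, LinearMap.smul_apply,
        L.brk_tmul d _ c _ h (N := N) fun p hp => h5 k p (Or.inr hp)]
      have : ∑ j ∈ Finset.range N, ∑ n ∈ Finset.range N, G k j n =
          ∑ j ∈ Finset.range N, ∑ n ∈ Finset.range (N - j), G k j n := by
        refine Finset.sum_congr rfl fun j _ => ?_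
        symm
        refine Finset.sum_subset (by intro k; simp; omega) fun n _ hn => hG k j n ?_
        simp at hn
        omega
      rw [this, ← Finset.sum_range_diag_flip, Finset.smul_sum]
      refine Finset.sum_congr rfl fun p _ => ?_
      rw [d.pow_mul p, Finset.sum_mul, TensorProduct.tmul_sum, Finset.smul_sum, Finset.smul_sum]
      refine Finset.sum_congr rfl fun j hj => ?_
      have hjp : j ≤ p := by simp at hj; omega
      simp only [G]
      rw [Nat.add_sub_cancel' hjp, smul_mul_assoc, TensorProduct.tmul_smul, smul_smul, smul_smul,
        ← Module.End.mul_apply, ← pow_add, add_comm j k, mul_assoc ((d.toLin ^ (k + j)) f)]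
      congr 1
      rw [Nat.cast_choose ℂ hjp]
      have := Nat.cast_ne_zero (R := ℂ).mpr p.factorial_ne_zero
      field_simp
    rw [← sub_eq_iff_eq_add, E₁, E₂, E₃, ← Finset.sum_sub_distrib]
    have : ∑ k ∈ Finset.range N, ∑ j ∈ Finset.range N, ∑ n ∈ Finset.range N, G k j n =
        ∑ n ∈ Finset.range N, ∑ k ∈ Finset.range N, ∑ j ∈ Finset.range (N - k), G k j n := by
      rw [Finset.sum_congr rfl fun k _ => Finset.sum_comm, Finset.sum_comm]
      refine Finset.sum_congr rfl fun n _ => Finset.sum_congr rfl fun k _ => ?_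
      symm
      refine Finset.sum_subset (by intro k; simp; omega) fun j _ hj => hG k j n ?_
      simp at hj
      omega
    rw [this]
    refine Finset.sum_congr rfl fun n _ => ?_
    rw [← Finset.sum_range_diag_flip, ← Finset.sum_sub_distrib]
    refine Finset.sum_congr rfl fun m _ => ?_
    rw [← smul_sub, ← TensorProduct.sub_tmul, L.commutator, TensorProduct.sum_tmul,
      Finset.smul_sum]
    refine Finset.sum_congr rfl fun k hk => ?_
    have hkm : k ≤ m := by simp at hk; omega
    simp only [G]
    rw [← TensorProduct.smul_tmul', smul_smul, Nat.add_sub_cancel' hkm,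
      show m - k + n = m + n - k by omega]
    congr 1
    rw [Nat.cast_choose ℂ hkm]
    have := Nat.cast_ne_zero (R := ℂ).mpr m.factorial_ne_zero
    field_simp

/-- The Lie algebra `Lie_A L = (V ⊗ A) / Im ∂`, with bracket
`[a ⊗ f, b ⊗ g] = ∑ₙ (1 / n!) a_(n) b ⊗ (δ^n f) g`. -/
def LieOver (L : VertexLieAlgebra V) (d : AlgDeriv A) : Type _ :=
  (V ⊗[ℂ] A) ⧸ LinearMap.range (L.del d)

instance : AddCommGroup (L.LieOver d) :=
  inferInstanceAs (AddCommGroup ((V ⊗[ℂ] A) ⧸ LinearMap.range (L.del d)))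

instance : Module ℂ (L.LieOver d) :=
  inferInstanceAs (Module ℂ ((V ⊗[ℂ] A) ⧸ LinearMap.range (L.del d)))

/-- The quotient map `ρ : V ⊗ A → Lie_A L`. -/
def rho : V ⊗[ℂ] A →ₗ[ℂ] L.LieOver d := (LinearMap.range (L.del d)).mkQ

lemma rho_surjective : Function.Surjective (L.rho d) := Submodule.mkQ_surjective _

lemma rho_eq_zero_iff (x : V ⊗[ℂ] A) : L.rho d x = 0 ↔ ∃ y, L.del d y = x :=
  Submodule.Quotient.mk_eq_zero _

lemma rho_del (x : V ⊗[ℂ] A) : L.rho d (L.del d x) = 0 := (L.rho_eq_zero_iff d _).mpr ⟨x, rfl⟩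

/-- Linear maps out of `V ⊗ A` vanishing on `Im ∂` descend to `Lie_A L`. -/
def liftRho {W : Type*} [AddCommGroup W] [Module ℂ W] (φ : V ⊗[ℂ] A →ₗ[ℂ] W)
    (h : ∀ x, φ (L.del d x) = 0) : L.LieOver d →ₗ[ℂ] W :=
  (LinearMap.range (L.del d)).liftQ φ (by rintro _ ⟨x, rfl⟩; exact h x)

@[simp] lemma liftRho_rho {W : Type*} [AddCommGroup W] [Module ℂ W] (φ : V ⊗[ℂ] A →ₗ[ℂ] W)
    (h : ∀ x, φ (L.del d x) = 0) (x : V ⊗[ℂ] A) : L.liftRho d φ h (L.rho d x) = φ x :=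
  Submodule.liftQ_apply _ _ _

/-- The Lie bracket of `Lie_A L` as a bilinear map. -/
def lieBracket : L.LieOver d →ₗ[ℂ] L.LieOver d →ₗ[ℂ] L.LieOver d :=
  (L.liftRho d (L.liftRho d ((L.brk d).compr₂ (L.rho d))
    (fun x => by refine LinearMap.ext fun y => ?_; simp [brk_del_left])).flip
    (fun y => by
      ext1 x
      obtain ⟨x, rfl⟩ := L.rho_surjective d x
      have := L.brk_skew d x (L.del d y)
      rw [brk_del_left, map_zero, neg_zero] at this
      rw [LinearMap.flip_apply, liftRho_rho]
      exact this)).flip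

lemma lieBracket_rho (x y : V ⊗[ℂ] A) :
    L.lieBracket d (L.rho d x) (L.rho d y) = L.rho d (L.brk d x y) := by
  simp [lieBracket]

instance : LieRing (L.LieOver d) where
  bracket x y := L.lieBracket d x y
  add_lie x y z := by simp
  lie_add x y z := by simp
  lie_self x := by
    obtain ⟨x, rfl⟩ := L.rho_surjective d x
    change L.lieBracket d _ _ = 0
    rw [lieBracket_rho]
    have h : L.rho d (L.brk d x x) = -L.rho d (L.brk d x x) := L.brk_skew d x x
    have h2 : (2 : ℂ) • L.rho d (L.brk d x x) = 0 := by
      rw [two_smul]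
      nth_rewrite 1 [h]
      exact neg_add_cancel _
    exact (smul_eq_zero.mp h2).resolve_left two_ne_zero
  leibniz_lie x y z := by
    obtain ⟨x, rfl⟩ := L.rho_surjective d x
    obtain ⟨y, rfl⟩ := L.rho_surjective d y
    obtain ⟨z, rfl⟩ := L.rho_surjective d z
    change L.lieBracket d _ (L.lieBracket d _ _) =
      L.lieBracket d (L.lieBracket d _ _) _ + L.lieBracket d _ (L.lieBracket d _ _)
    simp only [lieBracket_rho]
    rw [L.brk_jacobi, map_add]

instance : LieAlgebra ℂ (L.LieOver d) where
  lie_smul c x y := by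
    change L.lieBracket d _ _ = c • L.lieBracket d _ _
    simp

lemma lie_rho (x y : V ⊗[ℂ] A) : ⁅L.rho d x, L.rho d y⁆ = L.rho d (L.brk d x y) :=
  L.lieBracket_rho d x y

end VertexLieAlgebra

/-! ### Laurent series and rational functions -/

section Functions

open Polynomial

/-- Composition with a nonconstant polynomial, as a map from rational functions to a field `K`
containing the polynomials: `f ↦ f(y)`. -/
def substPoly (K : Type*) [Field K] [Algebra ℂ[X] K]
    [FaithfulSMul ℂ[X] K] (y : ℂ[X]) (hy : y.natDegree ≠ 0) : RatFunc ℂ →+* K :=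
  RatFunc.liftRingHom ((algebraMap ℂ[X] K).comp (compRingHom y)) (by
    refine nonZeroDivisors_le_comap_nonZeroDivisors_of_injective _ ?_
    refine (injective_iff_map_eq_zero _).mpr fun p hp => ?_
    have h : p.comp y = 0 := FaithfulSMul.algebraMap_injective ℂ[X] K (by
      simpa using hp)
    rcases comp_eq_zero_iff.mp h with h | ⟨-, h⟩
    · exact h
    · exact absurd (by rw [h]; simp) hy)

lemma substPoly_algebraMap (K : Type*) [Field K] [Algebra ℂ[X] K] [FaithfulSMul ℂ[X] K]
    (y : ℂ[X]) (hy : y.natDegree ≠ 0) (p : ℂ[X]) :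
    substPoly K y hy (algebraMap ℂ[X] (RatFunc ℂ) p) = algebraMap ℂ[X] K (p.comp y) :=
  RatFunc.liftRingHom_algebraMap _ _ p

lemma substPoly_smul (K : Type*) [Field K] [Algebra ℂ[X] K] [FaithfulSMul ℂ[X] K] [Module ℂ K]
    (hK : ∀ (a : ℂ) (x : K), algebraMap ℂ[X] K (C a) * x = a • x)
    (y : ℂ[X]) (hy : y.natDegree ≠ 0) (a : ℂ) (f : RatFunc ℂ) :
    substPoly K y hy (a • f) = a • substPoly K y hy f := by
  rw [RatFunc.smul_eq_C_mul, ← RatFunc.algebraMap_C, map_mul, substPoly_algebraMap, C_comp, hK]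

/-- The derivative of a rational function, by the quotient rule on its reduced fraction. -/
def ratDerivFun (f : RatFunc ℂ) : RatFunc ℂ :=
  algebraMap ℂ[X] (RatFunc ℂ) (derivative f.num * f.denom - f.num * derivative f.denom) /
    algebraMap ℂ[X] (RatFunc ℂ) f.denom ^ 2

lemma ratDerivFun_eq (f : RatFunc ℂ) (p q : ℂ[X]) (hq : q ≠ 0)
    (hf : f = algebraMap ℂ[X] (RatFunc ℂ) p / algebraMap ℂ[X] (RatFunc ℂ) q) : ratDerivFun f =
      algebraMap ℂ[X] (RatFunc ℂ) (derivative p * q - p * derivative q) /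
        algebraMap ℂ[X] (RatFunc ℂ) q ^ 2 := by
  have hd := f.denom_ne_zero
  have hq' : algebraMap ℂ[X] (RatFunc ℂ) q ≠ 0 := RatFunc.algebraMap_ne_zero hq
  have hd' : algebraMap ℂ[X] (RatFunc ℂ) f.denom ≠ 0 := RatFunc.algebraMap_ne_zero hd
  have h1 : f.num * q = p * f.denom := by
    apply RatFunc.algebraMap_injective ℂ
    rw [map_mul, map_mul]
    exact (div_eq_div_iff hd' hq').mp ((RatFunc.num_div_denom f).trans hf)
  have h2 := congrArg derivative h1
  simp only [derivative_mul] at h2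
  rw [ratDerivFun]
  generalize f.num = n at *
  generalize f.denom = e at *
  have h3 : (derivative n * e - n * derivative e) * q ^ 2 =
      (derivative p * q - p * derivative q) * e ^ 2 := by
    linear_combination (e * q) * h2 - (e * derivative q + derivative e * q) * h1
  refine (div_eq_div_iff (pow_ne_zero _ hd') (pow_ne_zero _ hq')).mpr ?_
  rw [← map_pow, ← map_pow, ← map_mul, ← map_mul, h3]

/-- `d/dt` on rational functions. -/
def ratDeriv : AlgDeriv (RatFunc ℂ) where
  toLin :=
    { toFun := ratDerivFun
      map_add' := fun f g => by
        have hf : algebraMap ℂ[X] (RatFunc ℂ) f.denom ≠ 0 :=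
          RatFunc.algebraMap_ne_zero f.denom_ne_zero
        have hg : algebraMap ℂ[X] (RatFunc ℂ) g.denom ≠ 0 :=
          RatFunc.algebraMap_ne_zero g.denom_ne_zero
        have e : f + g = algebraMap ℂ[X] (RatFunc ℂ) (f.num * g.denom + f.denom * g.num) /
            algebraMap ℂ[X] (RatFunc ℂ) (f.denom * g.denom) := by
          conv_lhs => rw [← f.num_div_denom, ← g.num_div_denom]
          rw [div_add_div _ _ hf hg]
          simp
        rw [ratDerivFun_eq _ _ _ (mul_ne_zero f.denom_ne_zero g.denom_ne_zero) e]
        simp only [ratDerivFun, derivative_mul, map_add, map_sub, map_mul]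
        field_simp
        ring
      map_smul' := fun c f => by
        have hf : algebraMap ℂ[X] (RatFunc ℂ) f.denom ≠ 0 :=
          RatFunc.algebraMap_ne_zero f.denom_ne_zero
        have e : c • f = algebraMap ℂ[X] (RatFunc ℂ) (C c * f.num) /
            algebraMap ℂ[X] (RatFunc ℂ) f.denom := by
          conv_lhs => rw [← f.num_div_denom]
          rw [map_mul, RatFunc.algebraMap_C, RatFunc.smul_eq_C_mul, mul_div_assoc]
        rw [ratDerivFun_eq _ _ _ f.denom_ne_zero e]
        simp only [ratDerivFun, derivative_C_mul, map_sub, map_mul, RatFunc.algebraMap_C,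
          RatFunc.smul_eq_C_mul, RingHom.id_apply]
        field_simp }
  leibniz := fun f g => by
    have hf : algebraMap ℂ[X] (RatFunc ℂ) f.denom ≠ 0 :=
      RatFunc.algebraMap_ne_zero f.denom_ne_zero
    have hg : algebraMap ℂ[X] (RatFunc ℂ) g.denom ≠ 0 :=
      RatFunc.algebraMap_ne_zero g.denom_ne_zero
    have e : f * g = algebraMap ℂ[X] (RatFunc ℂ) (f.num * g.num) /
        algebraMap ℂ[X] (RatFunc ℂ) (f.denom * g.denom) := by
      conv_lhs => rw [← f.num_div_denom, ← g.num_div_denom]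
      rw [div_mul_div_comm]
      simp
    change ratDerivFun _ = ratDerivFun f * g + f * ratDerivFun g
    rw [ratDerivFun_eq _ _ _ (mul_ne_zero f.denom_ne_zero g.denom_ne_zero) e]
    have e₁ : ratDerivFun f * g + f * ratDerivFun g =
        ratDerivFun f * (algebraMap ℂ[X] (RatFunc ℂ) g.num / algebraMap ℂ[X] (RatFunc ℂ) g.denom) +
        (algebraMap ℂ[X] (RatFunc ℂ) f.num / algebraMap ℂ[X] (RatFunc ℂ) f.denom) *
          ratDerivFun g := by
      rw [f.num_div_denom, g.num_div_denom]
    rw [e₁, ratDerivFun, ratDerivFun]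
    simp only [derivative_mul, map_add, map_sub, map_mul]
    field_simp
    ring

/-- `d/dt` on formal Laurent series. -/
def laurentDeriv : AlgDeriv (LaurentSeries ℂ) where
  toLin := LaurentSeries.derivative ℂ
  leibniz := fun f g => by
    ext n
    have hc : ∀ (h : LaurentSeries ℂ) (m : ℤ),
        (LaurentSeries.derivative ℂ h).coeff m = (m + 1) * h.coeff (m + 1) := fun h m => by
      simp [LaurentSeries.derivative_apply]
    -- the Euler operator
    let θ : LaurentSeries ℂ → LaurentSeries ℂ := fun h =>
      HahnSeries.single (1 : ℤ) (1 : ℂ) * LaurentSeries.derivative ℂ h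
    have hθ : ∀ (h : LaurentSeries ℂ) (m : ℤ), (θ h).coeff m = m * h.coeff m := fun h m => by
      have := HahnSeries.coeff_single_mul_add (r := (1 : ℂ)) (x := LaurentSeries.derivative ℂ h)
        (a := m - 1) (b := 1)
      simp only [sub_add_cancel] at this
      change (HahnSeries.single (1 : ℤ) (1 : ℂ) * LaurentSeries.derivative ℂ h).coeff m = _
      rw [this, hc]
      push_cast
      ring_nf
    have hsupp : ∀ h : LaurentSeries ℂ, (θ h).support ⊆ h.support := fun h m hm => by
      simp only [HahnSeries.mem_support, hθ] at hm ⊢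
      exact right_ne_zero_of_mul hm
    have key : θ (f * g) = θ f * g + f * θ g := by
      ext m
      rw [hθ, HahnSeries.coeff_add, HahnSeries.coeff_mul_left' f.isPWO_support (hsupp f),
        HahnSeries.coeff_mul_right' g.isPWO_support (hsupp g), HahnSeries.coeff_mul,
        ← Finset.sum_add_distrib, Finset.mul_sum]
      refine Finset.sum_congr rfl fun ij hij => ?_
      rw [hθ, hθ, ← (Finset.mem_antidiagonal.mp hij).2.2]
      push_cast
      ring
    have hs : (HahnSeries.single (1 : ℤ) (1 : ℂ)) ≠ 0 := by simp
    have key2 : LaurentSeries.derivative ℂ (f * g) =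
        LaurentSeries.derivative ℂ f * g + f * LaurentSeries.derivative ℂ g := by
      apply mul_left_cancel₀ hs
      change θ (f * g) = _
      rw [key]
      simp only [θ]
      ring
    rw [key2]

/-- Substitution `f(t) ↦ f(β t)` on formal Laurent series. -/
def laurentScale (β : ℂ) (hβ : β ≠ 0) : LaurentSeries ℂ →ₙₐ[ℂ] LaurentSeries ℂ where
  toFun f :=
    { coeff := fun n => β ^ n * f.coeff n
      isPWO_support' := f.isPWO_support.mono fun n hn => right_ne_zero_of_mul hn }
  map_smul' c f := by
    ext n
    simp only [HahnSeries.coeff_smul, smul_eq_mul, MonoidHom.id_apply]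
    ring
  map_zero' := by ext n; simp
  map_add' f g := by ext n; simp [mul_add]
  map_mul' f g := by
    ext n
    have hsupp : ∀ h : LaurentSeries ℂ, (HahnSeries.support (⟨fun n => β ^ n * h.coeff n,
        h.isPWO_support.mono fun n hn => right_ne_zero_of_mul hn⟩ : LaurentSeries ℂ)) ⊆
          h.support := fun h m hm => right_ne_zero_of_mul hm
    rw [HahnSeries.coeff_mul_left' f.isPWO_support (hsupp f)]
    have : ∀ h : LaurentSeries ℂ, (HahnSeries.support (⟨fun n => β ^ n * h.coeff n,
        h.isPWO_support.mono fun n hn => right_ne_zero_of_mul hn⟩ : LaurentSeries ℂ)) =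
          h.support := fun h => by
      refine Set.Subset.antisymm (hsupp h) fun m hm => ?_
      exact mul_ne_zero (zpow_ne_zero _ hβ) hm
    simp only [this]
    simp only [HahnSeries.coeff_mul, Finset.mul_sum]
    refine Finset.sum_congr rfl fun ij hij => ?_
    rw [← (Finset.mem_antidiagonal.mp hij).2.2, zpow_add₀ hβ]
    ring

lemma laurentScale_coeff (β : ℂ) (hβ : β ≠ 0) (f : LaurentSeries ℂ) (n : ℤ) :
    (laurentScale β hβ f).coeff n = β ^ n * f.coeff n := rfl

lemma laurentDeriv_coeff (f : LaurentSeries ℂ) (n : ℤ) :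
    (laurentDeriv.toLin f).coeff n = (n + 1) * f.coeff (n + 1) := by
  simp [laurentDeriv, LaurentSeries.derivative_apply]

/-- A map of differential algebras up to a factor `β`: an algebra endomorphism `s` with
`δ (s f) = β s (δ f)`, like `f(t) ↦ f(β t)`. -/
structure ScaleMap {A : Type*} [NonUnitalCommRing A] [Module ℂ A] (d : AlgDeriv A) (β : ℂ) where
  /-- the underlying algebra map -/
  toHom : A →ₙₐ[ℂ] A
  comm : ∀ f, d.toLin (toHom f) = β • toHom (d.toLin f)

/-- `f(t) ↦ f(β t)` on formal Laurent series, together with the chain rule. -/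
def laurentScaleMap (β : ℂ) (hβ : β ≠ 0) : ScaleMap laurentDeriv β where
  toHom := laurentScale β hβ
  comm f := by
    ext n
    rw [laurentDeriv_coeff, laurentScale_coeff, HahnSeries.coeff_smul, laurentScale_coeff,
      laurentDeriv_coeff, zpow_add_one₀ hβ, smul_eq_mul]
    ring

/-- A derivation of a field extension of the polynomials satisfies the chain rule on `substPoly`. -/
lemma deriv_substPoly (K : Type*) [Field K] [Algebra ℂ[X] K] [FaithfulSMul ℂ[X] K] [Module ℂ K]
    (hK : ∀ (a : ℂ) (x : K), algebraMap ℂ[X] K (C a) * x = a • x) (d : AlgDeriv K) (y : ℂ[X])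
    (hy : y.natDegree ≠ 0) (f : RatFunc ℂ) :
    d.toLin (substPoly K y hy f) =
      d.toLin (algebraMap ℂ[X] K y) * substPoly K y hy (ratDeriv.toLin f) := by
  have h1 : d.toLin 1 = 0 := by
    have := d.leibniz 1 1
    simpa using this
  have hp : ∀ p : ℂ[X], d.toLin (algebraMap ℂ[X] K (p.comp y)) =
      d.toLin (algebraMap ℂ[X] K y) * algebraMap ℂ[X] K ((derivative p).comp y) := by
    intro p
    induction p using Polynomial.induction_on with
    | C a =>
      have : algebraMap ℂ[X] K (C a) = a • 1 := by rw [← hK, mul_one]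
      simp [this, h1]
    | add p q hp hq => simp only [add_comp, map_add, hp, hq, mul_add]
    | monomial n a h =>
      have e : (C a * X ^ (n + 1)).comp y = (C a * X ^ n).comp y * y := by
        simp [pow_succ, mul_assoc]
      have e' : derivative (C a * X ^ (n + 1)) = derivative (C a * X ^ n) * X + C a * X ^ n := by
        rw [pow_succ, ← mul_assoc, derivative_mul, derivative_X, mul_one]
      rw [e, map_mul, d.leibniz, h, e']
      simp only [add_comp, mul_comp, X_comp, map_add, map_mul]
      ring
  have hd := f.denom_ne_zero
  have hd' : algebraMap ℂ[X] K (f.denom.comp y) ≠ 0 := by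
    rw [← substPoly_algebraMap K y hy]
    simpa using hd
  have e₁ : substPoly K y hy f * algebraMap ℂ[X] K (f.denom.comp y) =
      algebraMap ℂ[X] K (f.num.comp y) := by
    rw [← substPoly_algebraMap K y hy, ← substPoly_algebraMap K y hy, ← map_mul]
    congr 1
    exact (eq_div_iff (RatFunc.algebraMap_ne_zero hd)).mp (RatFunc.num_div_denom f).symm
  have e₂ : substPoly K y hy (ratDeriv.toLin f) * algebraMap ℂ[X] K (f.denom.comp y) ^ 2 =
      algebraMap ℂ[X] K ((derivative f.num).comp y) * algebraMap ℂ[X] K (f.denom.comp y) -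
        algebraMap ℂ[X] K (f.num.comp y) * algebraMap ℂ[X] K ((derivative f.denom).comp y) := by
    simp only [← substPoly_algebraMap K y hy, ← map_mul, ← map_pow, ← map_sub]
    congr 1
    have : ratDeriv.toLin f = ratDerivFun f := rfl
    rw [this, ratDerivFun, map_pow, map_sub, map_mul, map_mul,
      div_mul_cancel₀ _ (pow_ne_zero _ (RatFunc.algebraMap_ne_zero hd))]
  have e₃ := congrArg d.toLin e₁
  rw [d.leibniz, hp, hp] at e₃
  generalize substPoly K y hy (ratDeriv.toLin f) = F at *
  generalize d.toLin (substPoly K y hy f) = G at *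
  generalize substPoly K y hy f = H at *
  apply mul_right_cancel₀ (pow_ne_zero 2 hd')
  rw [mul_assoc, e₂, ← e₁]
  linear_combination (algebraMap ℂ[X] K (f.denom.comp y)) * e₃

lemma ratFunc_ringHom_ext {K : Type*} [Field K] (φ ψ : RatFunc ℂ →+* K)
    (h : φ RatFunc.X = ψ RatFunc.X) (hC : ∀ a : ℂ, φ (RatFunc.C a) = ψ (RatFunc.C a)) :
    φ = ψ := by
  have hp : φ.comp (algebraMap ℂ[X] (RatFunc ℂ)) = ψ.comp (algebraMap ℂ[X] (RatFunc ℂ)) := by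
    apply Polynomial.ringHom_ext
    · simpa using hC
    · simpa using h
  have hp' : ∀ p : ℂ[X], φ (algebraMap ℂ[X] (RatFunc ℂ) p) =
    ψ (algebraMap ℂ[X] (RatFunc ℂ) p) := fun p => DFunLike.congr_fun hp p
  ext f
  rw [← f.num_div_denom, map_div₀, map_div₀, hp', hp']

lemma algebraMap_laurent (p : ℂ[X]) : algebraMap ℂ[X] (LaurentSeries ℂ) p =
    HahnSeries.ofPowerSeries ℤ ℂ (p : PowerSeries ℂ) := by
  simp

lemma laurent_C_mul (a : ℂ) (x : LaurentSeries ℂ) :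
    algebraMap ℂ[X] (LaurentSeries ℂ) (C a) * x = a • x := by
  rw [algebraMap_laurent]
  ext n
  simp

lemma ratFunc_C_mul (a : ℂ) (x : RatFunc ℂ) :
    algebraMap ℂ[X] (RatFunc ℂ) (C a) * x = a • x := by
  rw [RatFunc.algebraMap_C, RatFunc.smul_eq_C_mul]

instance : IsScalarTower ℂ (LaurentSeries ℂ) (LaurentSeries ℂ) where
  smul_assoc a f g := by
    rw [← laurent_C_mul, ← laurent_C_mul, smul_eq_mul, smul_eq_mul, mul_assoc]

instance : SMulCommClass ℂ (LaurentSeries ℂ) (LaurentSeries ℂ) where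
  smul_comm a f g := by
    rw [← laurent_C_mul, ← laurent_C_mul, smul_eq_mul, smul_eq_mul, mul_left_comm]

/-- Laurent expansion `ι_{t-w}` of a rational function at the point `w`, written as a Laurent series
in the local coordinate `t - w`: it is the substitution `f(t) ↦ f(t + w)` followed by the expansion
at the origin. -/
def laurentExpand (w : ℂ) : RatFunc ℂ →ₗ[ℂ] LaurentSeries ℂ where
  toFun := substPoly (LaurentSeries ℂ) (X + C w) (by simp)
  map_add' := map_add _
  map_smul' := substPoly_smul _ laurent_C_mul _ _

lemma laurentExpand_mul (w : ℂ) (f g : RatFunc ℂ) :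
    laurentExpand w (f * g) = laurentExpand w f * laurentExpand w g :=
  map_mul (substPoly (LaurentSeries ℂ) (X + C w) (by simp)) f g

lemma laurentExpand_X (w : ℂ) : laurentExpand w RatFunc.X =
    HahnSeries.single (1 : ℤ) (1 : ℂ) + HahnSeries.C w := by
  have := substPoly_algebraMap (LaurentSeries ℂ) (X + C w) (by simp) X
  rw [RatFunc.algebraMap_X] at this
  refine this.trans ?_
  rw [algebraMap_laurent]
  simp

lemma laurentExpand_deriv (w : ℂ) (f : RatFunc ℂ) :
    laurentDeriv.toLin (laurentExpand w f) = laurentExpand w (ratDeriv.toLin f) := by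
  refine (deriv_substPoly (LaurentSeries ℂ) laurent_C_mul laurentDeriv (X + C w) (by simp) f).trans
    ?_
  have : laurentDeriv.toLin (algebraMap ℂ[X] (LaurentSeries ℂ) (X + C w)) = 1 := by
    ext n
    rw [algebraMap_laurent, laurentDeriv_coeff]
    simp only [coe_add, coe_X, coe_C, map_add, HahnSeries.ofPowerSeries_X,
      HahnSeries.ofPowerSeries_C, HahnSeries.coeff_add, HahnSeries.coeff_single,
      HahnSeries.C_apply, HahnSeries.coeff_one]
    by_cases h : n = 0
    · simp [h]
    · by_cases h' : n + 1 = 0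
      · have : (n : ℂ) + 1 = 0 := by exact_mod_cast h'
        simp [h, this]
      · simp [h, h']
  rw [this, one_mul]
  rfl

/-- Substitution `f(t) ↦ f(β t)` on rational functions. -/
def ratScale (β : ℂ) (hβ : β ≠ 0) : RatFunc ℂ →ₙₐ[ℂ] RatFunc ℂ where
  toFun := substPoly (RatFunc ℂ) (C β * X) (by simp [hβ])
  map_smul' := substPoly_smul _ ratFunc_C_mul _ _
  map_zero' := map_zero _
  map_add' := map_add _
  map_mul' := map_mul _

lemma ratScale_deriv (β : ℂ) (hβ : β ≠ 0) (f : RatFunc ℂ) :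
    ratDeriv.toLin (ratScale β hβ f) = β • ratScale β hβ (ratDeriv.toLin f) := by
  refine (deriv_substPoly (RatFunc ℂ) ratFunc_C_mul ratDeriv (C β * X) (by simp [hβ]) f).trans ?_
  have : ratDeriv.toLin (algebraMap ℂ[X] (RatFunc ℂ) (C β * X)) = RatFunc.C β := by
    have h := ratDerivFun_eq (algebraMap ℂ[X] (RatFunc ℂ) (C β * X)) (C β * X) 1 one_ne_zero
      (by simp)
    refine h.trans ?_
    simp
  rw [this, ← RatFunc.smul_eq_C_mul]
  rfl

lemma laurentExpand_ratScale (β : ℂ) (hβ : β ≠ 0) (f : RatFunc ℂ) :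
    laurentExpand 0 (ratScale β hβ f) = laurentScale β hβ (laurentExpand 0 f) := by
  have hC : ∀ a : ℂ, laurentExpand 0 (RatFunc.C a) = HahnSeries.C a := fun a => by
    have := substPoly_algebraMap (LaurentSeries ℂ) (X + C 0) (by simp) (C a)
    rw [RatFunc.algebraMap_C] at this
    refine this.trans ?_
    rw [algebraMap_laurent]
    simp
  have hone : laurentScale β hβ 1 = 1 := by
    ext n
    rw [laurentScale_coeff, HahnSeries.coeff_one]
    by_cases h : n = 0 <;> simp [h]
  let S : LaurentSeries ℂ →+* LaurentSeries ℂ :=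
    { toFun := laurentScale β hβ
      map_one' := hone
      map_mul' := map_mul _
      map_zero' := map_zero _
      map_add' := map_add _ }
  let E : RatFunc ℂ →+* LaurentSeries ℂ := substPoly (LaurentSeries ℂ) (X + C 0) (by simp)
  let R : RatFunc ℂ →+* RatFunc ℂ := substPoly (RatFunc ℂ) (C β * X) (by simp [hβ])
  have hRX : R RatFunc.X = RatFunc.C β * RatFunc.X := by
    have := substPoly_algebraMap (RatFunc ℂ) (C β * X) (by simp [hβ]) X
    rw [RatFunc.algebraMap_X] at this
    refine this.trans ?_
    simp
  have hRC : ∀ a, R (RatFunc.C a) = RatFunc.C a := fun a => by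
    have := substPoly_algebraMap (RatFunc ℂ) (C β * X) (by simp [hβ]) (C a)
    rw [RatFunc.algebraMap_C] at this
    refine this.trans ?_
    simp
  have key : E.comp R = S.comp E := by
    apply ratFunc_ringHom_ext
    · change E (R RatFunc.X) = laurentScale β hβ (laurentExpand 0 RatFunc.X)
      rw [hRX, map_mul, laurentExpand_X]
      change laurentExpand 0 (RatFunc.C β) * laurentExpand 0 RatFunc.X = _
      rw [hC, laurentExpand_X]
      ext n
      rw [laurentScale_coeff]
      simp only [map_zero, add_zero, HahnSeries.C_mul_eq_smul, HahnSeries.coeff_smul,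
        HahnSeries.coeff_single]
      by_cases h : n = 1 <;> simp [h]
    · intro a
      change E (R (RatFunc.C a)) = laurentScale β hβ (laurentExpand 0 (RatFunc.C a))
      rw [hRC, hC]
      change laurentExpand 0 (RatFunc.C a) = _
      rw [hC]
      ext n
      rw [laurentScale_coeff]
      simp only [HahnSeries.C_apply, HahnSeries.coeff_single]
      by_cases h : n = 0 <;> simp [h]
  exact DFunLike.congr_fun key f

/-- The rational functions of `t` that vanish at infinity and have poles at most in `S`. -/
def ratFun (S : Set ℂ) : NonUnitalSubalgebra ℂ (RatFunc ℂ) where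
  carrier := {f | ∃ p q : ℂ[X], p.degree < q.degree ∧ (∀ w, q.IsRoot w → w ∈ S) ∧
    f = algebraMap ℂ[X] (RatFunc ℂ) p / algebraMap ℂ[X] (RatFunc ℂ) q}
  zero_mem' := ⟨0, 1, by simp, by simp, by simp⟩
  add_mem' := by
    rintro f g ⟨p, q, hpq, hq, rfl⟩ ⟨r, s, hrs, hs, rfl⟩
    have hq0 : q ≠ 0 := by rintro rfl; simp at hpq
    have hs0 : s ≠ 0 := by rintro rfl; simp at hrs
    refine ⟨p * s + q * r, q * s, ?_, ?_, ?_⟩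
    · refine (degree_add_le _ _).trans_lt (max_lt ?_ ?_)
      · rw [degree_mul, degree_mul]
        exact WithBot.add_lt_add_right (by simpa using hs0) hpq
      · rw [degree_mul, degree_mul]
        exact WithBot.add_lt_add_left (by simpa using hq0) hrs
    · intro w hw
      rcases root_mul.mp hw with h | h
      · exact hq w h
      · exact hs w h
    · rw [div_add_div _ _ (RatFunc.algebraMap_ne_zero hq0) (RatFunc.algebraMap_ne_zero hs0)]
      simp
  mul_mem' := by
    rintro f g ⟨p, q, hpq, hq, rfl⟩ ⟨r, s, hrs, hs, rfl⟩
    have hq0 : q ≠ 0 := by rintro rfl; simp at hpq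
    refine ⟨p * r, q * s, ?_, ?_, ?_⟩
    · rw [degree_mul, degree_mul]
      exact (add_le_add_left hpq.le _).trans_lt
        (WithBot.add_lt_add_left (by simpa using hq0) hrs)
    · intro w hw
      rcases root_mul.mp hw with h | h
      · exact hq w h
      · exact hs w h
    · rw [div_mul_div_comm]
      simp
  smul_mem' := by
    rintro c f ⟨p, q, hpq, hq, rfl⟩
    refine ⟨C c * p, q, ?_, hq, ?_⟩
    · refine lt_of_le_of_lt ?_ hpq
      rw [← smul_eq_C_mul]
      exact degree_smul_le c p
    · rw [map_mul, RatFunc.algebraMap_C, RatFunc.smul_eq_C_mul, mul_div_assoc]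

lemma ratDeriv_mem {S : Set ℂ} {f : RatFunc ℂ} (hf : f ∈ ratFun S) :
    ratDeriv.toLin f ∈ ratFun S := by
  obtain ⟨p, q, hpq, hq, hf⟩ := hf
  have hq0 : q ≠ 0 := by rintro rfl; simp at hpq
  refine ⟨derivative p * q - p * derivative q, q ^ 2, ?_, ?_, ?_⟩
  · rw [pow_two, degree_mul]
    refine (degree_sub_le _ _).trans_lt (max_lt ?_ ?_)
    · rw [degree_mul]
      exact WithBot.add_lt_add_right (by simpa using hq0) ((degree_derivative_le).trans_lt hpq)
    · rw [degree_mul]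
      refine (add_le_add_right (degree_derivative_le (p := q)) _).trans_lt ?_
      exact WithBot.add_lt_add_right (by simpa using hq0) hpq
  · intro w hw
    exact hq w (by simpa [IsRoot] using hw)
  · refine (ratDerivFun_eq f p q hq0 hf).trans ?_
    simp

lemma ratScale_mem {S : Set ℂ} {β : ℂ} (hβ : β ≠ 0) (hS : ∀ w, β * w ∈ S → w ∈ S)
    {f : RatFunc ℂ} (hf : f ∈ ratFun S) : ratScale β hβ f ∈ ratFun S := by
  obtain ⟨p, q, hpq, hq, hf⟩ := hf
  have hq0 : q ≠ 0 := by rintro rfl; simp at hpq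
  refine ⟨p.comp (C β * X), q.comp (C β * X), ?_, ?_, ?_⟩
  · have hdeg : ∀ r : ℂ[X], (r.comp (C β * X)).degree = r.degree := fun r => by
      by_cases hr : r = 0
      · simp [hr]
      · have hr' : r.comp (C β * X) ≠ 0 := fun h => by
          rcases comp_eq_zero_iff.mp h with h | ⟨-, h⟩
          · exact hr h
          · have := congrArg natDegree h
            simp [hβ] at this
        rw [degree_eq_natDegree hr, degree_eq_natDegree hr', natDegree_comp]
        simp [hβ]
    rw [hdeg, hdeg]
    exact hpq
  · intro w hw
    refine hS w (hq _ ?_)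
    simpa [IsRoot, eval_comp] using hw
  · subst hf
    change substPoly (RatFunc ℂ) (C β * X) (by simp [hβ]) _ = _
    rw [map_div₀, substPoly_algebraMap, substPoly_algebraMap]

/-- `d/dt` on the rational functions vanishing at infinity with poles at most in `S`. -/
def ratFunDeriv (S : Set ℂ) : AlgDeriv (ratFun S) where
  toLin := ratDeriv.toLin.restrict (p := (ratFun S).toSubmodule) (q := (ratFun S).toSubmodule)
    fun _ hf => ratDeriv_mem hf
  leibniz f g := Subtype.ext (ratDeriv.leibniz f g)

/-- `f(t) ↦ f(β t)` on the rational functions vanishing at infinity with poles at most in `S`, for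
`S` stable under multiplication by `β⁻¹`. -/
def ratFunScaleMap (S : Set ℂ) (β : ℂ) (hβ : β ≠ 0) (hS : ∀ w, β * w ∈ S → w ∈ S) :
    ScaleMap (ratFunDeriv S) β where
  toHom :=
    { toFun := fun f => ⟨ratScale β hβ f, ratScale_mem hβ hS f.2⟩
      map_smul' := fun c f => Subtype.ext (map_smul (ratScale β hβ) c (f : RatFunc ℂ))
      map_zero' := Subtype.ext (map_zero (ratScale β hβ))
      map_add' := fun f g => Subtype.ext (map_add (ratScale β hβ) (f : RatFunc ℂ) g)
      map_mul' := fun f g => Subtype.ext (map_mul (ratScale β hβ) (f : RatFunc ℂ) g) }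
  comm f := Subtype.ext (ratScale_deriv β hβ f)

/-- The rational function `1 / (t - w)`. -/
def simplePole (S : Set ℂ) (w : ℂ) (hw : w ∈ S) : ratFun S :=
  ⟨algebraMap ℂ[X] (RatFunc ℂ) 1 / algebraMap ℂ[X] (RatFunc ℂ) (X - C w), 1, X - C w, by
    rw [degree_X_sub_C, degree_one]; exact zero_lt_one, fun v hv => by
      have : v = w := by simpa [IsRoot, sub_eq_zero] using hv
      exact this ▸ hw, rfl⟩

end Functions

/-! ### The action of the cyclic group -/

namespace VertexLieAlgebra

variable {V : Type u} [AddCommGroup V] [Module ℂ V] (L : VertexLieAlgebra V)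

/-- The local Lie algebra `L(V) = Lie_{ℂ((t))} V`.  The copy attached to a point `w` is identified
with it through the local coordinate `t - w`. -/
abbrev Loc : Type u := L.LieOver laurentDeriv

/-- The `n`-th mode `a(n) = ρ(a ⊗ t^n)`. -/
def mode (a : V) (n : ℤ) : L.Loc := L.rho laurentDeriv (a ⊗ₜ HahnSeries.single n (1 : ℂ))

/-- The operator `α^{L(0)}`, multiplying the elements of degree `n` by `α^n`. -/
def degScale (α : ℂ) : V →ₗ[ℂ] V :=
  (DirectSum.toModule ℂ ℕ V fun n => α ^ n • (L.grade n).subtype) ∘ₗ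
    (LinearEquiv.ofBijective (DirectSum.coeLinearMap L.grade) L.isInternal).symm.toLinearMap

lemma degScale_of_mem (α : ℂ) {n : ℕ} {a : V} (ha : a ∈ L.grade n) :
    L.degScale α a = α ^ n • a := by
  have : (LinearEquiv.ofBijective (DirectSum.coeLinearMap L.grade) L.isInternal).symm a =
      DirectSum.lof ℂ ℕ (fun n => L.grade n) n ⟨a, ha⟩ := by
    rw [LinearEquiv.symm_apply_eq]
    exact (DirectSum.coeLinearMap_lof L.grade n ⟨a, ha⟩).symm
  rw [degScale, LinearMap.comp_apply]
  refine (congrArg _ this).trans ?_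
  rw [DirectSum.toModule_lof]
  rfl

lemma linearMap_ext_grade {W : Type*} [AddCommGroup W] [Module ℂ W] {φ ψ : V →ₗ[ℂ] W}
    (h : ∀ n, ∀ a ∈ L.grade n, φ a = ψ a) : φ = ψ := by
  have : (⨆ n, L.grade n) ≤ LinearMap.eqLocus φ ψ := iSup_le fun n a ha => h n a ha
  rw [L.isInternal.submodule_iSup_eq_top] at this
  ext a
  exact this (Submodule.mem_top : a ∈ ⊤)

/-- An automorphism `σ` of the graded vertex Lie algebra `L` with `σ^T = 1`, together with a
primitive `T`-th root of unity `ω`.  This is the action of the cyclic group `Γ = ⟨ω⟩ ⊆ ℂ^×` of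
order `T` on `L` by automorphisms, the generator `ω` acting as `σ`.  The last condition says that
the chosen complement of `ℂ cent` modulo `Im D` is stable. -/
structure CyclicAction where
  /-- the order of the group -/
  T : ℕ
  T_pos : 0 < T
  /-- the generator of the group -/
  ω : ℂ
  isPrimitiveRoot : IsPrimitiveRoot ω T
  /-- the automorphism by which the generator acts -/
  σ : V ≃ₗ[ℂ] V
  σ_D : ∀ a, σ (L.D a) = L.D (σ a)
  σ_prod : ∀ n a b, σ (L.prod n a b) = L.prod n (σ a) (σ b)
  σ_grade : ∀ n, ∀ a ∈ L.grade n, σ a ∈ L.grade n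
  σ_cent : σ L.cent = L.cent
  σ_pow : ∀ a, (σ^[T]) a = a
  σ_Lo : ∀ a ∈ L.Lo, σ a ∈ L.Lo ⊔ LinearMap.range L.D

namespace CyclicAction

variable {L} (Γ : L.CyclicAction)

lemma ω_ne_zero : Γ.ω ≠ 0 := Γ.isPrimitiveRoot.ne_zero Γ.T_pos.ne'

/-- The modified action `R = ω^{L(0)} σ` of the generator on `V`. -/
def R : V →ₗ[ℂ] V := L.degScale Γ.ω ∘ₗ Γ.σ.toLinearMap

lemma R_of_mem {n : ℕ} {a : V} (ha : a ∈ L.grade n) : Γ.R a = Γ.ω ^ n • Γ.σ a :=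
  L.degScale_of_mem _ (Γ.σ_grade n a ha)

lemma R_mem {n : ℕ} {a : V} (ha : a ∈ L.grade n) : Γ.R a ∈ L.grade n := by
  rw [Γ.R_of_mem ha]
  exact Submodule.smul_mem _ _ (Γ.σ_grade n a ha)

lemma R_D (a : V) : Γ.R (L.D a) = Γ.ω • L.D (Γ.R a) := by
  have : Γ.R ∘ₗ L.D = Γ.ω • (L.D ∘ₗ Γ.R) := L.linearMap_ext_grade fun n a ha => by
    simp only [LinearMap.comp_apply, LinearMap.smul_apply]
    rw [Γ.R_of_mem (L.D_grade n a ha), Γ.R_of_mem ha, Γ.σ_D, map_smul, smul_smul, pow_succ']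
  exact DFunLike.congr_fun this a

lemma R_prod (n : ℕ) (a b : V) :
    L.prod n (Γ.R a) (Γ.R b) = Γ.ω ^ (n + 1) • Γ.R (L.prod n a b) := by
  have h : (L.prod n).compl₁₂ Γ.R Γ.R = Γ.ω ^ (n + 1) • (L.prod n).compr₂ Γ.R := by
    refine L.linearMap_ext_grade fun p a ha => L.linearMap_ext_grade fun q b hb => ?_
    simp only [LinearMap.compl₁₂_apply, LinearMap.smul_apply, LinearMap.compr₂_apply]
    rcases lt_or_ge (p + q) (n + 1) with hpq | hpq
    · rw [L.prod_grade_neg p q n hpq _ (Γ.R_mem ha) _ (Γ.R_mem hb),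
        L.prod_grade_neg p q n hpq _ ha _ hb]
      simp
    · obtain ⟨r, hr⟩ : ∃ r, r + n + 1 = p + q := ⟨p + q - (n + 1), by omega⟩
      rw [Γ.R_of_mem (L.prod_grade p q n r hr a ha b hb), Γ.R_of_mem ha, Γ.R_of_mem hb, Γ.σ_prod,
        smul_smul, ← pow_add]
      simp only [map_smul, LinearMap.smul_apply, smul_smul, ← pow_add]
      congr 2
      omega
  exact DFunLike.congr_fun (DFunLike.congr_fun h a) b

lemma R_pow_T : Γ.R ^ Γ.T = 1 := by
  refine L.linearMap_ext_grade fun n a ha => ?_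
  have : ∀ k : ℕ, (Γ.R ^ k) a = Γ.ω ^ (n * k) • (Γ.σ^[k]) a ∧ (Γ.σ^[k]) a ∈ L.grade n := by
    intro k
    induction k with
    | zero => simp [ha]
    | succ k ih =>
      have hm : (Γ.σ^[k + 1]) a ∈ L.grade n := by
        rw [Function.iterate_succ_apply']
        exact Γ.σ_grade n _ ih.2
      refine ⟨?_, hm⟩
      rw [pow_succ', Module.End.mul_apply, ih.1, map_smul, Γ.R_of_mem ih.2, smul_smul,
        Function.iterate_succ_apply', ← pow_add]
      congr 1
  rw [(this Γ.T).1, Γ.σ_pow, mul_comm, pow_mul, Γ.isPrimitiveRoot.pow_eq_one]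
  simp

lemma R_cent : Γ.R L.cent = L.cent := by
  rw [Γ.R_of_mem L.cent_grade, Γ.σ_cent]
  simp

section Twist

variable {A : Type*} [NonUnitalCommRing A] [Module ℂ A] [IsScalarTower ℂ A A] [SMulCommClass ℂ A A]
  {d : AlgDeriv A} (s : ScaleMap d Γ.ω⁻¹)

/-- The action `a ⊗ f(t) ↦ ω⁻¹ R a ⊗ f(ω⁻¹ t)` of the generator on `V ⊗ A`. -/
def twistT : V ⊗[ℂ] A →ₗ[ℂ] V ⊗[ℂ] A :=
  Γ.ω⁻¹ • TensorProduct.map Γ.R (s.toHom : A →ₗ[ℂ] A)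

lemma twistT_tmul (a : V) (f : A) :
    Γ.twistT s (a ⊗ₜ f) = Γ.ω⁻¹ • (Γ.R a ⊗ₜ[ℂ] s.toHom f) := by
  simp [twistT]

lemma twistT_del (x : V ⊗[ℂ] A) :
    Γ.twistT s (L.del d x) = Γ.ω • L.del d (Γ.twistT s x) := by
  induction x with
  | zero => simp
  | add x y hx hy => simp only [map_add, smul_add, hx, hy]
  | tmul a f =>
    have e : ∀ (a : V) (f : A), L.del d (a ⊗ₜ f) = L.D a ⊗ₜ f + a ⊗ₜ d.toLin f := by
      intro a f
      simp [del]
    have h := Γ.ω_ne_zero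
    rw [e, map_add, twistT_tmul, twistT_tmul, twistT_tmul, map_smul, e, s.comm, R_D,
      TensorProduct.tmul_smul, ← TensorProduct.smul_tmul', smul_add, smul_add, smul_smul, smul_smul,
      smul_smul, smul_smul]
    simp [h]

lemma dpow_scale (n : ℕ) (f : A) :
    (d.toLin ^ n) (s.toHom f) = (Γ.ω⁻¹) ^ n • s.toHom ((d.toLin ^ n) f) := by
  induction n with
  | zero => simp
  | succ n ih =>
    rw [pow_succ', Module.End.mul_apply, ih, map_smul, s.comm, smul_smul, Module.End.mul_apply,
      ← pow_succ]

lemma twistT_brk (x y : V ⊗[ℂ] A) :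
    L.brk d (Γ.twistT s x) (Γ.twistT s y) = Γ.twistT s (L.brk d x y) := by
  induction x with
  | zero => simp
  | add x₁ x₂ h₁ h₂ => simp only [map_add, LinearMap.add_apply, h₁, h₂]
  | tmul a f =>
  induction y with
  | zero => simp
  | add x₁ x₂ h₁ h₂ => simp only [map_add, h₁, h₂]
  | tmul b g =>
    obtain ⟨N, hN⟩ := L.locality a b
    rw [L.brk_tmul d a b f g hN, twistT_tmul, twistT_tmul, map_smul, map_smul,
      LinearMap.smul_apply, L.brk_tmul d (Γ.R a) (Γ.R b) _ _ (N := N) (fun n hn => by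
        rw [R_prod, hN n hn]; simp), map_sum, Finset.smul_sum, Finset.smul_sum]
    refine Finset.sum_congr rfl fun n _ => ?_
    have h := Γ.ω_ne_zero
    rw [map_smul, twistT_tmul, R_prod, dpow_scale, map_mul, smul_mul_assoc,
      TensorProduct.tmul_smul, ← TensorProduct.smul_tmul', smul_smul, smul_smul, smul_smul,
      smul_smul, smul_smul]
    congr 1
    rw [inv_pow, pow_succ]
    field_simp

lemma twistT_rho_del (x : V ⊗[ℂ] A) : (L.rho d ∘ₗ Γ.twistT s) (L.del d x) = 0 := by
  simp [twistT_del, rho_del]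

/-- The action of the generator on `Lie_A L`, by a Lie algebra endomorphism. -/
def twist : L.LieOver d →ₗ⁅ℂ⁆ L.LieOver d :=
  { L.liftRho d (L.rho d ∘ₗ Γ.twistT s) (Γ.twistT_rho_del s) with
    map_lie' := fun {x y} => by
      obtain ⟨x, rfl⟩ := L.rho_surjective d x
      obtain ⟨y, rfl⟩ := L.rho_surjective d y
      simp [lie_rho, twistT_brk] }

lemma twist_rho (x : V ⊗[ℂ] A) : Γ.twist s (L.rho d x) = L.rho d (Γ.twistT s x) :=
  L.liftRho_rho d _ (Γ.twistT_rho_del s) x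

end Twist

lemma ω_inv_ne_zero : Γ.ω⁻¹ ≠ 0 := inv_ne_zero Γ.ω_ne_zero

/-- The action of the generator on `L(V)`. -/
def twistLoc : L.Loc →ₗ⁅ℂ⁆ L.Loc := Γ.twist (laurentScaleMap Γ.ω⁻¹ Γ.ω_inv_ne_zero)

/-- The Lie algebra `L(V)^Γ` of invariants. -/
def LocInv : LieSubalgebra ℂ L.Loc where
  carrier := {X | Γ.twistLoc X = X}
  add_mem' := fun {x y} hx hy => by simp_all
  zero_mem' := by simp
  smul_mem' := fun c x hx => by simp_all
  lie_mem' := fun {x y} hx hy => by simp_all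

lemma mem_LocInv {X : L.Loc} : X ∈ Γ.LocInv ↔ Γ.twistLoc X = X := Iff.rfl

lemma twistLoc_pow_T (X : L.Loc) : (Γ.twistLoc^[Γ.T]) X = X := by
  obtain ⟨x, rfl⟩ := L.rho_surjective _ X
  have h1 : ∀ k : ℕ, (Γ.twistLoc^[k]) (L.rho laurentDeriv x) = L.rho laurentDeriv
      (((Γ.twistT (laurentScaleMap Γ.ω⁻¹ Γ.ω_inv_ne_zero)) ^ k) x) := by
    intro k
    induction k with
    | zero => simp
    | succ k ih =>
      rw [Function.iterate_succ_apply', ih, pow_succ', Module.End.mul_apply]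
      exact Γ.twist_rho _ _
  have h2 : ((laurentScaleMap Γ.ω⁻¹ Γ.ω_inv_ne_zero).toHom : LaurentSeries ℂ →ₗ[ℂ] LaurentSeries ℂ)
      ^ Γ.T = 1 := by
    have : ∀ (k : ℕ) (f : LaurentSeries ℂ) (n : ℤ),
        ((((laurentScaleMap Γ.ω⁻¹ Γ.ω_inv_ne_zero).toHom :
          LaurentSeries ℂ →ₗ[ℂ] LaurentSeries ℂ) ^ k) f).coeff n =
          (Γ.ω⁻¹ ^ n) ^ k * f.coeff n := by
      intro k f n
      induction k with
      | zero => simp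
      | succ k ih =>
        rw [pow_succ', Module.End.mul_apply]
        refine (laurentScale_coeff _ Γ.ω_inv_ne_zero _ n).trans ?_
        rw [ih, pow_succ']
        ring
    refine LinearMap.ext fun f => ?_
    ext n
    rw [this, ← zpow_natCast, ← zpow_mul, mul_comm n, zpow_mul, zpow_natCast, inv_pow,
      Γ.isPrimitiveRoot.pow_eq_one]
    simp
  rw [h1, twistT, smul_pow, TensorProduct.map_pow, h2, R_pow_T, inv_pow,
    Γ.isPrimitiveRoot.pow_eq_one]
  simp

/-- The modes `a^Γ(n) = ∑_{α ∈ Γ} α . a(n)` of `L(V)^Γ`. -/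
def modeInv (a : V) (n : ℤ) : Γ.LocInv :=
  ⟨∑ k ∈ Finset.range Γ.T, (Γ.twistLoc^[k]) (L.mode a n), by
    rw [mem_LocInv, map_sum]
    have h := Finset.sum_range_succ (fun k => (Γ.twistLoc^[k]) (L.mode a n)) Γ.T
    rw [Finset.sum_range_succ', Γ.twistLoc_pow_T] at h
    simp only [Function.iterate_zero, id_eq] at h
    have h' := add_right_cancel h
    rw [← h']
    exact Finset.sum_congr rfl fun k _ => by rw [Function.iterate_succ_apply']⟩

lemma twistLoc_cent (n : ℤ) : Γ.twistLoc (L.mode L.cent n) = Γ.ω⁻¹ ^ (n + 1) • L.mode L.cent n := by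
  have h : (laurentScaleMap Γ.ω⁻¹ Γ.ω_inv_ne_zero).toHom (HahnSeries.single n (1 : ℂ)) =
      Γ.ω⁻¹ ^ n • HahnSeries.single n (1 : ℂ) := by
    ext m
    refine (laurentScale_coeff _ Γ.ω_inv_ne_zero _ m).trans ?_
    rw [HahnSeries.coeff_smul, HahnSeries.coeff_single]
    by_cases h : m = n <;> simp [h]
  refine (Γ.twist_rho _ _).trans ?_
  rw [twistT_tmul, h, R_cent, TensorProduct.tmul_smul, smul_smul, map_smul, mode,
    zpow_add_one₀ Γ.ω_inv_ne_zero, mul_comm]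

/-- The central element `cent(-1)` of `L(V)^Γ`. -/
def centInv : Γ.LocInv := ⟨L.mode L.cent (-1), by
  rw [mem_LocInv, twistLoc_cent]
  simp⟩

end CyclicAction

end VertexLieAlgebra

/-! ### Global Lie algebras and their expansions -/

namespace VertexLieAlgebra

variable {V : Type u} [AddCommGroup V] [Module ℂ V] (L : VertexLieAlgebra V)

/-- The Lie algebra `Lie_A V` for `A` the rational functions vanishing at infinity with poles at
most in `S`. -/
abbrev Glob (S : Set ℂ) : Type u := L.LieOver (ratFunDeriv S)

/-- The subspace `ρ(Lo ⊗ A)` of `Lie_A V`, for `A` as above. -/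
def globLo (S : Set ℂ) : Submodule ℂ (L.Glob S) :=
  (LinearMap.range (L.Lo.subtype.rTensor (ratFun S))).map (L.rho (ratFunDeriv S))

/-- The element `cent / (t - w)`. -/
def centPole (S : Set ℂ) (w : ℂ) (hw : w ∈ S) : L.Glob S :=
  L.rho (ratFunDeriv S) (L.cent ⊗ₜ simplePole S w hw)

/-- The map `a f ↦ ρ(a ⊗ ι_{t-w} f)` from a global Lie algebra to the local one at `w`. -/
def expandAt (S : Set ℂ) (w : ℂ) : L.Glob S →ₗ[ℂ] L.Loc :=
  L.liftRho (ratFunDeriv S)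
    (L.rho laurentDeriv ∘ₗ (laurentExpand w ∘ₗ (ratFun S).toSubmodule.subtype).lTensor V)
    (fun x => by
      rw [LinearMap.comp_apply, rho_eq_zero_iff]
      refine ⟨(laurentExpand w ∘ₗ (ratFun S).toSubmodule.subtype).lTensor V x, ?_⟩
      induction x with
      | zero => simp
      | add x y hx hy => simp only [map_add, hx, hy]
      | tmul a f =>
        have h := laurentExpand_deriv w (f : RatFunc ℂ)
        simp only [del, LinearMap.add_apply, LinearMap.lTensor_tmul, LinearMap.rTensor_tmul,
          map_add, LinearMap.comp_apply]
        congr 2)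

lemma expandAt_rho (S : Set ℂ) (w : ℂ) (a : V) (f : ratFun S) :
    L.expandAt S w (L.rho (ratFunDeriv S) (a ⊗ₜ f)) =
      L.rho laurentDeriv (a ⊗ₜ laurentExpand w (f : RatFunc ℂ)) := by
  rw [expandAt, liftRho_rho]
  rfl

lemma D_cent : L.D L.cent = 0 := by
  have : L.cent ∈ LinearMap.ker L.D := by
    rw [L.ker_D]
    exact Submodule.mem_span_singleton_self _
  exact this

lemma cent_notMem_Lo : L.cent ∉ L.Lo ⊔ LinearMap.range L.D := by
  intro h
  obtain ⟨l, hl, b, hb, e⟩ := Submodule.mem_sup.mp h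
  have h1 : l ∈ Submodule.span ℂ {L.cent} ⊔ LinearMap.range L.D := by
    rw [eq_sub_of_add_eq e]
    exact Submodule.sub_mem _ (Submodule.mem_sup_left (Submodule.mem_span_singleton_self _))
      (Submodule.mem_sup_right hb)
  have h2 : l = 0 := Submodule.disjoint_def.mp L.Lo_isCompl.disjoint l hl h1
  rw [h2, zero_add] at e
  exact L.cent_notMem (e ▸ hb)

/-- `ρ(cent ⊗ f) = (res f) cent(-1)`. -/
lemma rho_cent (f : LaurentSeries ℂ) :
    L.rho laurentDeriv (L.cent ⊗ₜ f) = f.coeff (-1) • L.mode L.cent (-1) := by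
  rw [mode, ← map_smul, ← TensorProduct.tmul_smul, ← sub_eq_zero, ← map_sub,
    ← TensorProduct.tmul_sub, rho_eq_zero_iff]
  let g : LaurentSeries ℂ :=
    { coeff := fun n => (n : ℂ)⁻¹ * f.coeff (n - 1)
      isPWO_support' := by
        have h := (HahnSeries.single (1 : ℤ) (1 : ℂ) * f).isPWO_support
        refine h.mono fun n hn => ?_
        rw [HahnSeries.mem_support]
        have := HahnSeries.coeff_single_mul_add (r := (1 : ℂ)) (x := f) (a := n - 1) (b := 1)
        simp only [sub_add_cancel, one_mul] at this
        rw [this]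
        exact right_ne_zero_of_mul hn }
  refine ⟨L.cent ⊗ₜ g, ?_⟩
  simp only [del, LinearMap.add_apply, LinearMap.lTensor_tmul, LinearMap.rTensor_tmul, D_cent,
    TensorProduct.zero_tmul, zero_add]
  congr 1
  ext n
  rw [laurentDeriv_coeff, HahnSeries.coeff_sub, HahnSeries.coeff_smul, HahnSeries.coeff_single]
  change ((n : ℂ) + 1) * (((n + 1 : ℤ) : ℂ)⁻¹ * f.coeff (n + 1 - 1)) = _
  by_cases h : n = -1
  · simp [h]
  · have : (n : ℂ) + 1 ≠ 0 := fun h' => h (by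
      have : ((n + 1 : ℤ) : ℂ) = 0 := by exact_mod_cast h'
      have := Int.cast_eq_zero.mp this
      omega)
    push_cast
    rw [mul_inv_cancel_left₀ this]
    simp [h]

namespace CyclicAction

variable {L} (Γ : L.CyclicAction)

/-- The action of the generator on a global Lie algebra, for a `Γ`-stable set `S` of poles. -/
def twistGlob (S : Set ℂ) (hS : ∀ w, Γ.ω⁻¹ * w ∈ S → w ∈ S) : L.Glob S →ₗ⁅ℂ⁆ L.Glob S :=
  Γ.twist (ratFunScaleMap S Γ.ω⁻¹ Γ.ω_inv_ne_zero hS)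

lemma expandAt_zero_twistGlob (S : Set ℂ) (hS : ∀ w, Γ.ω⁻¹ * w ∈ S → w ∈ S) (X : L.Glob S) :
    L.expandAt S 0 (Γ.twistGlob S hS X) = Γ.twistLoc (L.expandAt S 0 X) := by
  obtain ⟨x, rfl⟩ := L.rho_surjective _ X
  induction x with
  | zero => simp
  | add x y hx hy => simp only [map_add, hx, hy]
  | tmul a f =>
    rw [expandAt_rho, twistLoc, twist_rho, twistGlob, twist_rho, twistT_tmul, twistT_tmul, map_smul,
      map_smul, map_smul, expandAt_rho]
    congr 3
    exact laurentExpand_ratScale _ Γ.ω_inv_ne_zero _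

lemma R_Lo {a : V} (ha : a ∈ L.Lo ⊔ LinearMap.range L.D) :
    Γ.R a ∈ L.Lo ⊔ LinearMap.range L.D := by
  obtain ⟨l, hl, _, ⟨b, rfl⟩, rfl⟩ := Submodule.mem_sup.mp ha
  rw [map_add]
  refine Submodule.add_mem _ ?_ ?_
  · have : (⨆ n, L.Lo ⊓ L.grade n) ≤ (L.Lo ⊔ LinearMap.range L.D).comap Γ.R := by
      refine iSup_le fun n a ha => ?_
      rw [Submodule.mem_comap, Γ.R_of_mem ha.2]
      exact Submodule.smul_mem _ _ (Γ.σ_Lo a ha.1)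
    exact this (L.Lo_homogeneous hl)
  · rw [R_D]
    exact Submodule.mem_sup_right (Submodule.smul_mem _ _ ⟨_, rfl⟩)

/-- If `X ∈ L(V)` is `Γ`-invariant modulo `cent(-1)` then it is `Γ`-invariant. -/
lemma mem_LocInv_of_sub_mem {X : L.Loc}
    (h : Γ.twistLoc X - X ∈ Submodule.span ℂ {L.mode L.cent (-1)}) : X ∈ Γ.LocInv := by
  obtain ⟨ε, hε, hker⟩ := Submodule.exists_le_ker_of_notMem L.cent_notMem_Lo
  have hεR : ∀ a, ε (Γ.R a) = ε a := fun a => by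
    have : a ∈ L.Lo ⊔ (Submodule.span ℂ {L.cent} ⊔ LinearMap.range L.D) := by
      rw [L.Lo_isCompl.sup_eq_top]; trivial
    obtain ⟨l, hl, m, hm, rfl⟩ := Submodule.mem_sup.mp this
    obtain ⟨c, hc, b, hb, rfl⟩ := Submodule.mem_sup.mp hm
    obtain ⟨z, rfl⟩ := Submodule.mem_span_singleton.mp hc
    have h1 : ∀ y ∈ L.Lo ⊔ LinearMap.range L.D, ε y = 0 := fun y hy => hker hy
    simp only [map_add, map_smul, R_cent]
    rw [h1 _ (Γ.R_Lo (Submodule.mem_sup_left hl)), h1 _ (Γ.R_Lo (Submodule.mem_sup_right hb)),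
      h1 _ (Submodule.mem_sup_left hl), h1 _ (Submodule.mem_sup_right hb)]
  -- the residue functional
  let res : LaurentSeries ℂ →ₗ[ℂ] ℂ :=
    { toFun := fun f => f.coeff (-1)
      map_add' := fun f g => HahnSeries.coeff_add
      map_smul' := fun c f => by simp }
  let r₀ : V ⊗[ℂ] LaurentSeries ℂ →ₗ[ℂ] ℂ :=
    LinearMap.mul' ℂ ℂ ∘ₗ TensorProduct.map ε res
  have hr₀ : ∀ a f, r₀ (a ⊗ₜ f) = ε a * f.coeff (-1) := fun a f => rfl
  have hdel : ∀ x, r₀ (L.del laurentDeriv x) = 0 := fun x => by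
    induction x with
    | zero => simp
    | add x y hx hy => simp only [map_add, hx, hy, add_zero]
    | tmul a f =>
      have h1 : ε (L.D a) = 0 := hker (Submodule.mem_sup_right ⟨a, rfl⟩)
      simp only [del, LinearMap.add_apply, LinearMap.lTensor_tmul, LinearMap.rTensor_tmul, map_add,
        hr₀, h1, laurentDeriv_coeff]
      simp
  let r : L.Loc →ₗ[ℂ] ℂ := L.liftRho laurentDeriv r₀ hdel
  have hr : ∀ x, r (L.rho laurentDeriv x) = r₀ x := fun x => L.liftRho_rho _ _ hdel x
  have hinv : ∀ Y, r (Γ.twistLoc Y) = r Y := fun Y => by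
    obtain ⟨y, rfl⟩ := L.rho_surjective _ Y
    rw [twistLoc, twist_rho, hr, hr]
    induction y with
    | zero => simp
    | add x y hx hy => simp only [map_add, hx, hy]
    | tmul a f =>
      rw [twistT_tmul, map_smul, hr₀, hr₀, hεR]
      have : ((laurentScaleMap Γ.ω⁻¹ Γ.ω_inv_ne_zero).toHom f).coeff (-1) =
        Γ.ω⁻¹ ^ (-1 : ℤ) * f.coeff (-1) := laurentScale_coeff _ Γ.ω_inv_ne_zero f (-1)
      rw [this]
      have := Γ.ω_ne_zero
      simp only [zpow_neg, zpow_one, inv_inv, smul_eq_mul]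
      field_simp
  obtain ⟨c, hc⟩ := Submodule.mem_span_singleton.mp h
  have h1 : r (L.mode L.cent (-1)) = ε L.cent := by
    rw [mode, hr, hr₀]
    simp
  have h2 : c * ε L.cent = 0 := by
    rw [← h1, ← smul_eq_mul, ← map_smul, hc, map_sub, hinv, sub_self]
  have h3 : c = 0 := (mul_eq_zero.mp h2).resolve_right hε
  rw [mem_LocInv, ← sub_eq_zero, ← hc, h3, zero_smul]

variable {ι : Type*}

/-- The set `Γ z` of all `α z_i`. -/
def orbits (z : ι → ℂ) : Set ℂ := {w | ∃ i, ∃ k : ℕ, w = Γ.ω ^ k * z i}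

lemma mem_orbits (z : ι → ℂ) (i : ι) (k : ℕ) : Γ.ω ^ k * z i ∈ Γ.orbits z := ⟨i, k, rfl⟩

lemma orbits_stable (z : ι → ℂ) (w : ℂ) (hw : Γ.ω⁻¹ * w ∈ Γ.orbits z) : w ∈ Γ.orbits z := by
  obtain ⟨i, k, h⟩ := hw
  refine ⟨i, k + 1, ?_⟩
  rw [pow_succ', mul_assoc, ← h, mul_inv_cancel_left₀ Γ.ω_ne_zero]

lemma insert_orbits_stable (z : ι → ℂ) (w : ℂ) (hw : Γ.ω⁻¹ * w ∈ insert 0 (Γ.orbits z)) :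
    w ∈ insert 0 (Γ.orbits z) := by
  rcases hw with h | h
  · left
    exact (mul_eq_zero.mp h).resolve_left Γ.ω_inv_ne_zero
  · right
    exact Γ.orbits_stable z w h

/-- The marked points `z` are nonzero and have pairwise disjoint `Γ`-orbits. -/
def Admissible (z : ι → ℂ) : Prop :=
  (∀ i, z i ≠ 0) ∧ ∀ i j, i ≠ j → ∀ k : ℕ, z i ≠ Γ.ω ^ k * z j

/-- The ideal `I_{Γ z}`, spanned by the differences of the elements
`∑_{α ∈ Γ} cent / (t - α z_i)`. -/
def ideal (z : ι → ℂ) : Submodule ℂ (L.Glob (Γ.orbits z)) :=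
  Submodule.span ℂ {X | ∃ i j : ι, X =
    ∑ k ∈ Finset.range Γ.T, L.centPole (Γ.orbits z) (Γ.ω ^ k * z i) (Γ.mem_orbits z i k) -
    ∑ k ∈ Finset.range Γ.T, L.centPole (Γ.orbits z) (Γ.ω ^ k * z j) (Γ.mem_orbits z j k)}

/-- The ideal `I_{Γ z, 0}`, spanned by the elements
`∑_{α ∈ Γ} cent / (t - α z_i) - T cent / t`. -/
def ideal₀ (z : ι → ℂ) : Submodule ℂ (L.Glob (insert 0 (Γ.orbits z))) :=
  Submodule.span ℂ {X | ∃ i : ι, X =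
    ∑ k ∈ Finset.range Γ.T, L.centPole (insert 0 (Γ.orbits z)) (Γ.ω ^ k * z i)
      (Set.mem_insert_of_mem _ (Γ.mem_orbits z i k)) -
    (Γ.T : ℂ) • L.centPole (insert 0 (Γ.orbits z)) 0 (Set.mem_insert _ _)}

/-- The elements of `Lie_A V` whose class modulo `I_{Γ z}` lies in
`L_z^Γ = (ρ(Lo ⊗ A) / I_{Γ z})^Γ`: those in `ρ(Lo ⊗ A) + I_{Γ z}` that are fixed by the generator
of `Γ` modulo `I_{Γ z}`. -/
def globInv (z : ι → ℂ) : Submodule ℂ (L.Glob (Γ.orbits z)) :=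
  (L.globLo (Γ.orbits z) ⊔ Γ.ideal z) ⊓ (Γ.ideal z).comap
    ((Γ.twistGlob (Γ.orbits z) (Γ.orbits_stable z) : L.Glob (Γ.orbits z) →ₗ[ℂ] _) - LinearMap.id)

/-- The elements of `Lie_A V` whose class modulo `I_{Γ z, 0}` lies in
`L_{z,0}^Γ = (ρ(Lo ⊗ A) / I_{Γ z, 0})^Γ`. -/
def globInv₀ (z : ι → ℂ) : Submodule ℂ (L.Glob (insert 0 (Γ.orbits z))) :=
  (L.globLo (insert 0 (Γ.orbits z)) ⊔ Γ.ideal₀ z) ⊓ (Γ.ideal₀ z).comap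
    ((Γ.twistGlob (insert 0 (Γ.orbits z)) (Γ.insert_orbits_stable z) :
      L.Glob (insert 0 (Γ.orbits z)) →ₗ[ℂ] _) - LinearMap.id)

lemma expandAt_zero_mem {z : ι → ℂ} {X : L.Glob (insert 0 (Γ.orbits z))} (hX : X ∈ Γ.globInv₀ z) :
    L.expandAt (insert 0 (Γ.orbits z)) 0 X ∈ Γ.LocInv := by
  refine Γ.mem_LocInv_of_sub_mem ?_
  rw [← expandAt_zero_twistGlob _ _ (Γ.insert_orbits_stable z), ← map_sub]
  have h : Γ.ideal₀ z ≤ (Submodule.span ℂ {L.mode L.cent (-1)}).comap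
      (L.expandAt (insert 0 (Γ.orbits z)) 0) := by
    refine Submodule.span_le.mpr ?_
    rintro _ ⟨i, rfl⟩
    have hp : ∀ w hw, L.expandAt (insert 0 (Γ.orbits z)) 0 (L.centPole _ w hw) ∈
        Submodule.span ℂ {L.mode L.cent (-1)} := fun w hw => by
      rw [centPole, expandAt_rho, rho_cent]
      exact Submodule.smul_mem _ _ (Submodule.mem_span_singleton_self _)
    simp only [SetLike.mem_coe, Submodule.mem_comap, map_sub, map_sum, map_smul]
    exact Submodule.sub_mem _ (Submodule.sum_mem _ fun k _ => hp _ _)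
      (Submodule.smul_mem _ _ (hp _ _))
  exact h hX.2

/-- Laurent expansion at the origin, from `L_{z,0}^Γ` to `L(V)^Γ`. -/
def expandZero (z : ι → ℂ) : Γ.globInv₀ z →ₗ[ℂ] Γ.LocInv :=
  (L.expandAt (insert 0 (Γ.orbits z)) 0).restrict (p := Γ.globInv₀ z)
    (q := Γ.LocInv.toSubmodule) fun _ hX => Γ.expandAt_zero_mem hX

end CyclicAction

end VertexLieAlgebra

/-! ### Modules, inverse limits and coinvariants -/

/-- A module over the complex Lie algebra `G`. -/
structure LModule (G : Type u) [LieRing G] [LieAlgebra ℂ G] where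
  /-- the underlying vector space -/
  carrier : Type u
  [addCommGroup : AddCommGroup carrier]
  [module : Module ℂ carrier]
  [lieRingModule : LieRingModule G carrier]
  [lieModule : LieModule ℂ G carrier]

namespace LModule

variable {G : Type u} [LieRing G] [LieAlgebra ℂ G]

instance : CoeSort (LModule G) (Type u) := ⟨carrier⟩

attribute [instance] addCommGroup module lieRingModule lieModule

end LModule

/-- An inverse system of modules, indexed by the natural numbers. -/
structure ModuleSystem (G : Type u) [LieRing G] [LieAlgebra ℂ G] where
  /-- the modules -/
  obj : ℕ → LModule G
  /-- the transition maps -/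
  map : ∀ {k l : ℕ}, l ≤ k → obj k →ₗ⁅ℂ,G⁆ obj l
  map_self : ∀ (k : ℕ) (x : obj k), map (le_refl k) x = x
  map_map : ∀ {k l m : ℕ} (h : l ≤ k) (h' : k ≤ m) (x : obj m),
    map h (map h' x) = map (h.trans h') x

namespace ModuleSystem

variable {G : Type u} [LieRing G] [LieAlgebra ℂ G] (S : ModuleSystem G)

/-- The compatible sequences in the product of the modules. -/
def limitSubmodule : Submodule ℂ (∀ k, S.obj k) where
  carrier := {x | ∀ (k l : ℕ) (h : l ≤ k), S.map h (x k) = x l}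
  add_mem' hx hy k l h := by simp [hx k l h, hy k l h]
  zero_mem' k l h := by simp
  smul_mem' c x hx k l h := by simp [hx k l h]

instance : LieRingModule G S.limitSubmodule where
  bracket X x := ⟨fun k => ⁅X, x.1 k⁆, fun k l h => by rw [LieModuleHom.map_lie, x.2 k l h]⟩
  add_lie X Y x := Subtype.ext (funext fun k => add_lie X Y (x.1 k))
  lie_add X x y := Subtype.ext (funext fun k => lie_add X (x.1 k) (y.1 k))
  leibniz_lie X Y x := Subtype.ext (funext fun k => leibniz_lie X Y (x.1 k))

instance : LieModule ℂ G S.limitSubmodule where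
  smul_lie c X x := Subtype.ext (funext fun k => smul_lie c X (x.1 k))
  lie_smul c X x := Subtype.ext (funext fun k => lie_smul c X (x.1 k))

/-- The inverse limit of an inverse system, with componentwise action. -/
def limit : LModule G := ⟨S.limitSubmodule⟩

end ModuleSystem

/-- The modules allowed as tensor factors: those satisfying `P`, inverse limits of inverse systems of
such modules, and (up to isomorphism) submodules of such inverse limits. -/
def IsPro {G : Type u} [LieRing G] [LieAlgebra ℂ G] (P : LModule G → Prop) (N : LModule G) : Prop :=
  P N ∨ ∃ S : ModuleSystem G, (∀ k, P (S.obj k)) ∧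
    ∃ f : N →ₗ⁅ℂ,G⁆ S.limit, Function.Injective f

namespace VertexLieAlgebra

variable {V : Type u} [AddCommGroup V] [Module ℂ V] (L : VertexLieAlgebra V)

/-- A smooth module of level `1` over the local Lie algebra `L(V)`: the central element `cent(-1)`
acts as the identity, and `a(n) v = 0` for `n ≫ 0`. -/
def IsSmooth (M : LModule L.Loc) : Prop :=
  (∀ v : M, ⁅L.mode L.cent (-1), v⁆ = v) ∧
    ∀ (v : M) (a : V), ∃ n₀ : ℤ, ∀ n, n₀ ≤ n → ⁅L.mode a n, v⁆ = 0

namespace CyclicAction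

variable {L} (Γ : L.CyclicAction)

/-- A smooth module of level `1 / T` over `L(V)^Γ`: the central element `cent(-1)` acts as `1 / T`,
and `a^Γ(n) v = 0` for `n ≫ 0`. -/
def IsSmooth₀ (M : LModule Γ.LocInv) : Prop :=
  (∀ v : M, ⁅Γ.centInv, v⁆ = (1 / (Γ.T : ℂ)) • v) ∧
    ∀ (v : M) (a : V), ∃ n₀ : ℤ, ∀ n, n₀ ≤ n → ⁅Γ.modeInv a n, v⁆ = 0

variable {ι : Type} [Fintype ι] [DecidableEq ι]

open scoped TensorProduct

/-- The action of `X` on the `i`-th factor of a tensor product of modules. -/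
def actAt (M : ι → LModule L.Loc) (i : ι) (X : L.Loc) : (⨂[ℂ] j, M j) →ₗ[ℂ] ⨂[ℂ] j, M j :=
  PiTensorProduct.map (Function.update (fun _ => LinearMap.id) i (LieModule.toEnd ℂ L.Loc (M i) X))

/-- The subspace `L_z^Γ . (⨂ M_{z_i})`, where an element of `L_z^Γ` acts on the `i`-th factor
through its Laurent expansion at `z_i`. -/
def coinvRel (z : ι → ℂ) (M : ι → LModule L.Loc) : Submodule ℂ (⨂[ℂ] i, M i) :=
  Submodule.span ℂ {w | ∃ X ∈ Γ.globInv z, ∃ u : ⨂[ℂ] i, M i,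
    w = ∑ i, actAt M i (L.expandAt (Γ.orbits z) (z i) X) u}

/-- The space of cyclotomic coinvariants `(⨂ M_{z_i}) / L_z^Γ`. -/
abbrev Coinv (z : ι → ℂ) (M : ι → LModule L.Loc) : Type u :=
  (⨂[ℂ] i, M i) ⧸ Γ.coinvRel z M

/-- The class `[⨂ m_i]` in the space of coinvariants. -/
def coinvClass (z : ι → ℂ) (M : ι → LModule L.Loc) (m : ∀ i, M i) : Γ.Coinv z M :=
  Submodule.Quotient.mk (PiTensorProduct.tprod ℂ m)

/-- The subspace `L_{z,0}^Γ . (⨂ M_{z_i} ⊗ M_0)`, where an element of `L_{z,0}^Γ` acts through its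
Laurent expansions at the points `z_i` and at the origin. -/
def coinvRel₀ (z : ι → ℂ) (M : ι → LModule L.Loc) (M₀ : LModule Γ.LocInv) :
    Submodule ℂ ((⨂[ℂ] i, M i) ⊗[ℂ] M₀) :=
  Submodule.span ℂ {w | ∃ X : Γ.globInv₀ z, ∃ u : (⨂[ℂ] i, M i) ⊗[ℂ] M₀,
    w = (∑ i, (actAt M i (L.expandAt (insert 0 (Γ.orbits z)) (z i) X)).rTensor M₀ u) +
      (LieModule.toEnd ℂ Γ.LocInv M₀ (Γ.expandZero z X)).lTensor (⨂[ℂ] i, M i) u}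

/-- The space of cyclotomic coinvariants `(⨂ M_{z_i} ⊗ M_0) / L_{z,0}^Γ` with a module at the
origin. -/
abbrev Coinv₀ (z : ι → ℂ) (M : ι → LModule L.Loc) (M₀ : LModule Γ.LocInv) : Type u :=
  ((⨂[ℂ] i, M i) ⊗[ℂ] M₀) ⧸ Γ.coinvRel₀ z M M₀

/-- The class `[⨂ m_i ⊗ m_0]` in the space of coinvariants with a module at the origin. -/
def coinvClass₀ (z : ι → ℂ) (M : ι → LModule L.Loc) (M₀ : LModule Γ.LocInv) (m : ∀ i, M i)
    (m₀ : M₀) : Γ.Coinv₀ z M M₀ :=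
  Submodule.Quotient.mk (PiTensorProduct.tprod ℂ m ⊗ₜ m₀)

end CyclicAction

end VertexLieAlgebra

section AddPoint

variable {G : Type u} [LieRing G] [LieAlgebra ℂ G] {N : ℕ}

/-- The family of marked points consisting of `x` and the `z_i`. -/
def addPoint (x : ℂ) (z : Fin N → ℂ) : Option (Fin N) → ℂ := fun o => o.elim x z

/-- The family of modules consisting of `M` and the `P_i`. -/
def addModule (M : LModule G) (P : Fin N → LModule G) : Option (Fin N) → LModule G :=
  fun o => o.elim M P

/-- The family of vectors consisting of `m` and the `p_i`. -/
def addVector {M : LModule G} {P : Fin N → LModule G} (m : M) (p : ∀ i, P i) :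
    ∀ o, addModule M P o
  | none => m
  | some i => p i

end AddPoint

end

noncomputable section

open scoped TensorProduct

set_option linter.unusedSectionVars false

/-! A single further marked point `y`, carrying the universal level one module F with generator vac
(`freeModule`, `vac`), already detects every nonzero vector. A linear functional on the coinvariants
of M and F is a pairing of F with M that is invariant under the global Lie algebra, so it suffices
to find an invariant pairing with nonzero value at (vac, m). Such a pairing comes from induction and
duality (`exists_invariant_pairing`).

The global Lie algebra lies in the Lie algebra H of Γ-invariant elements with vanishing total
residue (`globInv_le`, `globInv₀_le`). If the expansion of an element of H at `y` is zero, the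
element is of the form cent ⊗ f, because a rational function is determined by one Laurent series.
Its expansion at another point is then its residue times cent(-1). As residues are constant along
orbits and sum to zero, the residue on the only other orbit vanishes too (`resAt_eq_zero`). Hence
the action of H on M factors through the image of H in the local Lie algebra at `y`, and there
cent(-1) acts as -1. Induce M from this image to the whole local Lie algebra. By
Poincaré–Birkhoff–Witt, M embeds in the induced module, so some functional φ on it is nonzero at m.
On the dual of the induced module cent(-1) acts as 1, so vac ↦ φ extends to a module map from F to
this dual. Restricting functionals to M gives the pairing.

F must also be an allowed module (`isPro_freeModule`). Let J_K be the submodule generated by the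
vectors X.vac with X of degree at most -(K + 1). The quotients F / J_K are smooth, and the J_K
intersect in zero: a given vector involves finitely many basis elements of the local Lie algebra,
these stay independent modulo a deep enough step of the degree filtration, and a module induced from
that step separates the vector from J_K (`exists_notMem_deepSub`).

Both uses of induction need a PBW theorem relative to a subalgebra, which is proved by constructing
the action on `Multiset I →₀ M`, that is on Sym(G/H) ⊗ M. For a module at the origin the argument is
the same, the fixed point 0 counting T times in the residue balance. -/

/-- The data for inducing a module `M` over a Lie subalgebra of `G` to `G`: a family `b` which is a
basis of `G` modulo the subalgebra `ker coord`, and the action `θ` of that subalgebra on `M`. -/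
structure InductionData (k G I M : Type*) [CommRing k] [LieRing G] [LieAlgebra k G]
    [AddCommGroup M] [Module k M] where
  /-- the basis modulo the subalgebra -/
  b : I → G
  /-- the coordinates modulo the subalgebra -/
  coord : G →ₗ[k] (I →₀ k)
  coord_b : ∀ i, coord (b i) = Finsupp.single i 1
  coord_lie : ∀ g h, coord g = 0 → coord h = 0 → coord ⁅g, h⁆ = 0
  /-- the action, only relevant on the subalgebra -/
  θ : G →ₗ[k] Module.End k M
  θ_lie : ∀ g h, coord g = 0 → coord h = 0 → ∀ m, θ ⁅g, h⁆ m = θ g (θ h m) - θ h (θ g m)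

/-! ### Induced modules and the Poincaré–Birkhoff–Witt construction relative to a subalgebra. -/

namespace InductionData

variable {k G I M : Type*} [CommRing k] [LieRing G] [LieAlgebra k G] [LinearOrder I]
  [AddCommGroup M] [Module k M] (Q : InductionData k G I M)

/-- Multiplication by a basis element in the associated graded module. -/
def z (k : Type*) {I M : Type*} [CommRing k] [AddCommGroup M] [Module k M] (i : I) :
    (Multiset I →₀ M) →ₗ[k] (Multiset I →₀ M) :=
  Finsupp.lmapDomain M k (Multiset.cons i)

@[simp] lemma z_single (i : I) (s : Multiset I) (m : M) :
    z k i (Finsupp.single s m) = Finsupp.single (i ::ₘ s) m := by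
  simp [z]

/-- Multiplication by an element of `G` in the associated graded module. -/
def Z : G →ₗ[k] (Multiset I →₀ M) →ₗ[k] (Multiset I →₀ M) :=
  (Finsupp.linearCombination k (z k)) ∘ₗ Q.coord

@[simp] lemma Z_b (i : I) : Q.Z (Q.b i) = z k i := by simp [Z, Q.coord_b]

lemma Z_of_coord_eq_zero {g : G} (hg : Q.coord g = 0) : Q.Z g = 0 := by simp [Z, hg]

lemma Z_single (g : G) (s : Multiset I) (m : M) :
    Q.Z g (Finsupp.single s m) = (Q.coord g).sum fun i a => a • Finsupp.single (i ::ₘ s) m := by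
  rw [Z, LinearMap.comp_apply, Finsupp.linearCombination_apply, Finsupp.sum, Finsupp.sum,
    LinearMap.sum_apply]
  simp only [LinearMap.smul_apply, z_single]

lemma z_Z (i : I) (g : G) (s : Multiset I) (m : M) :
    z k i (Q.Z g (Finsupp.single s m)) = Q.Z g (Finsupp.single (i ::ₘ s) m) := by
  rw [Z_single, Z_single, Finsupp.sum, Finsupp.sum, map_sum]
  refine Finset.sum_congr rfl fun j _ => ?_
  rw [map_smul, z_single, Multiset.cons_swap]

/-- The component of an element of `G` along the basis elements up to `j`. -/
def lo (j : I) : G →ₗ[k] G :=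
  Finsupp.linearCombination k (fun i => if i ≤ j then Q.b i else 0) ∘ₗ Q.coord

/-- The component of an element of `G` complementary to `lo`. -/
def hi (j : I) : G →ₗ[k] G := LinearMap.id - Q.lo j

/-- The component of an element of `G` in the subalgebra. -/
def sub : G →ₗ[k] G := LinearMap.id - Finsupp.linearCombination k Q.b ∘ₗ Q.coord

lemma lo_add_hi (j : I) (g : G) : Q.lo j g + Q.hi j g = g := by simp [hi]

lemma lo_b_of_le {i j : I} (h : i ≤ j) : Q.lo j (Q.b i) = Q.b i := by
  simp [lo, Q.coord_b, h]

lemma hi_b_of_le {i j : I} (h : i ≤ j) : Q.hi j (Q.b i) = 0 := by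
  simp [hi, Q.lo_b_of_le h]

lemma hi_b_of_lt {i j : I} (h : j < i) : Q.hi j (Q.b i) = Q.b i := by
  simp [hi, lo, Q.coord_b, h.not_ge]

lemma coord_lo (j : I) (g : G) (i : I) :
    Q.coord (Q.lo j g) i = if i ≤ j then Q.coord g i else 0 := by
  rw [lo, LinearMap.comp_apply]
  induction Q.coord g using Finsupp.induction_linear with
  | zero => simp
  | add x y hx hy =>
    rw [map_add, map_add, Finsupp.add_apply, hx, hy]
    split_ifs <;> simp
  | single l a =>
    rw [Finsupp.linearCombination_single]
    by_cases hl : l ≤ j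
    · rw [if_pos hl, map_smul, coord_b, Finsupp.smul_single, smul_eq_mul, mul_one]
      split_ifs with hi
      · rfl
      · exact Finsupp.single_eq_of_ne (by rintro rfl; exact hi hl)
    · rw [if_neg hl, smul_zero, map_zero, Finsupp.zero_apply]
      split_ifs with hi
      · exact (Finsupp.single_eq_of_ne (by rintro rfl; exact hl hi)).symm
      · rfl

lemma coord_hi (j : I) (g : G) {i : I} (h : i ≤ j) : Q.coord (Q.hi j g) i = 0 := by
  rw [hi, LinearMap.sub_apply, map_sub, Finsupp.sub_apply, coord_lo, if_pos h]
  simp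

lemma lo_hi (j : I) (g : G) : Q.lo j (Q.hi j g) = 0 := by
  rw [lo, LinearMap.comp_apply, Finsupp.linearCombination_apply]
  refine Finset.sum_eq_zero fun i _ => ?_
  simp only
  split_ifs with h
  · rw [Q.coord_hi j g h, zero_smul]
  · simp

lemma hi_hi (j : I) (g : G) : Q.hi j (Q.hi j g) = Q.hi j g := by
  have := Q.lo_add_hi j (Q.hi j g)
  rwa [lo_hi, zero_add] at this

lemma coord_sub (g : G) : Q.coord (Q.sub g) = 0 := by
  rw [sub, LinearMap.sub_apply, map_sub, LinearMap.comp_apply, Finsupp.linearCombination_apply,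
    map_finsuppSum]
  simp [Q.coord_b]

lemma sub_b (i : I) : Q.sub (Q.b i) = 0 := by simp [sub, Q.coord_b]

lemma sub_lo (j : I) (g : G) : Q.sub (Q.lo j g) = 0 := by
  rw [lo, LinearMap.comp_apply, Finsupp.linearCombination_apply, map_finsuppSum]
  refine Finset.sum_eq_zero fun i _ => ?_
  dsimp only
  split_ifs <;> simp [sub_b]

lemma sub_of_coord_eq_zero {g : G} (hg : Q.coord g = 0) : Q.sub g = g := by simp [sub, hg]

lemma exists_min (s : Multiset I) (hs : s ≠ 0) :
    ∃ p : I × Multiset I, s = p.1 ::ₘ p.2 ∧ ∀ i ∈ p.2, p.1 ≤ i := by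
  have hne : s.toFinset.Nonempty := by simpa [Finset.nonempty_iff_ne_empty] using hs
  refine ⟨(s.toFinset.min' hne, s.erase (s.toFinset.min' hne)), ?_, fun i hi => ?_⟩
  · exact (Multiset.cons_erase (Multiset.mem_toFinset.mp (Finset.min'_mem _ _))).symm
  · exact Finset.min'_le _ _ (Multiset.mem_toFinset.mpr (Multiset.mem_of_mem_erase hi))

/-- Monomials are built by prepending a smallest index. The induction hypothesis covers all
monomials of smaller size, and not only `t`, because the correction terms of the action are
controlled by degree alone. -/
lemma multiset_induction {p : Multiset I → Prop} (h0 : p 0)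
    (hc : ∀ (j : I) (t : Multiset I), (∀ i ∈ t, j ≤ i) →
      (∀ s : Multiset I, s.card ≤ t.card → p s) → p (j ::ₘ t)) (s : Multiset I) : p s := by
  have : ∀ (n : ℕ) (s : Multiset I), s.card ≤ n → p s := by
    intro n
    induction n with
    | zero => intro s hs; rw [Multiset.card_eq_zero.mp (Nat.le_zero.mp hs)]; exact h0
    | succ n ih =>
      intro s hs
      by_cases h : s = 0
      · rw [h]; exact h0
      · obtain ⟨⟨j, t⟩, rfl, ht⟩ := exists_min s h
        simp only [Multiset.card_cons] at hs
        exact hc j t ht fun s' hs' => ih s' (by omega)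
  exact this _ s le_rfl

/-- A bilinear map given on monomials. -/
def ofMonomials (F : Multiset I → G →ₗ[k] M →ₗ[k] (Multiset I →₀ M)) :
    G →ₗ[k] (Multiset I →₀ M) →ₗ[k] (Multiset I →₀ M) :=
  (Finsupp.lsum k fun s => (F s).flip).flip

@[simp] lemma ofMonomials_single (F : Multiset I → G →ₗ[k] M →ₗ[k] (Multiset I →₀ M)) (g : G)
    (s : Multiset I) (m : M) : ofMonomials F g (Finsupp.single s m) = F s g m := by
  simp [ofMonomials]

/-- The restriction of a bilinear map to a monomial. -/
def atMonomial (A : G →ₗ[k] (Multiset I →₀ M) →ₗ[k] (Multiset I →₀ M)) (s : Multiset I) :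
    G →ₗ[k] M →ₗ[k] (Multiset I →₀ M) := A.compl₂ (Finsupp.lsingle s)

@[simp] lemma atMonomial_apply (A : G →ₗ[k] (Multiset I →₀ M) →ₗ[k] (Multiset I →₀ M))
    (s : Multiset I) (g : G) (m : M) : atMonomial A s g m = A g (Finsupp.single s m) := rfl

/-- The recursive formula for the action. -/
def stepFun (A : G →ₗ[k] (Multiset I →₀ M) →ₗ[k] (Multiset I →₀ M)) (j : I) (t : Multiset I)
    (g : G) (m : M) : Multiset I →₀ M :=
  -- Indices in `lo j g` are at most `j`, so prepending them keeps the word sorted. For `h = hi j g`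
  -- the formula expresses h b_j w = b_j h w + [h, b_j] w. Here h w is split into its leading part
  -- `Z h w`, whose new indices exceed `j` so that b_j acts by `z`, and a remainder of lower degree.
  Q.Z (Q.lo j g) (Finsupp.single (j ::ₘ t) m) +
    (z k j (Q.Z (Q.hi j g) (Finsupp.single t m)) +
      A (Q.b j) (A (Q.hi j g) (Finsupp.single t m) - Q.Z (Q.hi j g) (Finsupp.single t m)) +
      A ⁅Q.hi j g, Q.b j⁆ (Finsupp.single t m))

/-- The recursive formula for the action, as a bilinear map. -/
def step (A : G →ₗ[k] (Multiset I →₀ M) →ₗ[k] (Multiset I →₀ M)) (j : I) (t : Multiset I) :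
    G →ₗ[k] M →ₗ[k] (Multiset I →₀ M) :=
  LinearMap.mk₂ k (Q.stepFun A j t)
    (fun g g' m => by
      simp only [stepFun, map_add, LinearMap.add_apply, add_lie, map_sub]
      abel)
    (fun c g m => by
      simp only [stepFun, map_smul, LinearMap.smul_apply, smul_lie, map_sub, smul_add, smul_sub])
    (fun g m m' => by
      simp only [stepFun, map_add, Finsupp.single_add, map_sub]
      abel)
    (fun c g m => by
      simp only [stepFun, ← Finsupp.smul_single, map_smul, map_sub, smul_add, smul_sub])

/-- The action on the vectors of degree zero. -/
def base : G →ₗ[k] M →ₗ[k] (Multiset I →₀ M) :=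
  atMonomial Q.Z 0 + (Q.θ ∘ₗ Q.sub).compr₂ (Finsupp.lsingle 0)

lemma base_apply (g : G) (m : M) :
    Q.base g m = Q.Z g (Finsupp.single 0 m) + Finsupp.single 0 (Q.θ (Q.sub g) m) := by
  simp [base]

open Classical in
/-- The action on the vectors of degree up to `n`. -/
def act : ℕ → G →ₗ[k] (Multiset I →₀ M) →ₗ[k] (Multiset I →₀ M)
  -- Stage `n` is meaningful only up to degree `n`; its values on longer monomials are placeholders.
  -- Making each stage total avoids having to know, while defining the recursion, that the remainder
  -- in `stepFun` has lower degree.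
  | 0 => ofMonomials fun _ => Q.base
  | n + 1 => ofMonomials fun s =>
      if h : s.card ≤ n then atMonomial (act n) s
      else Q.step (act n) (exists_min s (by rintro rfl; simp at h)).choose.1
        (exists_min s (by rintro rfl; simp at h)).choose.2

/-- The action of `G` on the induced module. -/
def A : G →ₗ[k] (Multiset I →₀ M) →ₗ[k] (Multiset I →₀ M) :=
  ofMonomials fun s => atMonomial (Q.act s.card) s

/-- The stages are stable: once a monomial is within range, later stages copy its value. -/
lemma act_single {n : ℕ} {s : Multiset I} (h : s.card ≤ n) (g : G) (m : M) :
    Q.act n g (Finsupp.single s m) = Q.A g (Finsupp.single s m) := by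
  induction n with
  | zero => rw [A, ofMonomials_single, atMonomial_apply, Nat.le_zero.mp h]
  | succ n ih =>
    rcases Nat.lt_or_ge n s.card with h' | h'
    · rw [A, ofMonomials_single, atMonomial_apply, show s.card = n + 1 by omega]
    · rw [← ih h', act, ofMonomials_single, dif_pos h', atMonomial_apply]

/-- The vectors of degree up to `n`. -/
def fil (k I M : Type*) [CommRing k] [AddCommGroup M] [Module k M] (n : ℕ) :
    Submodule k (Multiset I →₀ M) := Finsupp.supported M k {s | s.card ≤ n}

lemma single_mem_fil {n : ℕ} {s : Multiset I} (h : s.card ≤ n) (m : M) :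
    Finsupp.single s m ∈ fil k I M n := Finsupp.single_mem_supported k m h

lemma fil_mono {n n' : ℕ} (h : n ≤ n') : fil k I M n ≤ fil k I M n' :=
  Finsupp.supported_mono fun _ hs => le_trans hs h

lemma fil_induction {n : ℕ} {p : (Multiset I →₀ M) → Prop} (h0 : p 0)
    (ha : ∀ x y, p x → p y → p (x + y))
    (hs : ∀ s m, s.card ≤ n → p (Finsupp.single s m)) {y : Multiset I →₀ M}
    (hy : y ∈ fil k I M n) : p y := by
  have hy' : ∀ s ∈ y.support, s.card ≤ n := fun s h => (Finsupp.mem_supported k y).mp hy h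
  rw [← y.sum_single]
  exact Finset.sum_induction _ p ha h0 fun s hs' => hs s _ (hy' s hs')

lemma act_eq {n : ℕ} {y : Multiset I →₀ M} (hy : y ∈ fil k I M n) (g : G) :
    Q.act n g y = Q.A g y := by
  refine fil_induction (p := fun y => Q.act n g y = Q.A g y) (by simp) (fun x y hx hy => ?_)
    (fun s m h => Q.act_single h g m) hy
  rw [map_add, map_add, hx, hy]

lemma z_mem_fil (i : I) {n : ℕ} {y : Multiset I →₀ M} (hy : y ∈ fil k I M n) :
    z k i y ∈ fil k I M (n + 1) := by
  refine fil_induction (p := fun y => z k i y ∈ fil k I M (n + 1)) (by simp) (fun x y hx hy => ?_)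
    (fun s m h => ?_) hy
  · rw [map_add]; exact Submodule.add_mem _ hx hy
  · rw [z_single]; exact single_mem_fil (by simpa using h) m

lemma Z_mem_fil (g : G) {n : ℕ} {y : Multiset I →₀ M} (hy : y ∈ fil k I M n) :
    Q.Z g y ∈ fil k I M (n + 1) := by
  rw [Z, LinearMap.comp_apply, Finsupp.linearCombination_apply, Finsupp.sum, LinearMap.sum_apply]
  exact Submodule.sum_mem _ fun i _ => Submodule.smul_mem _ _ (z_mem_fil i hy)

lemma A_zero (g : G) (m : M) : Q.A g (Finsupp.single 0 m) =
    Q.Z g (Finsupp.single 0 m) + Finsupp.single 0 (Q.θ (Q.sub g) m) := by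
  rw [A, ofMonomials_single, Multiset.card_zero, atMonomial_apply, act, ofMonomials_single,
    base_apply]

/-- Uniqueness of the smallest index makes the choice inside `act` harmless. -/
lemma cons_min_inj {j j' : I} {t t' : Multiset I} (h : j ::ₘ t = j' ::ₘ t')
    (ht : ∀ i ∈ t, j ≤ i) (ht' : ∀ i ∈ t', j' ≤ i) : j = j' ∧ t = t' := by
  have h1 : j ≤ j' := by
    have : j' ∈ j ::ₘ t := h ▸ Multiset.mem_cons_self _ _
    rcases Multiset.mem_cons.mp this with h | h
    · exact h.ge
    · exact ht _ h
  have h2 : j' ≤ j := by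
    have : j ∈ j' ::ₘ t' := h ▸ Multiset.mem_cons_self _ _
    rcases Multiset.mem_cons.mp this with h | h
    · exact h.ge
    · exact ht' _ h
  obtain rfl := le_antisymm h1 h2
  exact ⟨rfl, (Multiset.cons_inj_right j).mp h⟩

lemma A_cons_act {j : I} {t : Multiset I} (ht : ∀ i ∈ t, j ≤ i) (g : G) (m : M) :
    Q.A g (Finsupp.single (j ::ₘ t) m) = Q.stepFun (Q.act t.card) j t g m := by
  rw [A, ofMonomials_single, Multiset.card_cons, atMonomial_apply, act, ofMonomials_single,
    dif_neg (by simp)]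
  have hne : j ::ₘ t ≠ 0 := Multiset.cons_ne_zero
  obtain ⟨h1, h2⟩ := cons_min_inj (exists_min _ hne).choose_spec.1 ht
    (exists_min _ hne).choose_spec.2
  rw [← h1, ← h2]
  rfl

/-- The action agrees with the commutative multiplication up to terms of lower degree. -/
lemma A_sub_Z_mem (g : G) (s : Multiset I) (m : M) :
    Q.A g (Finsupp.single s m) - Q.Z g (Finsupp.single s m) ∈ fil k I M s.card := by
  induction s using multiset_induction generalizing g m with
  | h0 =>
    rw [A_zero, add_sub_cancel_left]
    exact single_mem_fil (by simp) _
  | hc j t ht ih =>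
    have hA : ∀ (g : G) {y : Multiset I →₀ M}, y ∈ fil k I M t.card →
        Q.A g y ∈ fil k I M (t.card + 1) := by
      intro g y hy
      have : Q.A g y - Q.Z g y ∈ fil k I M (t.card + 1) := by
        refine fil_induction (p := fun y => Q.A g y - Q.Z g y ∈ fil k I M (t.card + 1)) (by simp)
          (fun x y hx hy => ?_) (fun s m h => fil_mono (by omega) (ih s h g m)) hy
        rw [map_add, map_add, add_sub_add_comm]
        exact Submodule.add_mem _ hx hy
      rw [← sub_add_cancel (Q.A g y) (Q.Z g y)]
      exact Submodule.add_mem _ this (Q.Z_mem_fil g hy)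
    have ht' : Finsupp.single t m ∈ fil k I M t.card := single_mem_fil le_rfl m
    have hw := ih t le_rfl (Q.hi j g) m
    rw [A_cons_act Q ht, stepFun, Q.act_eq ht', Q.act_eq ht', Q.act_eq hw, z_Z, Multiset.card_cons]
    have e : Q.Z g (Finsupp.single (j ::ₘ t) m) = Q.Z (Q.lo j g) (Finsupp.single (j ::ₘ t) m) +
        Q.Z (Q.hi j g) (Finsupp.single (j ::ₘ t) m) := by
      rw [← LinearMap.add_apply, ← map_add, lo_add_hi]
    rw [e]
    -- The leading terms cancel. What is left is the action on the remainder, of degree at most that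
    -- of `t`, and the bracket term on `t`; each application raises the degree by at most one.
    have := Submodule.add_mem _ (hA (Q.b j) hw) (hA ⁅Q.hi j g, Q.b j⁆ ht')
    convert this using 1
    abel

/-- By `A_sub_Z_mem` the recursion only evaluates stages within their meaningful range, so it
becomes an identity for `A` itself. -/
lemma A_cons {j : I} {t : Multiset I} (ht : ∀ i ∈ t, j ≤ i) (g : G) (m : M) :
    Q.A g (Finsupp.single (j ::ₘ t) m) = Q.stepFun Q.A j t g m := by
  have ht' : Finsupp.single t m ∈ fil k I M t.card := single_mem_fil le_rfl m
  rw [A_cons_act Q ht, stepFun, Q.act_eq ht', Q.act_eq ht', Q.act_eq (Q.A_sub_Z_mem _ _ _), stepFun]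

/-- The PBW normal form: sorted products of the `b i`, applied to degree zero vectors, are exactly
the monomials. -/
lemma A_b {i : I} {t : Multiset I} (ht : ∀ j ∈ t, i ≤ j) (m : M) :
    Q.A (Q.b i) (Finsupp.single t m) = Finsupp.single (i ::ₘ t) m := by
  by_cases h : t = 0
  · rw [h, A_zero, sub_b, Z_b, z_single]
    simp
  · obtain ⟨⟨j, s⟩, rfl, hs⟩ := exists_min t h
    have hij := ht j (Multiset.mem_cons_self _ _)
    rw [A_cons Q hs, stepFun, Q.lo_b_of_le hij, Q.hi_b_of_le hij]
    simp

/-- The failure of the action to respect the bracket. -/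
def comm (g h : G) : (Multiset I →₀ M) →ₗ[k] (Multiset I →₀ M) :=
  Q.A g ∘ₗ Q.A h - Q.A h ∘ₗ Q.A g - Q.A ⁅g, h⁆

lemma comm_apply (g h : G) (y : Multiset I →₀ M) :
    Q.comm g h y = Q.A g (Q.A h y) - Q.A h (Q.A g y) - Q.A ⁅g, h⁆ y := rfl

lemma comm_swap (g h : G) : Q.comm h g = -Q.comm g h := by
  rw [comm, comm, ← lie_skew, map_neg]
  abel

lemma comm_add_left (g g' h : G) : Q.comm (g + g') h = Q.comm g h + Q.comm g' h := by
  refine LinearMap.ext fun y => ?_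
  simp only [comm_apply, add_lie, map_add, LinearMap.add_apply]
  abel

lemma comm_add_right (g h h' : G) : Q.comm g (h + h') = Q.comm g h + Q.comm g h' := by
  rw [comm_swap, comm_add_left, comm_swap, Q.comm_swap h' g]
  abel

lemma comm_smul_left (c : k) (g h : G) : Q.comm (c • g) h = c • Q.comm g h := by
  refine LinearMap.ext fun y => ?_
  simp only [comm_apply, smul_lie, map_smul, LinearMap.smul_apply, smul_sub]

lemma comm_zero_left (h : G) : Q.comm 0 h = 0 := by
  have := Q.comm_smul_left 0 0 h
  simpa using this

lemma comm_lo {i : I} {g h : G} {y : Multiset I →₀ M}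
    (H : ∀ j ≤ i, Q.comm (Q.b j) h y = 0) : Q.comm (Q.lo i g) h y = 0 := by
  rw [lo, LinearMap.comp_apply, Finsupp.linearCombination_apply]
  refine Finset.sum_induction _ (fun x => Q.comm x h y = 0) (fun x x' hx hx' => ?_) ?_ fun j _ => ?_
  · rw [comm_add_left, LinearMap.add_apply, hx, hx', add_zero]
  · rw [comm_zero_left, LinearMap.zero_apply]
  · rw [comm_smul_left, LinearMap.smul_apply]
    split_ifs with hj
    · rw [H j hj, smul_zero]
    · rw [comm_zero_left, LinearMap.zero_apply, smul_zero]

/-- The recursion for `A` on `i ::ₘ t` was written to make this true. It only remains to see that `b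
i` acts by `z` on the leading term, where every index is at least `i`. -/
lemma comm_hi_b {i : I} {t : Multiset I} (ht : ∀ j ∈ t, i ≤ j) (g : G) (m : M) :
    Q.comm (Q.hi i g) (Q.b i) (Finsupp.single t m) = 0 := by
  have e : Q.A (Q.b i) (Q.Z (Q.hi i g) (Finsupp.single t m)) =
      z k i (Q.Z (Q.hi i g) (Finsupp.single t m)) := by
    rw [Z_single, Finsupp.sum, map_sum, map_sum]
    refine Finset.sum_congr rfl fun j hj => ?_
    have hij : i ≤ j := by
      by_contra hc
      exact (Finsupp.mem_support_iff.mp hj) (Q.coord_hi i g (not_le.mp hc).le)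
    rw [map_smul, map_smul, A_b, z_single]
    intro l hl
    rcases Multiset.mem_cons.mp hl with rfl | hl
    · exact hij
    · exact ht l hl
  rw [comm_apply, A_b Q ht, A_cons Q ht, stepFun, lo_hi, hi_hi, map_sub, e]
  simp

/-- For the `lo` part of `g`, a pair `b j`, `b i` with `j < i` is handled by exchanging roles: `j`
is then the smallest index and `hi j` fixes `b i`, so antisymmetry reduces to `comm_hi_b`. -/
lemma comm_b {i : I} {t : Multiset I} (ht : ∀ j ∈ t, i ≤ j) (g : G) (m : M) :
    Q.comm g (Q.b i) (Finsupp.single t m) = 0 := by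
  rw [← Q.lo_add_hi i g, comm_add_left, LinearMap.add_apply, Q.comm_hi_b ht, add_zero]
  refine Q.comm_lo fun j hj => ?_
  rcases hj.lt_or_eq with hj | rfl
  · have := Q.comm_hi_b (fun l hl => hj.le.trans (ht l hl)) (Q.b i) m
    rw [Q.hi_b_of_lt hj] at this
    rw [comm_swap, LinearMap.neg_apply, this, neg_zero]
  · rw [comm_apply, lie_self]
    simp

/-- The consistency of the recursion, by induction on the degree. Components along small indices
fall to `comm_b`. For two `hi` components the monomial is written as `b j` applied to `t`, both
elements are moved past `b j`, and the Jacobi identity together with the induction hypothesis on `t`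
finishes the computation. -/
lemma comm_single (s : Multiset I) (g h : G) (m : M) : Q.comm g h (Finsupp.single s m) = 0 := by
  induction s using multiset_induction generalizing g h m with
  | h0 =>
    -- In degree zero every element is a combination of the `b i`, to which `comm_b` applies with no
    -- condition on indices, plus an element of the subalgebra, to which `θ_lie` applies.
    have hb : ∀ g h, Q.comm (Finsupp.linearCombination k Q.b (Q.coord g)) h
        (Finsupp.single 0 m) = 0 := by
      intro g h
      rw [Finsupp.linearCombination_apply]
      refine Finset.sum_induction _ (fun x => Q.comm x h (Finsupp.single 0 m) = 0)
        (fun x x' hx hx' => ?_) ?_ fun j _ => ?_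
      · rw [comm_add_left, LinearMap.add_apply, hx, hx', add_zero]
      · rw [comm_zero_left, LinearMap.zero_apply]
      · rw [comm_smul_left, LinearMap.smul_apply, comm_swap, LinearMap.neg_apply,
          Q.comm_b (by simp), neg_zero, smul_zero]
    have e : ∀ g, g = Finsupp.linearCombination k Q.b (Q.coord g) + Q.sub g := fun g => by
      simp [sub]
    have hss : Q.comm (Q.sub g) (Q.sub h) (Finsupp.single 0 m) = 0 := by
      have hA : ∀ x (m : M), Q.coord x = 0 → Q.A x (Finsupp.single 0 m) =
          Finsupp.single 0 (Q.θ x m) := fun x m hx => by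
        rw [A_zero, Q.Z_of_coord_eq_zero hx, Q.sub_of_coord_eq_zero hx]
        simp
      have hg := Q.coord_sub g
      have hh := Q.coord_sub h
      rw [comm_apply, hA _ _ hg, hA _ _ hh, hA _ _ hg, hA _ _ hh, hA _ _ (Q.coord_lie _ _ hg hh),
        Q.θ_lie _ _ hg hh]
      simp
    rw [e g, comm_add_left, LinearMap.add_apply, hb, zero_add, e h, comm_add_right,
      LinearMap.add_apply, hss, add_zero, comm_swap, LinearMap.neg_apply, hb, neg_zero]
  | hc j t ht ih =>
    have hcard : (j ::ₘ t).card = t.card + 1 := by simp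
    have hj : ∀ l ∈ j ::ₘ t, j ≤ l := fun l hl => by
      rcases Multiset.mem_cons.mp hl with rfl | hl
      · exact le_rfl
      · exact ht l hl
    have hlo : ∀ g h, Q.comm (Q.lo j g) h (Finsupp.single (j ::ₘ t) m) = 0 := fun g h =>
      Q.comm_lo fun i hi => by
        rw [comm_swap, LinearMap.neg_apply, Q.comm_b fun l hl => hi.trans (hj l hl), neg_zero]
    have ih' : ∀ g h (y : Multiset I →₀ M), y ∈ fil k I M t.card → Q.comm g h y = 0 := by
      intro g h y hy
      refine fil_induction (p := fun y => Q.comm g h y = 0) (by simp) (fun x y hx hy => ?_)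
        (fun s m hs => ih s hs _ _ _) hy
      rw [map_add, hx, hy, add_zero]
    have hhi : Q.comm (Q.hi j g) (Q.hi j h) (Finsupp.single (j ::ₘ t) m) = 0 := by
      have key : ∀ g g', Q.A (Q.hi j g) (Q.A (Q.hi j g') (Finsupp.single (j ::ₘ t) m)) =
          Q.A (Q.b j) (Q.A (Q.hi j g) (Q.A (Q.hi j g') (Finsupp.single t m))) +
          Q.A ⁅Q.hi j g, Q.b j⁆ (Q.A (Q.hi j g') (Finsupp.single t m)) +
          Q.A (Q.hi j g) (Q.A ⁅Q.hi j g', Q.b j⁆ (Finsupp.single t m)) := by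
        intro g g'
        have h1 := Q.comm_hi_b ht g' m
        rw [comm_apply, A_b Q ht, sub_sub, sub_eq_zero] at h1
        rw [h1, map_add]
        congr 1
        -- The vector has degree one more than `t`, out of reach of the induction hypothesis. Its
        -- lower order part is within reach, and its leading part consists of monomials `i ::ₘ t`
        -- with `j ≤ i`, where `comm_hi_b` applies.
        have h2 : Q.comm (Q.hi j g) (Q.b j) (Q.A (Q.hi j g') (Finsupp.single t m)) = 0 := by
          rw [← sub_add_cancel (Q.A (Q.hi j g') (Finsupp.single t m))
            (Q.Z (Q.hi j g') (Finsupp.single t m)), map_add, ih' _ _ _ (Q.A_sub_Z_mem _ _ _),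
            zero_add, Z_single, Finsupp.sum, map_sum]
          refine Finset.sum_eq_zero fun i hi => ?_
          have hij : j ≤ i := by
            by_contra hc
            exact (Finsupp.mem_support_iff.mp hi) (Q.coord_hi j g' (not_le.mp hc).le)
          rw [map_smul, Q.comm_hi_b, smul_zero]
          intro l hl
          rcases Multiset.mem_cons.mp hl with rfl | hl
          · exact hij
          · exact ht l hl
        rw [comm_apply, sub_sub, sub_eq_zero] at h2
        exact h2
      have h3 := Q.comm_b ht ⁅Q.hi j g, Q.hi j h⁆ m
      rw [comm_apply, A_b Q ht, sub_sub, sub_eq_zero] at h3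
      have ht' : Finsupp.single t m ∈ fil k I M t.card := single_mem_fil le_rfl m
      have h4 := ih' ⁅Q.hi j g, Q.b j⁆ (Q.hi j h) _ ht'
      have h5 := ih' (Q.hi j g) ⁅Q.hi j h, Q.b j⁆ _ ht'
      have h6 := ih' (Q.hi j g) (Q.hi j h) _ ht'
      have jac : ⁅⁅Q.hi j g, Q.hi j h⁆, Q.b j⁆ =
          ⁅⁅Q.hi j g, Q.b j⁆, Q.hi j h⁆ + ⁅Q.hi j g, ⁅Q.hi j h, Q.b j⁆⁆ := by
        rw [leibniz_lie (Q.hi j g) (Q.hi j h), ← lie_skew ⁅Q.hi j g, Q.b j⁆]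
        abel
      rw [jac, map_add, LinearMap.add_apply] at h3
      rw [comm_apply, sub_eq_zero] at h4 h5 h6
      rw [comm_apply, h3, ← h4, ← h5, ← h6, key, key, map_sub]
      abel
    rw [← Q.lo_add_hi j g, comm_add_left, LinearMap.add_apply, hlo, zero_add,
      ← Q.lo_add_hi j h, comm_add_right, LinearMap.add_apply, hhi, add_zero, comm_swap,
      LinearMap.neg_apply, hlo, neg_zero]

lemma A_lie (g h : G) (y : Multiset I →₀ M) :
    Q.A ⁅g, h⁆ y = Q.A g (Q.A h y) - Q.A h (Q.A g y) := by
  have : Q.comm g h = 0 := Finsupp.lhom_ext fun s m => Q.comm_single s g h m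
  have := DFunLike.congr_fun this y
  rw [comm_apply, LinearMap.zero_apply, sub_eq_zero] at this
  exact this.symm

/-- The module which is induced embeds into the induced module. -/
lemma A_single_zero {h : G} (hh : Q.coord h = 0) (m : M) :
    Q.A h (Finsupp.single 0 m) = Finsupp.single 0 (Q.θ h m) := by
  rw [A_zero, Q.Z_of_coord_eq_zero hh, Q.sub_of_coord_eq_zero hh]
  simp

/-- The induced module is generated by its vectors of degree zero. -/
lemma induction_A {p : (Multiset I →₀ M) → Prop} (h0 : ∀ m, p (Finsupp.single 0 m))
    (ha : ∀ x y, p x → p y → p (x + y)) (hr : ∀ i y, p y → p (Q.A (Q.b i) y))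
    (y : Multiset I →₀ M) : p y := by
  have hs : ∀ s m, p (Finsupp.single s m) := by
    intro s m
    induction s using multiset_induction with
    | h0 => exact h0 m
    | hc j t ht ih => rw [← Q.A_b ht]; exact hr j _ (ih t le_rfl)
  induction y using Finsupp.induction_linear with
  | zero => simpa using h0 0
  | add x y hx hy => exact ha x y hx hy
  | single s m => exact hs s m

/-- A central element acting by a scalar on the degree zero part acts by that scalar. -/
lemma A_central {c : G} (hc : ∀ g : G, ⁅c, g⁆ = 0) {a : k}
    (h0 : ∀ m, Q.A c (Finsupp.single 0 m) = a • Finsupp.single 0 m) (y : Multiset I →₀ M) :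
    Q.A c y = a • y := by
  induction y using Q.induction_A with
  | h0 m => exact h0 m
  | ha x y hx hy => rw [map_add, hx, hy, smul_add]
  | hr i y hy =>
    have : Q.A ⁅c, Q.b i⁆ y = 0 := by rw [hc]; simp
    rw [A_lie, sub_eq_zero] at this
    rw [this, hy, map_smul]

section Universal

variable {W : Type*} [AddCommGroup W] [Module k W] (ρ : G →ₗ[k] Module.End k W) (f : M →ₗ[k] W)

/-- The extension of a linear map to the induced module. -/
def extend : (Multiset I →₀ M) →ₗ[k] W :=
  Finsupp.lsum k fun s => ((s.sort (· ≤ ·)).foldr (fun i φ => ρ (Q.b i) ∘ₗ φ) f)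

lemma extend_zero (m : M) : Q.extend ρ f (Finsupp.single 0 m) = f m := by
  simp [extend]

lemma extend_cons {j : I} {t : Multiset I} (ht : ∀ i ∈ t, j ≤ i) (m : M) :
    Q.extend ρ f (Finsupp.single (j ::ₘ t) m) = ρ (Q.b j) (Q.extend ρ f (Finsupp.single t m)) := by
  simp [extend, Multiset.sort_cons _ _ _ ht]

/-- Frobenius reciprocity. The recursion defining `A` uses only the bracket relation, which `ρ` also
satisfies, so equivariance propagates from degree zero, where `hf` supplies it on the subalgebra. -/
lemma extend_A (hρ : ∀ g h w, ρ ⁅g, h⁆ w = ρ g (ρ h w) - ρ h (ρ g w))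
    (hf : ∀ h, Q.coord h = 0 → ∀ m, f (Q.θ h m) = ρ h (f m)) (g : G)
    (y : Multiset I →₀ M) : Q.extend ρ f (Q.A g y) = ρ g (Q.extend ρ f y) := by
  suffices h : ∀ s g m, Q.extend ρ f (Q.A g (Finsupp.single s m)) =
      ρ g (Q.extend ρ f (Finsupp.single s m)) by
    induction y using Finsupp.induction_linear with
    | zero => simp
    | add x y hx hy => simp only [map_add, hx, hy]
    | single s m => exact h s g m
  intro s
  -- When all new indices precede those of `s`, prepending them gives sorted words, and
  -- `extend_cons` reads off the value.
  have hZ : ∀ (s : Multiset I) (g : G) (m : M), (∀ i, Q.coord g i ≠ 0 → ∀ j ∈ s, i ≤ j) →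
      Q.extend ρ f (Q.Z g (Finsupp.single s m)) =
        ρ (Finsupp.linearCombination k Q.b (Q.coord g)) (Q.extend ρ f (Finsupp.single s m)) := by
    intro s g m hs
    rw [Z_single, Finsupp.linearCombination_apply, Finsupp.sum, Finsupp.sum, map_sum, map_sum,
      LinearMap.sum_apply]
    refine Finset.sum_congr rfl fun i hi => ?_
    rw [map_smul, map_smul, LinearMap.smul_apply, extend_cons]
    exact hs i (Finsupp.mem_support_iff.mp hi)
  induction s using multiset_induction with
  | h0 =>
    intro g m
    rw [A_zero, map_add, hZ _ _ _ (by simp), extend_zero, extend_zero, hf _ (Q.coord_sub g),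
      ← LinearMap.add_apply, ← map_add]
    simp [sub]
  | hc j t ht ih =>
    intro g m
    have ih' : ∀ g (y : Multiset I →₀ M), y ∈ fil k I M t.card →
        Q.extend ρ f (Q.A g y) = ρ g (Q.extend ρ f y) := by
      intro g y hy
      refine fil_induction (p := fun y => Q.extend ρ f (Q.A g y) = ρ g (Q.extend ρ f y)) (by simp)
        (fun x y hx hy => ?_) (fun s m hs => ih s hs _ _) hy
      simp only [map_add, hx, hy]
    have hlo : Q.extend ρ f (Q.Z (Q.lo j g) (Finsupp.single (j ::ₘ t) m)) =
        ρ (Q.lo j g) (Q.extend ρ f (Finsupp.single (j ::ₘ t) m)) := by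
      have hle : ∀ i, Q.coord (Q.lo j g) i ≠ 0 → i ≤ j := fun i hi => by
        rw [coord_lo] at hi
        by_contra hc
        exact hi (if_neg hc)
      rw [hZ _ _ _ fun i hi l hl => ?_]
      · congr 2
        have := Q.sub_lo j g
        rw [sub, LinearMap.sub_apply, sub_eq_zero] at this
        exact this.symm
      · rcases Multiset.mem_cons.mp hl with rfl | hl
        · exact hle i hi
        · exact (hle i hi).trans (ht l hl)
    have hz : Q.extend ρ f (z k j (Q.Z (Q.hi j g) (Finsupp.single t m))) =
        ρ (Q.b j) (Q.extend ρ f (Q.Z (Q.hi j g) (Finsupp.single t m))) := by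
      rw [Z_single, Finsupp.sum, map_sum, map_sum, map_sum, map_sum]
      refine Finset.sum_congr rfl fun i hi => ?_
      have hij : j ≤ i := by
        by_contra hc
        exact (Finsupp.mem_support_iff.mp hi) (Q.coord_hi j g (not_le.mp hc).le)
      rw [map_smul, map_smul, map_smul, map_smul, z_single, extend_cons]
      intro l hl
      rcases Multiset.mem_cons.mp hl with rfl | hl
      · exact hij
      · exact ht l hl
    have ht' : Finsupp.single t m ∈ fil k I M t.card := single_mem_fil le_rfl m
    rw [A_cons Q ht, stepFun, map_add, map_add, map_add, hlo, hz, ih' _ _ (Q.A_sub_Z_mem _ _ _),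
      map_sub, ih' _ _ ht', ih' _ _ ht', map_sub, hρ]
    conv_rhs => rw [← Q.lo_add_hi j g, map_add, LinearMap.add_apply]
    rw [Q.extend_cons ρ f ht]
    abel

end Universal

end InductionData

/-! ### Decomposition of the vertex Lie algebra into `ℂ cent` and the spaces `D^k Lo`. -/

namespace VertexLieAlgebra

variable {V : Type u} [AddCommGroup V] [Module ℂ V] (L : VertexLieAlgebra V)

/-- The projection onto a homogeneous component. -/
def gradeProj (d : ℕ) : V →ₗ[ℂ] V :=
  (L.grade d).subtype ∘ₗ DirectSum.component ℂ ℕ (fun n => L.grade n) d ∘ₗ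
    (LinearEquiv.ofBijective (DirectSum.coeLinearMap L.grade) L.isInternal).symm.toLinearMap

lemma gradeProj_mem (d : ℕ) (v : V) : L.gradeProj d v ∈ L.grade d := Subtype.property _

lemma gradeProj_of_mem {n : ℕ} (d : ℕ) {v : V} (hv : v ∈ L.grade n) :
    L.gradeProj d v = if n = d then v else 0 := by
  have : (LinearEquiv.ofBijective (DirectSum.coeLinearMap L.grade) L.isInternal).symm v =
      DirectSum.lof ℂ ℕ (fun n => L.grade n) n ⟨v, hv⟩ := by
    rw [LinearEquiv.symm_apply_eq]
    exact (DirectSum.coeLinearMap_lof L.grade n ⟨v, hv⟩).symm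
  rw [gradeProj, LinearMap.comp_apply, LinearMap.comp_apply, LinearEquiv.coe_coe, this]
  split_ifs with h
  · subst h
    rw [DirectSum.component.lof_self]
    rfl
  · have : DirectSum.component ℂ ℕ (fun n => L.grade n) d
        (DirectSum.lof ℂ ℕ (fun n => L.grade n) n ⟨v, hv⟩) = 0 :=
      DirectSum.of_eq_of_ne _ _ _ (Ne.symm h)
    rw [this, map_zero]

lemma grade_induction {p : V → Prop} (h0 : p 0) (ha : ∀ x y, p x → p y → p (x + y))
    (hg : ∀ d, ∀ v ∈ L.grade d, p v) (v : V) : p v := by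
  have : v ∈ ⨆ n, L.grade n := by
    rw [L.isInternal.submodule_iSup_eq_top]
    trivial
  induction this using Submodule.iSup_induction' with
  | mem d v hv => exact hg d v hv
  | zero => exact h0
  | add x y _ _ hx hy => exact ha x y hx hy

lemma gradeProj_succ_D (d : ℕ) (v : V) : L.gradeProj (d + 1) (L.D v) = L.D (L.gradeProj d v) := by
  have : L.gradeProj (d + 1) ∘ₗ L.D = L.D ∘ₗ L.gradeProj d := L.linearMap_ext_grade fun n a ha => by
    rw [LinearMap.comp_apply, LinearMap.comp_apply, L.gradeProj_of_mem _ (L.D_grade n a ha),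
      L.gradeProj_of_mem _ ha]
    by_cases h : n = d <;> simp [h]
  exact DFunLike.congr_fun this v

lemma gradeProj_zero_D (v : V) : L.gradeProj 0 (L.D v) = 0 := by
  have : L.gradeProj 0 ∘ₗ L.D = 0 := L.linearMap_ext_grade fun n a ha => by
    rw [LinearMap.comp_apply, L.gradeProj_of_mem _ (L.D_grade n a ha)]
    simp
  exact DFunLike.congr_fun this v

lemma gradeProj_Lo (d : ℕ) {v : V} (hv : v ∈ L.Lo) : L.gradeProj d v ∈ L.Lo := by
  have : (⨆ n, L.Lo ⊓ L.grade n) ≤ L.Lo.comap (L.gradeProj d) := by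
    refine iSup_le fun n a ha => ?_
    rw [Submodule.mem_comap, L.gradeProj_of_mem d ha.2]
    split_ifs
    · exact ha.1
    · exact zero_mem _
  exact this (L.Lo_homogeneous hv)

lemma exists_decomposition (v : V) : ∃ l ∈ L.Lo, ∃ (c : ℂ) (b : V), v = l + (c • L.cent + L.D b) := by
  have : v ∈ L.Lo ⊔ (Submodule.span ℂ {L.cent} ⊔ LinearMap.range L.D) := by
    rw [L.Lo_isCompl.sup_eq_top]; trivial
  obtain ⟨l, hl, m, hm, rfl⟩ := Submodule.mem_sup.mp this
  obtain ⟨x, hx, _, ⟨b, rfl⟩, rfl⟩ := Submodule.mem_sup.mp hm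
  obtain ⟨c, rfl⟩ := Submodule.mem_span_singleton.mp hx
  exact ⟨l, hl, c, b, rfl⟩

/-- The map `(l_k), c ↦ c cent + ∑ D^k l_k`. -/
def assemble : (ℕ →₀ L.Lo) × ℂ →ₗ[ℂ] V :=
  (Finsupp.lsum ℂ fun k => (L.D ^ k) ∘ₗ L.Lo.subtype).coprod (LinearMap.toSpanSingleton ℂ V L.cent)

lemma assemble_apply (l : ℕ →₀ L.Lo) (c : ℂ) :
    L.assemble (l, c) = (l.sum fun k x => (L.D ^ k) (x : V)) + c • L.cent := rfl

lemma assemble_single (k : ℕ) (l : L.Lo) (c : ℂ) :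
    L.assemble (Finsupp.single k l, c) = (L.D ^ k) l + c • L.cent := by
  rw [assemble_apply, Finsupp.sum_single_index (by simp)]

/-- The term `l 0` lies in `Lo` and in its complement, so it vanishes. The rest reads D w + c cent =
0. Since cent is not in Im D, c = 0, and then w lies in ker D = ℂ cent, which is a shorter relation
of the same form. -/
lemma eq_zero_of_sum_D_pow (n : ℕ) (l : ℕ → L.Lo) (c : ℂ)
    (h : ∑ k ∈ Finset.range n, (L.D ^ k) (l k : V) + c • L.cent = 0) :
    (∀ k < n, l k = 0) ∧ c = 0 := by
  have hc : ∀ (c : ℂ) (w : V), L.D w + c • L.cent = 0 → c = 0 := fun c w h => by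
    by_contra hc
    refine L.cent_notMem ⟨-(c⁻¹ • w), ?_⟩
    rw [map_neg, map_smul, eq_neg_of_add_eq_zero_left h, smul_neg, neg_neg, smul_smul,
      inv_mul_cancel₀ hc, one_smul]
  induction n generalizing l c with
  | zero =>
    refine ⟨by simp, hc c 0 ?_⟩
    simpa using h
  | succ n ih =>
    rw [Finset.sum_range_succ'] at h
    set w := ∑ k ∈ Finset.range n, (L.D ^ k) (l (k + 1) : V) with hw
    have e : ∑ k ∈ Finset.range n, (L.D ^ (k + 1)) (l (k + 1) : V) = L.D w := by
      rw [hw, map_sum]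
      exact Finset.sum_congr rfl fun k _ => by rw [pow_succ', Module.End.mul_apply]
    rw [e, pow_zero, Module.End.one_apply] at h
    have h0 : (l 0 : V) = 0 := by
      refine Submodule.disjoint_def.mp L.Lo_isCompl.disjoint _ (l 0).2 ?_
      have : (l 0 : V) = -(c • L.cent) + L.D (-w) := by
        rw [map_neg, eq_comm, ← sub_eq_zero, ← neg_eq_zero, ← h]
        abel
      rw [this]
      exact Submodule.add_mem _ (Submodule.mem_sup_left (Submodule.neg_mem _
        (Submodule.smul_mem _ _ (Submodule.mem_span_singleton_self _))))
        (Submodule.mem_sup_right ⟨_, rfl⟩)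
    rw [h0, add_zero] at h
    have hc0 := hc c w h
    rw [hc0, zero_smul, add_zero] at h
    have hk : w ∈ Submodule.span ℂ {L.cent} := by rw [← L.ker_D]; exact h
    obtain ⟨c', hc'⟩ := Submodule.mem_span_singleton.mp hk
    have := (ih (fun k => l (k + 1)) (-c') (by rw [← hw, ← hc', neg_smul, add_neg_cancel])).1
    refine ⟨fun k hk => ?_, hc0⟩
    cases k with
    | zero => exact Subtype.ext h0
    | succ k => exact this k (by omega)

lemma assemble_injective : Function.Injective L.assemble := by
  rw [injective_iff_map_eq_zero]
  rintro ⟨l, c⟩ h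
  rw [assemble_apply] at h
  obtain ⟨n, hn⟩ : ∃ n, l.support ⊆ Finset.range n := ⟨l.support.sup id + 1, fun k hk => by
    have : k ≤ l.support.sup id := Finset.le_sup (f := id) hk
    simpa using Nat.lt_succ_of_le this⟩
  rw [Finsupp.sum_of_support_subset _ hn _ (by simp)] at h
  obtain ⟨h1, h2⟩ := L.eq_zero_of_sum_D_pow n l c h
  refine Prod.ext (Finsupp.ext fun k => ?_) h2
  by_cases hk : k ∈ l.support
  · exact h1 k (by simpa using hn hk)
  · simpa using hk

lemma assemble_shift (l : ℕ →₀ L.Lo) (c : ℂ) :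
    L.assemble (Finsupp.mapDomain Nat.succ l, 0) = L.D (L.assemble (l, c)) := by
  rw [assemble_apply, assemble_apply, Finsupp.sum_mapDomain_index (by simp) (by simp), map_add,
    map_smul, D_cent, smul_zero, zero_smul, Finsupp.sum, Finsupp.sum, map_sum]
  congr 1
  exact Finset.sum_congr rfl fun k _ => by rw [pow_succ', Module.End.mul_apply]

/-- Induction on the degree. Projecting v = l + c cent + D b to the degree of v replaces b by a
component of degree one less, and in degree zero the term D b disappears. -/
lemma assemble_surjective : Function.Surjective L.assemble := by
  rw [← LinearMap.range_eq_top, eq_top_iff]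
  have hD : ∀ v ∈ LinearMap.range L.assemble, L.D v ∈ LinearMap.range L.assemble := by
    rintro _ ⟨⟨l, c⟩, rfl⟩
    exact ⟨_, L.assemble_shift l c⟩
  have hLo : ∀ v ∈ L.Lo, v ∈ LinearMap.range L.assemble := fun v hv =>
    ⟨(Finsupp.single 0 ⟨v, hv⟩, 0), by simp [assemble_single]⟩
  have hc : ∀ c : ℂ, c • L.cent ∈ LinearMap.range L.assemble := fun c =>
    ⟨(Finsupp.single 0 0, c), by rw [assemble_single]; simp⟩
  have hg : ∀ d, ∀ v ∈ L.grade d, v ∈ LinearMap.range L.assemble := by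
    intro d
    induction d with
    | zero =>
      intro v hv
      obtain ⟨l, hl, c, b, e⟩ := L.exists_decomposition v
      have h := L.gradeProj_of_mem 0 hv
      rw [if_pos rfl, e, map_add, map_add, gradeProj_zero_D, map_smul,
        L.gradeProj_of_mem 0 L.cent_grade, if_pos rfl, add_zero] at h
      rw [e, ← h]
      exact Submodule.add_mem _ (hLo _ (L.gradeProj_Lo 0 hl)) (hc c)
    | succ d ih =>
      intro v hv
      obtain ⟨l, hl, c, b, e⟩ := L.exists_decomposition v
      have h := L.gradeProj_of_mem (d + 1) hv
      rw [if_pos rfl, e, map_add, map_add, gradeProj_succ_D, map_smul,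
        L.gradeProj_of_mem _ L.cent_grade, if_neg (by omega), smul_zero, zero_add] at h
      rw [e, ← h]
      exact Submodule.add_mem _ (hLo _ (L.gradeProj_Lo _ hl)) (hD _ (ih _ (L.gradeProj_mem d b)))
  intro v _
  exact L.grade_induction (zero_mem _) (fun x y hx hy => Submodule.add_mem _ hx hy) hg v

/-- The decomposition of `V` into `ℂ cent` and the `D^k Lo`. -/
def assembleEquiv : ((ℕ →₀ L.Lo) × ℂ) ≃ₗ[ℂ] V :=
  LinearEquiv.ofBijective L.assemble ⟨L.assemble_injective, L.assemble_surjective⟩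

/-- The components `l_k` of a vector `c cent + ∑ D^k l_k`. -/
def comps : V →ₗ[ℂ] (ℕ →₀ L.Lo) := LinearMap.fst ℂ _ _ ∘ₗ L.assembleEquiv.symm.toLinearMap

/-- The coefficient of `cent` in a vector. -/
def eps : V →ₗ[ℂ] ℂ := LinearMap.snd ℂ _ _ ∘ₗ L.assembleEquiv.symm.toLinearMap

@[simp] lemma comps_assemble (x : (ℕ →₀ L.Lo) × ℂ) : L.comps (L.assemble x) = x.1 :=
  congrArg Prod.fst (L.assembleEquiv.symm_apply_apply x)

@[simp] lemma eps_assemble (x : (ℕ →₀ L.Lo) × ℂ) : L.eps (L.assemble x) = x.2 :=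
  congrArg Prod.snd (L.assembleEquiv.symm_apply_apply x)

lemma comps_D (v : V) : L.comps (L.D v) = Finsupp.mapDomain Nat.succ (L.comps v) := by
  obtain ⟨⟨l, c⟩, rfl⟩ := L.assemble_surjective v
  rw [← assemble_shift, comps_assemble, comps_assemble]

@[simp] lemma eps_D (v : V) : L.eps (L.D v) = 0 := by
  obtain ⟨⟨l, c⟩, rfl⟩ := L.assemble_surjective v
  rw [← assemble_shift, eps_assemble]

@[simp] lemma eps_cent : L.eps L.cent = 1 := by
  have := L.eps_assemble (0, 1)
  rwa [assemble_apply, Finsupp.sum_zero_index, zero_add, one_smul] at this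

@[simp] lemma comps_cent : L.comps L.cent = 0 := by
  have := L.comps_assemble (0, 1)
  rwa [assemble_apply, Finsupp.sum_zero_index, zero_add, one_smul] at this

@[simp] lemma comps_D_pow (k : ℕ) (l : L.Lo) : L.comps ((L.D ^ k) l) = Finsupp.single k l := by
  have := L.comps_assemble (Finsupp.single k l, 0)
  rwa [assemble_single, zero_smul, add_zero] at this

lemma eps_Lo {v : V} (hv : v ∈ L.Lo) : L.eps v = 0 := by
  have := L.eps_assemble (Finsupp.single 0 ⟨v, hv⟩, 0)
  rwa [assemble_single, zero_smul, add_zero] at this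

lemma eps_of_mem {v : V} (hv : v ∈ L.Lo ⊔ LinearMap.range L.D) : L.eps v = 0 := by
  obtain ⟨l, hl, _, ⟨b, rfl⟩, rfl⟩ := Submodule.mem_sup.mp hv
  rw [map_add, L.eps_Lo hl, eps_D, add_zero]

lemma assemble_comps (v : V) : L.assemble (L.comps v, L.eps v) = v :=
  L.assembleEquiv.apply_symm_apply v

lemma D_pow_induction {p : V → Prop} (ha : ∀ x y, p x → p y → p (x + y))
    (hc : ∀ c : ℂ, p (c • L.cent)) (hD : ∀ (k : ℕ) (l : L.Lo), p ((L.D ^ k) l)) (v : V) : p v := by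
  rw [← L.assemble_comps v, assemble_apply]
  refine ha _ _ (Finset.sum_induction _ p ha ?_ fun k _ => hD k _) (hc _)
  simpa using hc 0

/-- The components of a homogeneous vector are homogeneous. -/
lemma comps_mem_grade {d k : ℕ} {v : V} (hv : v ∈ L.grade d) (hk : (L.comps v) k ≠ 0) :
    k ≤ d ∧ ((L.comps v) k : V) ∈ L.grade (d - k) := by
  have hpow : ∀ (k e : ℕ) (v : V), L.gradeProj e ((L.D ^ k) v) =
      if k ≤ e then (L.D ^ k) (L.gradeProj (e - k) v) else 0 := by
    intro k
    induction k with
    | zero => simp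
    | succ k ih =>
      intro e v
      rw [pow_succ', Module.End.mul_apply]
      cases e with
      | zero => simp [gradeProj_zero_D]
      | succ e =>
        rw [gradeProj_succ_D, ih]
        split_ifs with h1 h2 h2
        · rw [Nat.add_sub_add_right]; rfl
        · omega
        · omega
        · simp
  let F : L.Lo →ₗ[ℂ] L.Lo :=
    (L.gradeProj (d - k)).restrict (p := L.Lo) (q := L.Lo) fun _ h => L.gradeProj_Lo _ h
  -- The decomposition is compatible with the grading, the `k`-th component dropping by `k` degrees.
  have key : ∀ v, (if k ≤ d then F else 0) ((L.comps v) k) = (L.comps (L.gradeProj d v)) k := by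
    intro v
    induction v using L.D_pow_induction with
    | ha x y hx hy => simp only [map_add, Finsupp.add_apply, hx, hy]
    | hc c =>
      rw [map_smul, map_smul, map_smul, comps_cent, L.gradeProj_of_mem d L.cent_grade]
      split_ifs <;> simp
    | hD j l =>
      have e : ∀ h : j ≤ d, L.comps ((L.D ^ j) (L.gradeProj (d - j) l)) =
          Finsupp.single j ⟨L.gradeProj (d - j) l, L.gradeProj_Lo _ l.2⟩ := fun h =>
        L.comps_D_pow j ⟨L.gradeProj (d - j) l, L.gradeProj_Lo _ l.2⟩
      rw [hpow, comps_D_pow]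
      by_cases hj : j = k
      · subst hj
        split_ifs with h
        · rw [e h, Finsupp.single_eq_same, Finsupp.single_eq_same]
          rfl
        · simp
      · rw [Finsupp.single_eq_of_ne (Ne.symm hj), map_zero]
        split_ifs with h
        · rw [e h, Finsupp.single_eq_of_ne (Ne.symm hj)]
        · simp
  have h := key v
  rw [L.gradeProj_of_mem d hv, if_pos rfl] at h
  split_ifs at h with hkd
  · refine ⟨hkd, ?_⟩
    rw [← h]
    exact L.gradeProj_mem _ _
  · exact absurd h.symm hk

section Over

variable {A : Type*} [NonUnitalCommRing A] [Module ℂ A] [IsScalarTower ℂ A A] [SMulCommClass ℂ A A]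
  (d : AlgDeriv A)

/-- The map `D^k l ⊗ f ↦ (-1)^k l ⊗ δ^k f`, `cent ⊗ f ↦ 0`. -/
def toLoAux : V ⊗[ℂ] A →ₗ[ℂ] L.Lo ⊗[ℂ] A :=
  TensorProduct.lift ((Finsupp.lsum ℂ fun k => (-1 : ℂ) ^ k •
    (TensorProduct.mk ℂ L.Lo A).compl₂ (d.toLin ^ k)) ∘ₗ L.comps)

lemma toLoAux_tmul (v : V) (f : A) : L.toLoAux d (v ⊗ₜ f) =
    (L.comps v).sum fun k l => (-1 : ℂ) ^ k • (l ⊗ₜ[ℂ] (d.toLin ^ k) f) := by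
  rw [toLoAux, TensorProduct.lift.tmul, LinearMap.comp_apply, Finsupp.lsum_apply, Finsupp.sum,
    LinearMap.sum_apply]
  rfl

lemma toLoAux_del (x : V ⊗[ℂ] A) : L.toLoAux d (L.del d x) = 0 := by
  induction x with
  | zero => simp
  | add x y hx hy => simp only [map_add, hx, hy, add_zero]
  | tmul v f =>
    rw [del, LinearMap.add_apply, LinearMap.rTensor_tmul, LinearMap.lTensor_tmul, map_add,
      toLoAux_tmul, toLoAux_tmul, comps_D, Finsupp.sum_mapDomain_index (by simp)
        (fun k l l' => by rw [TensorProduct.add_tmul, smul_add]), Finsupp.sum, Finsupp.sum,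
      ← Finset.sum_add_distrib]
    refine Finset.sum_eq_zero fun k _ => ?_
    rw [pow_succ, pow_succ, Module.End.mul_apply, mul_neg_one, ← add_smul, neg_add_cancel, zero_smul]

/-- The component in `Lo ⊗ A` of an element of `Lie_A V`. -/
def toLo : L.LieOver d →ₗ[ℂ] L.Lo ⊗[ℂ] A := L.liftRho d (L.toLoAux d) (L.toLoAux_del d)

lemma toLo_D_pow (k : ℕ) (l : L.Lo) (f : A) : L.toLo d (L.rho d ((L.D ^ k) (l : V) ⊗ₜ f)) =
    (-1 : ℂ) ^ k • (l ⊗ₜ[ℂ] (d.toLin ^ k) f) := by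
  rw [toLo, liftRho_rho, toLoAux_tmul, comps_D_pow, Finsupp.sum_single_index (by simp)]

lemma toLo_cent (f : A) : L.toLo d (L.rho d (L.cent ⊗ₜ f)) = 0 := by
  rw [toLo, liftRho_rho, toLoAux_tmul, comps_cent, Finsupp.sum_zero_index]

lemma rho_D_pow (k : ℕ) (a : V) (f : A) : L.rho d ((L.D ^ k) a ⊗ₜ f) =
    (-1 : ℂ) ^ k • L.rho d (a ⊗ₜ (d.toLin ^ k) f) := L.mkQ_D_pow d k a f

/-- Integration by parts turns every D into -δ, so modulo classes of cent ⊗ f only `Lo ⊗ A` remains.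
Together with `toLo` this shows that an element with zero `Lo` component is of the form cent ⊗ f. -/
lemma exists_eq_toLo_add (X : L.LieOver d) :
    ∃ f, X = L.rho d (L.Lo.subtype.rTensor A (L.toLo d X)) + L.rho d (L.cent ⊗ₜ f) := by
  obtain ⟨x, rfl⟩ := L.rho_surjective d X
  induction x with
  | zero => exact ⟨0, by simp⟩
  | add x y hx hy =>
    obtain ⟨f, hf⟩ := hx
    obtain ⟨g, hg⟩ := hy
    refine ⟨f + g, ?_⟩
    rw [map_add, map_add, map_add, map_add, TensorProduct.tmul_add, map_add]
    nth_rewrite 1 [hf, hg]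
    abel
  | tmul v f =>
    induction v using L.D_pow_induction with
    | ha x y hx hy =>
      obtain ⟨f₁, hf⟩ := hx
      obtain ⟨g, hg⟩ := hy
      refine ⟨f₁ + g, ?_⟩
      rw [TensorProduct.add_tmul, map_add, map_add, map_add, map_add, TensorProduct.tmul_add,
        map_add]
      nth_rewrite 1 [hf, hg]
      abel
    | hc c =>
      refine ⟨c • f, ?_⟩
      rw [TensorProduct.tmul_smul, ← TensorProduct.smul_tmul', map_smul, map_smul, toLo_cent]
      simp
    | hD k l =>
      refine ⟨0, ?_⟩
      rw [toLo_D_pow, rho_D_pow]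
      simp

end Over

/-- The residue functional on the local Lie algebra. -/
def localRes : L.Loc →ₗ[ℂ] ℂ :=
  L.liftRho laurentDeriv
    (LinearMap.mul' ℂ ℂ ∘ₗ TensorProduct.map L.eps
      { toFun := fun f : LaurentSeries ℂ => f.coeff (-1)
        map_add' := fun f g => HahnSeries.coeff_add
        map_smul' := fun c f => by simp })
    (fun x => by
      induction x with
      | zero => simp
      | add x y hx hy => simp only [map_add, hx, hy, add_zero]
      | tmul a f =>
        -- `eps` kills Im D, and a derivative has no coefficient at t^(-1).
        simp [del, laurentDeriv_coeff])

lemma localRes_rho (a : V) (f : LaurentSeries ℂ) :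
    L.localRes (L.rho laurentDeriv (a ⊗ₜ f)) = L.eps a * f.coeff (-1) := by
  rw [localRes, liftRho_rho]
  rfl

end VertexLieAlgebra

/-! ### Partial fractions and residues of rational functions. -/

section Residues

open Polynomial

/-- The rational function `1 / (t - w)`. -/
def ratPole (w : ℂ) : RatFunc ℂ := (algebraMap ℂ[X] (RatFunc ℂ) (X - C w))⁻¹

lemma ratPole_mul_ratPole {w v : ℂ} (h : w ≠ v) :
    ratPole w * ratPole v = (w - v)⁻¹ • (ratPole w - ratPole v) := by
  have hw : algebraMap ℂ[X] (RatFunc ℂ) (X - C w) ≠ 0 := RatFunc.algebraMap_ne_zero (X_sub_C_ne_zero w)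
  have hv : algebraMap ℂ[X] (RatFunc ℂ) (X - C v) ≠ 0 := RatFunc.algebraMap_ne_zero (X_sub_C_ne_zero v)
  have e : algebraMap ℂ[X] (RatFunc ℂ) (X - C v) - algebraMap ℂ[X] (RatFunc ℂ) (X - C w) =
      RatFunc.C (w - v) := by
    rw [← map_sub, sub_sub_sub_cancel_left, ← C_sub, RatFunc.algebraMap_C]
  have hwv : RatFunc.C (w - v) ≠ 0 := (_root_.map_ne_zero _).mpr (sub_ne_zero.mpr h)
  rw [RatFunc.smul_eq_C_mul, map_inv₀, eq_inv_mul_iff_mul_eq₀ hwv, ← e, ratPole, ratPole]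
  field_simp

/-- The span of the powers of the functions `1 / (t - w)` for `w ∈ S`. -/
def poleSpan (S : Set ℂ) : Submodule ℂ (RatFunc ℂ) :=
  Submodule.span ℂ {f | ∃ w ∈ S, ∃ k : ℕ, f = ratPole w ^ (k + 1)}

lemma ratPole_pow_mem {S : Set ℂ} {w : ℂ} (hw : w ∈ S) (k : ℕ) :
    ratPole w ^ (k + 1) ∈ poleSpan S := Submodule.subset_span ⟨w, hw, k, rfl⟩

lemma ratPole_mem {S : Set ℂ} {w : ℂ} (hw : w ∈ S) : ratPole w ∈ poleSpan S := by
  simpa using ratPole_pow_mem hw 0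

lemma ratPole_mul_mem {S : Set ℂ} {w : ℂ} (hw : w ∈ S) {f : RatFunc ℂ} (hf : f ∈ poleSpan S) :
    ratPole w * f ∈ poleSpan S := by
  induction hf using Submodule.span_induction with
  | zero => simp
  | add x y _ _ hx hy => rw [mul_add]; exact Submodule.add_mem _ hx hy
  | smul c x _ hx => rw [mul_smul_comm]; exact Submodule.smul_mem _ _ hx
  | mem f hf =>
    obtain ⟨v, hv, k, rfl⟩ := hf
    by_cases h : w = v
    · rw [h, ← pow_succ']
      exact ratPole_pow_mem hv (k + 1)
    · induction k with
      | zero =>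
        rw [zero_add, pow_one, ratPole_mul_ratPole h]
        exact Submodule.smul_mem _ _ (Submodule.sub_mem _ (ratPole_mem hw) (ratPole_mem hv))
      | succ k ih =>
        rw [pow_succ', ← mul_assoc, ratPole_mul_ratPole h, smul_mul_assoc, sub_mul, ← pow_succ']
        exact Submodule.smul_mem _ _ (Submodule.sub_mem _ ih (ratPole_pow_mem hv _))

lemma inv_mem_poleSpan {S : Set ℂ} (n : ℕ) (q : ℂ[X]) (hn : q.natDegree = n + 1)
    (hq : ∀ w, q.IsRoot w → w ∈ S) : (algebraMap ℂ[X] (RatFunc ℂ) q)⁻¹ ∈ poleSpan S := by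
  induction n generalizing q with
  | zero =>
    obtain ⟨w, hw⟩ := IsAlgClosed.exists_root q (by
      intro h; have := natDegree_eq_zero_iff_degree_le_zero.mpr h.le; omega)
    obtain ⟨p, rfl⟩ := dvd_iff_isRoot.mpr hw
    have hp : p ≠ 0 := by rintro rfl; simp at hn
    rw [natDegree_mul (X_sub_C_ne_zero w) hp, natDegree_X_sub_C] at hn
    obtain ⟨c, rfl⟩ := natDegree_eq_zero.mp (show p.natDegree = 0 by omega)
    rw [map_mul, mul_inv, RatFunc.algebraMap_C, ← map_inv₀ RatFunc.C c, mul_comm, ← RatFunc.smul_eq_C_mul]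
    exact Submodule.smul_mem _ _ (ratPole_mem (hq w hw))
  | succ n ih =>
    obtain ⟨w, hw⟩ := IsAlgClosed.exists_root q (by
      intro h; have := natDegree_eq_zero_iff_degree_le_zero.mpr h.le; omega)
    obtain ⟨p, rfl⟩ := dvd_iff_isRoot.mpr hw
    have hp : p ≠ 0 := by rintro rfl; simp at hn
    rw [natDegree_mul (X_sub_C_ne_zero w) hp, natDegree_X_sub_C] at hn
    rw [map_mul, mul_inv]
    exact ratPole_mul_mem (hq w hw) (ih p (by omega) fun v hv => hq v (root_mul.mpr (Or.inr hv)))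

/-- Partial fractions: rational functions vanishing at infinity are combinations of the
`1 / (t - w)^k`. -/
lemma ratFun_le_poleSpan (S : Set ℂ) : (ratFun S).toSubmodule ≤ poleSpan S := by
  rintro f ⟨p, q, hpq, hq, rfl⟩
  have key : ∀ (n : ℕ) (p q : ℂ[X]), q.natDegree = n → p.degree < q.degree →
      (∀ w, q.IsRoot w → w ∈ S) →
      algebraMap ℂ[X] (RatFunc ℂ) p / algebraMap ℂ[X] (RatFunc ℂ) q ∈ poleSpan S := by
    intro n
    induction n with
    | zero =>
      intro p q hn hpq _
      have : p = 0 := by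
        have hq0 : q ≠ 0 := by rintro rfl; simp at hpq
        rw [degree_eq_natDegree hq0, hn] at hpq
        by_contra hc
        exact absurd hpq (not_lt.mpr (zero_le_degree_iff.mpr hc))
      simp [this]
    | succ n ih =>
      intro p q hn hpq hq
      have hinv := inv_mem_poleSpan n q hn hq
      obtain ⟨w, hw⟩ := IsAlgClosed.exists_root q (by
        intro h; have := natDegree_eq_zero_iff_degree_le_zero.mpr h.le; omega)
      obtain ⟨r, rfl⟩ := dvd_iff_isRoot.mpr hw
      have hr : r ≠ 0 := by rintro rfl; simp at hn
      have hp := modByMonic_add_div p (X - C w)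
      rw [modByMonic_X_sub_C_eq_C_eval] at hp
      have hdeg : (p /ₘ (X - C w)).degree < r.degree := by
        by_cases h0 : p /ₘ (X - C w) = 0
        · rw [h0, degree_zero, bot_lt_iff_ne_bot]
          simpa using hr
        · have hle : (X - C w).degree ≤ p.degree := by
            by_contra hc
            exact h0 ((divByMonic_eq_zero_iff (monic_X_sub_C w)).mpr (not_le.mp hc))
          have h2 := degree_add_divByMonic (monic_X_sub_C w) hle
          rw [← h2, degree_mul] at hpq
          exact lt_of_add_lt_add_left hpq
      have hw0 : algebraMap ℂ[X] (RatFunc ℂ) (X - C w) ≠ 0 :=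
        RatFunc.algebraMap_ne_zero (X_sub_C_ne_zero w)
      have hr0 : algebraMap ℂ[X] (RatFunc ℂ) r ≠ 0 := RatFunc.algebraMap_ne_zero hr
      rw [natDegree_mul (X_sub_C_ne_zero w) hr, natDegree_X_sub_C] at hn
      have h3 := ih _ r (by omega) hdeg fun v hv => hq v (root_mul.mpr (Or.inr hv))
      -- Dividing the numerator by a linear factor t - w of the denominator leaves the constant p(w)
      -- over the full denominator, plus a fraction with denominator of smaller degree.
      have e : algebraMap ℂ[X] (RatFunc ℂ) p / algebraMap ℂ[X] (RatFunc ℂ) ((X - C w) * r) =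
          (p.eval w) • (algebraMap ℂ[X] (RatFunc ℂ) ((X - C w) * r))⁻¹ +
          algebraMap ℂ[X] (RatFunc ℂ) (p /ₘ (X - C w)) / algebraMap ℂ[X] (RatFunc ℂ) r := by
        conv_lhs => rw [← hp]
        rw [map_add, map_mul, map_mul, RatFunc.algebraMap_C, RatFunc.smul_eq_C_mul]
        field_simp
      rw [e]
      exact Submodule.add_mem _ (Submodule.smul_mem _ _ hinv) h3
  exact key _ p q rfl hpq hq

lemma laurentExpand_algebraMap (w : ℂ) (p : ℂ[X]) :
    laurentExpand w (algebraMap ℂ[X] (RatFunc ℂ) p) =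
      HahnSeries.ofPowerSeries ℤ ℂ ((p.comp (X + C w) : ℂ[X]) : PowerSeries ℂ) := by
  refine (substPoly_algebraMap (LaurentSeries ℂ) (X + C w) (by simp) p).trans ?_
  rw [algebraMap_laurent]

lemma laurentExpand_inv (w : ℂ) (f : RatFunc ℂ) : laurentExpand w f⁻¹ = (laurentExpand w f)⁻¹ :=
  map_inv₀ (substPoly (LaurentSeries ℂ) (X + C w) (by simp)) f

lemma laurentExpand_pow (w : ℂ) (f : RatFunc ℂ) (n : ℕ) :
    laurentExpand w (f ^ n) = laurentExpand w f ^ n :=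
  map_pow (substPoly (LaurentSeries ℂ) (X + C w) (by simp)) f n

lemma laurentExpand_injective (w : ℂ) : Function.Injective (laurentExpand w) :=
  (substPoly (LaurentSeries ℂ) (X + C w) (by simp)).injective

lemma laurentExpand_ratPole_self (w : ℂ) :
    laurentExpand w (ratPole w) = HahnSeries.single (-1 : ℤ) 1 := by
  rw [ratPole, laurentExpand_inv, laurentExpand_algebraMap]
  have : ((X - C w).comp (X + C w) : ℂ[X]) = X := by simp
  rw [this, coe_X, HahnSeries.ofPowerSeries_X]
  refine inv_eq_of_mul_eq_one_right ?_
  rw [HahnSeries.single_mul_single]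
  simp

lemma laurentExpand_ratPole_of_ne {w v : ℂ} (h : w ≠ v) :
    ∃ P : PowerSeries ℂ, laurentExpand w (ratPole v) = HahnSeries.ofPowerSeries ℤ ℂ P := by
  rw [ratPole, laurentExpand_inv, laurentExpand_algebraMap]
  set Q : PowerSeries ℂ := (((X - C v).comp (X + C w) : ℂ[X]) : PowerSeries ℂ) with hQ
  have hQ0 : PowerSeries.constantCoeff Q ≠ 0 := by
    rw [hQ, ← PowerSeries.coeff_zero_eq_constantCoeff_apply, coeff_coe]
    simpa [sub_eq_zero] using h
  refine ⟨Q⁻¹, inv_eq_of_mul_eq_one_right ?_⟩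
  rw [← map_mul, PowerSeries.mul_inv_cancel _ hQ0, map_one]

/-- The residue of a rational function. -/
def ratRes (w : ℂ) : RatFunc ℂ →ₗ[ℂ] ℂ where
  toFun f := (laurentExpand w f).coeff (-1)
  map_add' f g := by simp
  map_smul' c f := by simp

lemma ratRes_apply (w : ℂ) (f : RatFunc ℂ) : ratRes w f = (laurentExpand w f).coeff (-1) := rfl

lemma ratRes_ratPole_pow (w v : ℂ) (k : ℕ) :
    ratRes w (ratPole v ^ (k + 1)) = if w = v ∧ k = 0 then 1 else 0 := by
  rw [ratRes_apply, laurentExpand_pow]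
  by_cases h : w = v
  · subst h
    rw [laurentExpand_ratPole_self, HahnSeries.single_pow, HahnSeries.coeff_single]
    simp only [one_pow, true_and]
    refine if_congr ?_ rfl rfl
    simp only [nsmul_eq_mul]
    push_cast
    omega
  · obtain ⟨P, hP⟩ := laurentExpand_ratPole_of_ne h
    rw [hP, ← map_pow, HahnSeries.ofPowerSeries_apply, HahnSeries.embDomain_of_notMem_range]
    · simp [h]
    · rintro ⟨n, hn⟩
      simp at hn

/-- The sum of the residues of a rational function at the points of a finite set. -/
def sumRes (S : Finset ℂ) : RatFunc ℂ →ₗ[ℂ] ℂ := ∑ w ∈ S, ratRes w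

lemma sumRes_apply (S : Finset ℂ) (f : RatFunc ℂ) : sumRes S f = ∑ w ∈ S, ratRes w f := by
  simp [sumRes]

lemma sumRes_ratPole_pow {S : Finset ℂ} {v : ℂ} (hv : v ∈ S) (k : ℕ) :
    sumRes S (ratPole v ^ (k + 1)) = if k = 0 then 1 else 0 := by
  rw [sumRes_apply, Finset.sum_eq_single_of_mem v hv]
  · rw [ratRes_ratPole_pow]; simp
  · intro w _ hw
    rw [ratRes_ratPole_pow]; simp [hw]

/-- Each factor vanishes at infinity, so the product decays like t^(-2) and has no residue there.
Algebraically, for w ≠ v the partial fraction identity lowers the total exponent, until the equal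
residues of two simple poles cancel. -/
lemma sumRes_pow_mul_pow {S : Finset ℂ} {w v : ℂ} (hw : w ∈ S) (hv : v ∈ S) (k l : ℕ) :
    sumRes S (ratPole w ^ (k + 1) * ratPole v ^ (l + 1)) = 0 := by
  by_cases h : w = v
  · subst h
    rw [← pow_add, show k + 1 + (l + 1) = (k + l + 1) + 1 by ring, sumRes_ratPole_pow hw]
    simp
  · have e : ∀ k l, sumRes S (ratPole w ^ (k + 1) * ratPole v ^ (l + 1)) = (w - v)⁻¹ *
        (sumRes S (ratPole w ^ (k + 1) * ratPole v ^ l) -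
          sumRes S (ratPole w ^ k * ratPole v ^ (l + 1))) := fun k l => by
      rw [← map_sub, ← smul_eq_mul (a := (w - v)⁻¹), ← map_smul]
      congr 1
      have := ratPole_mul_ratPole h
      rw [pow_succ, pow_succ, mul_mul_mul_comm, this, mul_smul_comm]
      congr 1
      ring
    have : ∀ n k l, k + l = n →
        sumRes S (ratPole w ^ (k + 1) * ratPole v ^ (l + 1)) = 0 := by
      intro n
      induction n with
      | zero =>
        intro k l hkl
        obtain ⟨rfl, rfl⟩ : k = 0 ∧ l = 0 := by omega
        rw [e, pow_zero, pow_zero, mul_one, one_mul, sumRes_ratPole_pow hw, sumRes_ratPole_pow hv]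
        simp
      | succ n ih =>
        intro k l hkl
        have h1 : sumRes S (ratPole w ^ (k + 1) * ratPole v ^ l) = if k + l = 0 then 1 else 0 := by
          cases l with
          | zero => rw [pow_zero, mul_one, sumRes_ratPole_pow hw]; simp
          | succ l => rw [ih k l (by omega)]; simp
        have h2 : sumRes S (ratPole w ^ k * ratPole v ^ (l + 1)) = if k + l = 0 then 1 else 0 := by
          cases k with
          | zero => rw [pow_zero, one_mul, sumRes_ratPole_pow hv]; simp
          | succ k => rw [ih k l (by omega)]; simp
        rw [e, h1, h2, sub_self, mul_zero]
    exact this _ k l rfl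

/-- The residue theorem for products of functions vanishing at infinity. -/
lemma sumRes_mul {S : Finset ℂ} {f g : RatFunc ℂ} (hf : f ∈ poleSpan (S : Set ℂ))
    (hg : g ∈ poleSpan (S : Set ℂ)) : sumRes S (f * g) = 0 := by
  induction hf using Submodule.span_induction with
  | zero => simp
  | add x y _ _ hx hy => rw [add_mul, map_add, hx, hy, add_zero]
  | smul c x _ hx => rw [smul_mul_assoc, map_smul, hx, smul_zero]
  | mem f hf =>
    obtain ⟨w, hw, k, rfl⟩ := hf
    induction hg using Submodule.span_induction with
    | zero => simp
    | add x y _ _ hx hy => rw [mul_add, map_add, hx, hy, add_zero]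
    | smul c x _ hx => rw [mul_smul_comm, map_smul, hx, smul_zero]
    | mem g hg =>
      obtain ⟨v, hv, l, rfl⟩ := hg
      exact sumRes_pow_mul_pow hw hv k l

lemma laurentExpand_C (w a : ℂ) : laurentExpand w (RatFunc.C a) = HahnSeries.C a := by
  rw [← RatFunc.algebraMap_C, laurentExpand_algebraMap]
  simp

lemma laurentScale_one (β : ℂ) (hβ : β ≠ 0) : laurentScale β hβ 1 = 1 := by
  ext n
  rw [laurentScale_coeff, HahnSeries.coeff_one]
  by_cases h : n = 0 <;> simp [h]

lemma ratScale_algebraMap (β : ℂ) (hβ : β ≠ 0) (p : ℂ[X]) :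
    ratScale β hβ (algebraMap ℂ[X] (RatFunc ℂ) p) =
      algebraMap ℂ[X] (RatFunc ℂ) (p.comp (C β * X)) :=
  substPoly_algebraMap (RatFunc ℂ) (C β * X) (by simp [hβ]) p

/-- Expanding `f(β t)` at `w` is expanding `f` at `β w`. -/
lemma laurentExpand_ratScale_at (β : ℂ) (hβ : β ≠ 0) (w : ℂ) (f : RatFunc ℂ) :
    laurentExpand w (ratScale β hβ f) = laurentScale β hβ (laurentExpand (β * w) f) := by
  let S : LaurentSeries ℂ →+* LaurentSeries ℂ :=
    { toFun := laurentScale β hβ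
      map_one' := laurentScale_one β hβ
      map_mul' := map_mul _
      map_zero' := map_zero _
      map_add' := map_add _ }
  have key : (substPoly (LaurentSeries ℂ) (X + C w) (by simp)).comp
      (substPoly (RatFunc ℂ) (C β * X) (by simp [hβ])) =
        S.comp (substPoly (LaurentSeries ℂ) (X + C (β * w))
          (by rw [natDegree_X_add_C]; exact one_ne_zero)) := by
    apply ratFunc_ringHom_ext
    · change laurentExpand w (ratScale β hβ RatFunc.X) =
        laurentScale β hβ (laurentExpand (β * w) RatFunc.X)
      rw [laurentExpand_X, ← RatFunc.algebraMap_X, ratScale_algebraMap, laurentExpand_algebraMap]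
      ext n
      rw [laurentScale_coeff]
      simp only [X_comp, mul_comp, C_comp, mul_add, coe_add, coe_mul, coe_C, coe_X, map_add,
        map_mul, HahnSeries.ofPowerSeries_C, HahnSeries.ofPowerSeries_X, HahnSeries.coeff_add,
        HahnSeries.coeff_single,
        HahnSeries.C_apply]
      by_cases h : n = 1
      · subst h; simp
      · by_cases h' : n = 0 <;> simp [h, h']
    · intro a
      change laurentExpand w (ratScale β hβ (RatFunc.C a)) =
        laurentScale β hβ (laurentExpand (β * w) (RatFunc.C a))
      rw [← RatFunc.algebraMap_C, ratScale_algebraMap, C_comp, RatFunc.algebraMap_C,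
        laurentExpand_C, laurentExpand_C]
      ext n
      rw [laurentScale_coeff]
      simp only [HahnSeries.C_apply, HahnSeries.coeff_single]
      by_cases h : n = 0 <;> simp [h]
  exact DFunLike.congr_fun key f

lemma ratScale_ratPole (β : ℂ) (hβ : β ≠ 0) (w : ℂ) :
    ratScale β hβ (ratPole w) = β⁻¹ • ratPole (β⁻¹ * w) := by
  have h1 : ratScale β hβ (ratPole w) =
      (ratScale β hβ (algebraMap ℂ[X] (RatFunc ℂ) (X - C w)))⁻¹ :=
    map_inv₀ (substPoly (RatFunc ℂ) (C β * X) (by simp [hβ])) _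
  have h2 : ((X - C w).comp (C β * X) : ℂ[X]) = C β * (X - C (β⁻¹ * w)) := by
    rw [sub_comp, X_comp, C_comp, mul_sub, ← C_mul, mul_inv_cancel_left₀ hβ]
  rw [h1, ratScale_algebraMap, h2, map_mul, mul_inv, RatFunc.algebraMap_C, ← map_inv₀,
    RatFunc.smul_eq_C_mul, ratPole]

lemma coe_simplePole (S : Set ℂ) (w : ℂ) (hw : w ∈ S) : (simplePole S w hw : RatFunc ℂ) = ratPole w := by
  simp [simplePole, ratPole]

end Residues

/-! ### Global Lie algebras: expansions, residues and invariants. -/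

namespace VertexLieAlgebra

variable {V : Type u} [AddCommGroup V] [Module ℂ V] (L : VertexLieAlgebra V)

lemma expandAt_coe_pow (S : Set ℂ) (w : ℂ) (k : ℕ) (f : ratFun S) :
    laurentExpand w (((ratFunDeriv S).toLin ^ k) f : ratFun S) =
      (laurentDeriv.toLin ^ k) (laurentExpand w f) := by
  induction k generalizing f with
  | zero => simp
  | succ k ih =>
    rw [pow_succ, pow_succ, Module.End.mul_apply, Module.End.mul_apply, ih, laurentExpand_deriv]
    rfl

/-- Laurent expansion is a homomorphism of Lie algebras. -/
lemma expandAt_lie (S : Set ℂ) (w : ℂ) (X Y : L.Glob S) :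
    L.expandAt S w ⁅X, Y⁆ = ⁅L.expandAt S w X, L.expandAt S w Y⁆ := by
  obtain ⟨x, rfl⟩ := L.rho_surjective _ X
  obtain ⟨y, rfl⟩ := L.rho_surjective _ Y
  induction x with
  | zero => simp
  | add x₁ x₂ h₁ h₂ => simp only [map_add, add_lie, h₁, h₂]
  | tmul a f =>
  induction y with
  | zero => simp
  | add x₁ x₂ h₁ h₂ => simp only [map_add, lie_add, h₁, h₂]
  | tmul b g =>
    obtain ⟨N, hN⟩ := L.locality a b
    rw [expandAt_rho, expandAt_rho, lie_rho, lie_rho, L.brk_tmul _ a b _ _ hN,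
      L.brk_tmul _ a b _ _ hN, map_sum, map_sum, map_sum]
    refine Finset.sum_congr rfl fun n _ => ?_
    rw [map_smul, map_smul, map_smul, expandAt_rho, NonUnitalSubalgebra.coe_mul, laurentExpand_mul,
      expandAt_coe_pow]

/-- The residue at a point of an element of a global Lie algebra. -/
def resAt (S : Set ℂ) (w : ℂ) : L.Glob S →ₗ[ℂ] ℂ := L.localRes ∘ₗ L.expandAt S w

lemma resAt_rho (S : Set ℂ) (w : ℂ) (a : V) (f : ratFun S) :
    L.resAt S w (L.rho (ratFunDeriv S) (a ⊗ₜ f)) = L.eps a * ratRes w f := by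
  rw [resAt, LinearMap.comp_apply, expandAt_rho, localRes_rho]
  rfl

/-- The sum of all residues of an element of a global Lie algebra. -/
def globRes {S : Set ℂ} (hS : S.Finite) : L.Glob S →ₗ[ℂ] ℂ := ∑ w ∈ hS.toFinset, L.resAt S w

lemma globRes_apply {S : Set ℂ} (hS : S.Finite) (X : L.Glob S) :
    L.globRes hS X = ∑ w ∈ hS.toFinset, L.resAt S w X := by
  simp [globRes]

lemma globRes_rho {S : Set ℂ} (hS : S.Finite) (a : V) (f : ratFun S) :
    L.globRes hS (L.rho (ratFunDeriv S) (a ⊗ₜ f)) = L.eps a * sumRes hS.toFinset f := by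
  rw [globRes_apply, sumRes_apply, Finset.mul_sum]
  exact Finset.sum_congr rfl fun w _ => L.resAt_rho S w a f

lemma mem_poleSpan {S : Set ℂ} (hS : S.Finite) (f : ratFun S) :
    (f : RatFunc ℂ) ∈ poleSpan (hS.toFinset : Set ℂ) := by
  rw [Set.Finite.coe_toFinset]
  exact ratFun_le_poleSpan S f.2

/-- Each term of the bracket carries a product (δ^n f) g of two functions vanishing at infinity, so
`sumRes_mul` applies. This makes `globResInv` a Lie subalgebra with no quotient by an ideal. -/
lemma globRes_lie {S : Set ℂ} (hS : S.Finite) (X Y : L.Glob S) : L.globRes hS ⁅X, Y⁆ = 0 := by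
  obtain ⟨x, rfl⟩ := L.rho_surjective _ X
  obtain ⟨y, rfl⟩ := L.rho_surjective _ Y
  induction x with
  | zero => simp
  | add x₁ x₂ h₁ h₂ => simp only [map_add, add_lie, h₁, h₂, add_zero]
  | tmul a f =>
  induction y with
  | zero => simp
  | add x₁ x₂ h₁ h₂ => simp only [map_add, lie_add, h₁, h₂, add_zero]
  | tmul b g =>
    obtain ⟨N, hN⟩ := L.locality a b
    rw [lie_rho, L.brk_tmul _ a b _ _ hN, map_sum, map_sum]
    refine Finset.sum_eq_zero fun n _ => ?_
    rw [map_smul, map_smul, globRes_rho, NonUnitalSubalgebra.coe_mul,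
      sumRes_mul (mem_poleSpan hS _) (mem_poleSpan hS _), mul_zero, smul_zero]

lemma globRes_centPole {S : Set ℂ} (hS : S.Finite) (w : ℂ) (hw : w ∈ S) :
    L.globRes hS (L.centPole S w hw) = 1 := by
  have := sumRes_ratPole_pow (S := hS.toFinset) (v := w) (by simpa using hw) 0
  rw [zero_add, pow_one, if_pos rfl] at this
  rw [centPole, globRes_rho, coe_simplePole, this, eps_cent, one_mul]

lemma expandAt_centPole (S : Set ℂ) (w v : ℂ) (hv : v ∈ S) : L.expandAt S w (L.centPole S v hv) =
    (if w = v then (1 : ℂ) else 0) • L.mode L.cent (-1) := by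
  have := ratRes_ratPole_pow w v 0
  rw [zero_add, pow_one, ratRes_apply] at this
  rw [centPole, expandAt_rho, rho_cent, coe_simplePole, this]
  simp

lemma resAt_globLo {S : Set ℂ} (w : ℂ) {X : L.Glob S} (hX : X ∈ L.globLo S) :
    L.resAt S w X = 0 := by
  obtain ⟨_, ⟨x, rfl⟩, rfl⟩ := hX
  induction x with
  | zero => simp
  | add x y hx hy => rw [map_add, map_add, map_add, hx, hy, add_zero]
  | tmul l f =>
    rw [LinearMap.rTensor_tmul, Submodule.subtype_apply, resAt_rho, L.eps_Lo l.2, zero_mul]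

lemma toLo_expandAt (S : Set ℂ) (w : ℂ) (X : L.Glob S) : L.toLo laurentDeriv (L.expandAt S w X) =
    (laurentExpand w ∘ₗ (ratFun S).toSubmodule.subtype).lTensor L.Lo (L.toLo (ratFunDeriv S) X) := by
  obtain ⟨x, rfl⟩ := L.rho_surjective _ X
  induction x with
  | zero => simp
  | add x y hx hy => simp only [map_add, hx, hy]
  | tmul v f =>
    induction v using L.D_pow_induction with
    | ha x y hx hy => simp only [TensorProduct.add_tmul, map_add, hx, hy]
    | hc c =>
      rw [← TensorProduct.smul_tmul', map_smul, map_smul, map_smul, expandAt_rho, toLo_cent,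
        map_smul, toLo_cent]
      simp
    | hD k l =>
      rw [expandAt_rho, toLo_D_pow, toLo_D_pow, map_smul, LinearMap.lTensor_tmul,
        ← expandAt_coe_pow]
      rfl

/-- An element of a global Lie algebra whose expansion at one point vanishes is central. -/
lemma exists_of_expandAt_eq_zero {S : Set ℂ} {w : ℂ} {X : L.Glob S} (h : L.expandAt S w X = 0) :
    ∃ f, X = L.rho (ratFunDeriv S) (L.cent ⊗ₜ f) := by
  have h1 := L.toLo_expandAt S w X
  rw [h, map_zero] at h1
  -- A rational function is determined by one of its Laurent series, and tensoring with `Lo` over a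
  -- field preserves injectivity; so the whole `Lo` component vanishes.
  have hinj : Function.Injective (laurentExpand w ∘ₗ (ratFun S).toSubmodule.subtype) :=
    (laurentExpand_injective w).comp Subtype.val_injective
  have h2 : L.toLo (ratFunDeriv S) X = 0 :=
    (injective_iff_map_eq_zero _).mp
      (Module.Flat.lTensor_preserves_injective_linearMap (M := L.Lo) _ hinj) _ h1.symm
  obtain ⟨f, hf⟩ := L.exists_eq_toLo_add (ratFunDeriv S) X
  rw [h2, map_zero, map_zero, zero_add] at hf
  exact ⟨f, hf⟩

/-- Such an element is cent ⊗ f, and by `rho_cent` only the residue of f survives in the local Lie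
algebra. -/
lemma expandAt_eq_resAt_smul {S : Set ℂ} {v : ℂ} {X : L.Glob S} (h : L.expandAt S v X = 0) (w : ℂ) :
    L.expandAt S w X = L.resAt S w X • L.mode L.cent (-1) := by
  obtain ⟨f, rfl⟩ := L.exists_of_expandAt_eq_zero h
  rw [expandAt_rho, rho_cent, resAt_rho, eps_cent, one_mul]
  rfl

namespace CyclicAction

variable {L} (Γ : L.CyclicAction)

/-- `R` fixes cent and preserves `Lo + Im D`, the kernel of `eps`. -/
lemma eps_R (v : V) : L.eps (Γ.R v) = L.eps v := by
  induction v using L.D_pow_induction with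
  | ha x y hx hy => simp only [map_add, hx, hy]
  | hc c => rw [map_smul, R_cent]
  | hD k l =>
    have hm : (L.D ^ k) (l : V) ∈ L.Lo ⊔ LinearMap.range L.D := by
      cases k with
      | zero => exact Submodule.mem_sup_left l.2
      | succ k => exact Submodule.mem_sup_right ⟨_, by rw [pow_succ', Module.End.mul_apply]⟩
    rw [L.eps_of_mem hm, L.eps_of_mem (Γ.R_Lo hm)]

/-- Rescaling the coordinate by ω⁻¹ multiplies a residue by ω, which the prefactor ω⁻¹ of the action
cancels. The generator therefore just permutes residues along orbits. -/
lemma resAt_twistGlob (S : Set ℂ) (hS : ∀ w, Γ.ω⁻¹ * w ∈ S → w ∈ S) (w : ℂ) (X : L.Glob S) :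
    L.resAt S w (Γ.twistGlob S hS X) = L.resAt S (Γ.ω⁻¹ * w) X := by
  obtain ⟨x, rfl⟩ := L.rho_surjective _ X
  induction x with
  | zero => simp
  | add x y hx hy => simp only [map_add, hx, hy]
  | tmul a f =>
    rw [twistGlob, twist_rho, twistT_tmul, map_smul, map_smul, resAt_rho, resAt_rho, eps_R]
    have : ratRes w ((ratFunScaleMap S Γ.ω⁻¹ Γ.ω_inv_ne_zero hS).toHom f : ratFun S) =
        Γ.ω⁻¹ ^ (-1 : ℤ) * ratRes (Γ.ω⁻¹ * w) f := by
      rw [ratRes_apply, ratRes_apply, ← laurentScale_coeff Γ.ω⁻¹ Γ.ω_inv_ne_zero,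
        ← laurentExpand_ratScale_at]
      rfl
    rw [this, smul_eq_mul]
    have := Γ.ω_ne_zero
    simp only [zpow_neg, zpow_one, inv_inv]
    field_simp

lemma twistGlob_centPole (S : Set ℂ) (hS : ∀ w, Γ.ω⁻¹ * w ∈ S → w ∈ S) (w : ℂ) (hw : w ∈ S)
    (hw' : Γ.ω * w ∈ S) :
    Γ.twistGlob S hS (L.centPole S w hw) = L.centPole S (Γ.ω * w) hw' := by
  rw [centPole, twistGlob, twist_rho, twistT_tmul, R_cent, centPole, ← TensorProduct.tmul_smul]
  congr 2
  refine Subtype.ext ?_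
  change Γ.ω⁻¹ • ratScale Γ.ω⁻¹ Γ.ω_inv_ne_zero (simplePole S w hw : RatFunc ℂ) = _
  rw [coe_simplePole, coe_simplePole, ratScale_ratPole, inv_inv, smul_smul,
    inv_mul_cancel₀ Γ.ω_ne_zero, one_smul]

lemma twistGlob_pow_T (S : Set ℂ) (hS : ∀ w, Γ.ω⁻¹ * w ∈ S → w ∈ S) (X : L.Glob S) :
    ((Γ.twistGlob S hS)^[Γ.T]) X = X := by
  obtain ⟨x, rfl⟩ := L.rho_surjective _ X
  set s := ratFunScaleMap S Γ.ω⁻¹ Γ.ω_inv_ne_zero hS with hs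
  have h1 : ∀ k : ℕ, ((Γ.twistGlob S hS)^[k]) (L.rho (ratFunDeriv S) x) =
      L.rho (ratFunDeriv S) ((Γ.twistT s ^ k) x) := by
    intro k
    induction k with
    | zero => simp
    | succ k ih =>
      rw [Function.iterate_succ_apply', ih, pow_succ', Module.End.mul_apply]
      exact Γ.twist_rho _ _
  -- Rational functions are compared through their expansions at the origin, where rescaling
  -- multiplies the coefficient of t^n by ω^(-n).
  have h2 : (s.toHom : ratFun S →ₗ[ℂ] ratFun S) ^ Γ.T = 1 := by
    have : ∀ (k : ℕ) (f : ratFun S) (n : ℤ),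
        (laurentExpand 0 (((s.toHom : ratFun S →ₗ[ℂ] ratFun S) ^ k) f : ratFun S)).coeff n =
          (Γ.ω⁻¹ ^ n) ^ k * (laurentExpand 0 (f : RatFunc ℂ)).coeff n := by
      intro k f n
      induction k with
      | zero => simp
      | succ k ih =>
        rw [pow_succ', Module.End.mul_apply]
        change (laurentExpand 0 (ratScale Γ.ω⁻¹ Γ.ω_inv_ne_zero _)).coeff n = _
        rw [laurentExpand_ratScale, laurentScale_coeff, ih, pow_succ']
        ring
    refine LinearMap.ext fun f => Subtype.ext (laurentExpand_injective 0 ?_)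
    ext n
    rw [this, ← zpow_natCast, ← zpow_mul, mul_comm n, zpow_mul, zpow_natCast, inv_pow,
      Γ.isPrimitiveRoot.pow_eq_one]
    simp
  rw [h1, twistT, smul_pow, TensorProduct.map_pow, h2, R_pow_T, inv_pow,
    Γ.isPrimitiveRoot.pow_eq_one]
  simp

/-- If `X` is fixed by the generator modulo fixed vectors then it is fixed. -/
lemma twistGlob_eq_of_sub_fixed (S : Set ℂ) (hS : ∀ w, Γ.ω⁻¹ * w ∈ S → w ∈ S) {X : L.Glob S}
    (h : Γ.twistGlob S hS (Γ.twistGlob S hS X - X) = Γ.twistGlob S hS X - X) :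
    Γ.twistGlob S hS X = X := by
  set Y := Γ.twistGlob S hS X - X with hY
  -- The generator acts unipotently on the span of X and Y but has finite order, so T Y = 0 and Y =
  -- 0 over ℂ.
  have h1 : ∀ k : ℕ, ((Γ.twistGlob S hS)^[k]) X = X + (k : ℂ) • Y := by
    intro k
    induction k with
    | zero => simp
    | succ k ih =>
      rw [Function.iterate_succ_apply', ih, map_add, map_smul, h,
        show Γ.twistGlob S hS X = X + Y by rw [hY]; abel]
      push_cast
      rw [add_smul, one_smul]
      abel
  have h2 := h1 Γ.T
  rw [twistGlob_pow_T, left_eq_add] at h2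
  have hT : (Γ.T : ℂ) ≠ 0 := Nat.cast_ne_zero.mpr Γ.T_pos.ne'
  exact sub_eq_zero.mp ((smul_eq_zero.mp h2).resolve_left hT)

/-- The `Γ`-invariant elements of a global Lie algebra with vanishing sum of residues. -/
def globResInv {S : Set ℂ} (hS : ∀ w, Γ.ω⁻¹ * w ∈ S → w ∈ S) (hfin : S.Finite) :
    LieSubalgebra ℂ (L.Glob S) where
  carrier := {X | Γ.twistGlob S hS X = X ∧ L.globRes hfin X = 0}
  add_mem' := fun {x y} hx hy => by
    refine ⟨?_, ?_⟩
    · rw [map_add, hx.1, hy.1]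
    · rw [map_add, hx.2, hy.2, add_zero]
  zero_mem' := by simp
  smul_mem' := fun c x hx => by
    refine ⟨?_, ?_⟩
    · rw [map_smul, hx.1]
    · rw [map_smul, hx.2, smul_zero]
  lie_mem' := fun {x y} hx hy => by
    refine ⟨?_, L.globRes_lie hfin x y⟩
    rw [LieHom.map_lie, hx.1, hy.1]

lemma mem_globResInv {S : Set ℂ} (hS : ∀ w, Γ.ω⁻¹ * w ∈ S → w ∈ S) (hfin : S.Finite)
    {X : L.Glob S} : X ∈ Γ.globResInv hS hfin ↔
      Γ.twistGlob S hS X = X ∧ L.globRes hfin X = 0 := Iff.rfl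

lemma resAt_ω_pow_mul {S : Set ℂ} (hS : ∀ w, Γ.ω⁻¹ * w ∈ S → w ∈ S) {X : L.Glob S}
    (hX : Γ.twistGlob S hS X = X) (w : ℂ) (k : ℕ) :
    L.resAt S (Γ.ω ^ k * w) X = L.resAt S w X := by
  induction k with
  | zero => simp
  | succ k ih =>
    rw [← ih]
    conv_lhs => rw [← hX]
    rw [resAt_twistGlob, pow_succ', mul_assoc, inv_mul_cancel_left₀ Γ.ω_ne_zero]

/-- If the poles are in the orbits of `v` and `w`, and an element of `globResInv` vanishes at
`v`, then it vanishes at `w`. -/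
lemma resAt_eq_zero {S : Set ℂ} (hS : ∀ w, Γ.ω⁻¹ * w ∈ S → w ∈ S) (hfin : S.Finite)
    {v w : ℂ} (hw : w ∈ S) (hvw : ∀ u ∈ S, ∃ k : ℕ, u = Γ.ω ^ k * v ∨ u = Γ.ω ^ k * w)
    {X : L.Glob S} (hX : X ∈ Γ.globResInv hS hfin) (h : L.resAt S v X = 0) :
    L.resAt S w X = 0 := by
  by_contra hne
  -- Residues are constant along orbits, so each is zero or equal to the one at `w`. The total is
  -- then the residue at `w` times the number of points with nonzero residue; this count treats a
  -- free orbit and the fixed point 0 alike.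
  have h1 : ∀ u ∈ S, L.resAt S u X = if L.resAt S u X ≠ 0 then L.resAt S w X else 0 := by
    intro u hu
    obtain ⟨k, rfl | rfl⟩ := hvw u hu
    · rw [Γ.resAt_ω_pow_mul hS hX.1, h]; simp
    · rw [Γ.resAt_ω_pow_mul hS hX.1, if_pos hne]
  have h2 := hX.2
  rw [globRes_apply, Finset.sum_congr rfl fun u hu => h1 u (by simpa using hu),
    ← Finset.sum_filter, Finset.sum_const, nsmul_eq_mul] at h2
  rcases mul_eq_zero.mp h2 with h2 | h2
  · rw [Nat.cast_eq_zero, Finset.card_eq_zero] at h2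
    have : w ∈ hfin.toFinset.filter fun u => L.resAt S u X ≠ 0 := by simp [hw, hne]
    rw [h2] at this
    simp at this
  · exact hne h2

/-- The sum of `cent / (t - α w)` over `α ∈ Γ`. -/
def orbitPole (S : Set ℂ) (w : ℂ) (hw : ∀ k : ℕ, Γ.ω ^ k * w ∈ S) : L.Glob S :=
  ∑ k ∈ Finset.range Γ.T, L.centPole S (Γ.ω ^ k * w) (hw k)

lemma twistGlob_orbitPole (S : Set ℂ) (hS : ∀ w, Γ.ω⁻¹ * w ∈ S → w ∈ S) (w : ℂ)
    (hw : ∀ k : ℕ, Γ.ω ^ k * w ∈ S) :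
    Γ.twistGlob S hS (Γ.orbitPole S w hw) = Γ.orbitPole S w hw := by
  have e : ∀ k, Γ.twistGlob S hS (L.centPole S (Γ.ω ^ k * w) (hw k)) =
      L.centPole S (Γ.ω ^ (k + 1) * w) (hw (k + 1)) := fun k => by
    rw [Γ.twistGlob_centPole S hS _ (hw k) (by rw [← mul_assoc, ← pow_succ']; exact hw (k + 1))]
    congr 1
    rw [← mul_assoc, ← pow_succ']
  have h0 : L.centPole S (Γ.ω ^ Γ.T * w) (hw Γ.T) = L.centPole S (Γ.ω ^ 0 * w) (hw 0) := by
    congr 1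
    rw [Γ.isPrimitiveRoot.pow_eq_one, pow_zero]
  rw [orbitPole, map_sum, Finset.sum_congr rfl fun k _ => e k]
  have h := Finset.sum_range_succ (fun k => L.centPole S (Γ.ω ^ k * w) (hw k)) Γ.T
  rw [Finset.sum_range_succ', h0] at h
  exact add_right_cancel h

lemma globRes_orbitPole {S : Set ℂ} (hfin : S.Finite) (w : ℂ) (hw : ∀ k : ℕ, Γ.ω ^ k * w ∈ S) :
    L.globRes hfin (Γ.orbitPole S w hw) = Γ.T := by
  rw [orbitPole, map_sum, Finset.sum_congr rfl fun k _ => L.globRes_centPole hfin _ _]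
  simp

/-- For `w ≠ 0` the T points of the orbit are distinct, so only the term with k = 0 has a pole at
`w`. -/
lemma expandAt_orbitPole_self {S : Set ℂ} {w : ℂ} (h0 : w ≠ 0) (hw : ∀ k : ℕ, Γ.ω ^ k * w ∈ S) :
    L.expandAt S w (Γ.orbitPole S w hw) = L.mode L.cent (-1) := by
  rw [orbitPole, map_sum, Finset.sum_eq_single_of_mem 0 (by simpa using Γ.T_pos)]
  · rw [expandAt_centPole]; simp
  · intro k hk hk0
    rw [expandAt_centPole, if_neg, zero_smul]
    intro h
    have h1 : Γ.ω ^ k = 1 := mul_right_cancel₀ h0 (by rw [← h, one_mul])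
    exact hk0 (Nat.eq_zero_of_dvd_of_lt (Γ.isPrimitiveRoot.dvd_of_pow_eq_one k h1)
      (by simpa using hk))

lemma expandAt_orbitPole_of_ne {S : Set ℂ} {v w : ℂ} (hvw : ∀ k : ℕ, v ≠ Γ.ω ^ k * w)
    (hw : ∀ k : ℕ, Γ.ω ^ k * w ∈ S) : L.expandAt S v (Γ.orbitPole S w hw) = 0 := by
  rw [orbitPole, map_sum]
  refine Finset.sum_eq_zero fun k _ => ?_
  rw [expandAt_centPole, if_neg (hvw k), zero_smul]

variable {ι : Type*}

lemma finite_orbits [Finite ι] (z : ι → ℂ) : (Γ.orbits z).Finite := by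
  have : Γ.orbits z ⊆ Set.range fun p : ι × Fin Γ.T => Γ.ω ^ (p.2 : ℕ) * z p.1 := by
    rintro _ ⟨i, k, rfl⟩
    refine ⟨(i, ⟨k % Γ.T, Nat.mod_lt _ Γ.T_pos⟩), ?_⟩
    simp only
    rw [← pow_mod_orderOf Γ.ω k, ← Γ.isPrimitiveRoot.eq_orderOf]
  exact (Set.finite_range _).subset this

lemma ideal_le (z : ι → ℂ) (hfin : (Γ.orbits z).Finite) :
    Γ.ideal z ≤ (Γ.globResInv (Γ.orbits_stable z) hfin).toSubmodule := by
  refine Submodule.span_le.mpr ?_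
  rintro _ ⟨i, j, rfl⟩
  change Γ.orbitPole _ (z i) (Γ.mem_orbits z i) - Γ.orbitPole _ (z j) (Γ.mem_orbits z j) ∈
    Γ.globResInv (Γ.orbits_stable z) hfin
  rw [mem_globResInv, map_sub, map_sub, twistGlob_orbitPole, twistGlob_orbitPole,
    globRes_orbitPole, globRes_orbitPole]
  simp

/-- An orbit sum has total residue T, balanced by T copies of the simple pole at the origin, which Γ
fixes. -/
lemma ideal₀_le (z : ι → ℂ) (hfin : (insert 0 (Γ.orbits z)).Finite) :
    Γ.ideal₀ z ≤ (Γ.globResInv (Γ.insert_orbits_stable z) hfin).toSubmodule := by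
  refine Submodule.span_le.mpr ?_
  rintro _ ⟨i, rfl⟩
  change Γ.orbitPole (insert 0 (Γ.orbits z)) (z i)
    (fun k => Set.mem_insert_of_mem _ (Γ.mem_orbits z i k)) - (Γ.T : ℂ) • L.centPole _ 0 _ ∈
      Γ.globResInv (Γ.insert_orbits_stable z) hfin
  have h0 : Γ.ω * 0 ∈ insert 0 (Γ.orbits z) := by rw [mul_zero]; exact Set.mem_insert _ _
  rw [mem_globResInv, map_sub, map_sub, twistGlob_orbitPole, globRes_orbitPole, map_smul, map_smul,
    globRes_centPole, Γ.twistGlob_centPole _ _ _ _ h0]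
  simp

/-- This trades the quotient description of the global Lie algebra for a genuine subalgebra.
Invariance modulo J is honest invariance because J is fixed pointwise, and classes coming from `Lo`
have no residues at all. -/
lemma mem_globResInv_of_mem {S : Set ℂ} (hS : ∀ w, Γ.ω⁻¹ * w ∈ S → w ∈ S) (hfin : S.Finite)
    {J : Submodule ℂ (L.Glob S)} (hJ : J ≤ (Γ.globResInv hS hfin).toSubmodule) {X : L.Glob S}
    (hX : X ∈ L.globLo S ⊔ J) (hX' : Γ.twistGlob S hS X - X ∈ J) : X ∈ Γ.globResInv hS hfin := by
  refine ⟨Γ.twistGlob_eq_of_sub_fixed S hS (hJ hX').1, ?_⟩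
  obtain ⟨l, hl, j, hj, rfl⟩ := Submodule.mem_sup.mp hX
  rw [map_add, (hJ hj).2, add_zero, globRes_apply]
  exact Finset.sum_eq_zero fun w _ => L.resAt_globLo w hl

lemma globInv_le (z : ι → ℂ) (hfin : (Γ.orbits z).Finite) {X : L.Glob (Γ.orbits z)}
    (hX : X ∈ Γ.globInv z) : X ∈ Γ.globResInv (Γ.orbits_stable z) hfin :=
  Γ.mem_globResInv_of_mem _ hfin (Γ.ideal_le z hfin) hX.1 hX.2

lemma globInv₀_le (z : ι → ℂ) (hfin : (insert 0 (Γ.orbits z)).Finite)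
    {X : L.Glob (insert 0 (Γ.orbits z))} (hX : X ∈ Γ.globInv₀ z) :
    X ∈ Γ.globResInv (Γ.insert_orbits_stable z) hfin :=
  Γ.mem_globResInv_of_mem _ hfin (Γ.ideal₀_le z hfin) hX.1 hX.2

end CyclicAction

end VertexLieAlgebra

/-! ### Modules from representations, systems of quotients, and induction data from a basis. -/

namespace LModule

variable {G : Type u} [LieRing G] [LieAlgebra ℂ G]

/-- The module given by a representation. -/
def ofRep (W : Type u) [AddCommGroup W] [Module ℂ W] (ρ : G →ₗ[ℂ] Module.End ℂ W)
    (hρ : ∀ g h w, ρ ⁅g, h⁆ w = ρ g (ρ h w) - ρ h (ρ g w)) : LModule G :=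
  letI : LieRingModule G W :=
    { bracket := fun g w => ρ g w
      add_lie := fun g h w => by
        rw [map_add, LinearMap.add_apply]
      lie_add := fun g w w' => map_add (ρ g) w w'
      leibniz_lie := fun g h w => by
        change ρ g (ρ h w) = ρ ⁅g, h⁆ w + ρ h (ρ g w)
        rw [hρ, sub_add_cancel] }
  letI : LieModule ℂ G W :=
    { smul_lie := fun c g w => by
        change ρ (c • g) w = c • ρ g w
        rw [map_smul, LinearMap.smul_apply]
      lie_smul := fun c g w => map_smul (ρ g) c w }
  ⟨W⟩

/-- The inverse system of quotients of a module by a decreasing sequence of submodules. -/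
def quotientSystem (N : LModule G) (J : ℕ → LieSubmodule ℂ G N) (hJ : Antitone J) :
    ModuleSystem G where
  obj k := ⟨N ⧸ J k⟩
  map {k l} h :=
    { Submodule.mapQ (J k).toSubmodule (J l).toSubmodule LinearMap.id (hJ h) with
      map_lie' := fun {g x} => by
        obtain ⟨x, rfl⟩ := Submodule.Quotient.mk_surjective _ x
        rfl }
  map_self k x := by
    obtain ⟨x, rfl⟩ := Submodule.Quotient.mk_surjective _ x
    rfl
  map_map h h' x := by
    obtain ⟨x, rfl⟩ := Submodule.Quotient.mk_surjective _ x
    rfl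

/-- The map from a module to the inverse limit of its quotients. -/
def toLimit (N : LModule G) (J : ℕ → LieSubmodule ℂ G N) (hJ : Antitone J) :
    N →ₗ⁅ℂ,G⁆ (N.quotientSystem J hJ).limit where
  toFun x := ⟨fun k => (Submodule.Quotient.mk x : N ⧸ (J k).toSubmodule), fun _ _ _ => rfl⟩
  map_add' _ _ := rfl
  map_smul' _ _ := rfl
  map_lie' := rfl

lemma toLimit_injective (N : LModule G) (J : ℕ → LieSubmodule ℂ G N) (hJ : Antitone J)
    (h : ∀ x : N, x ≠ 0 → ∃ k, x ∉ J k) : Function.Injective (N.toLimit J hJ) := by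
  rw [injective_iff_map_eq_zero]
  intro x hx
  by_contra hne
  obtain ⟨k, hk⟩ := h x hne
  refine hk ?_
  have := congrFun (congrArg Subtype.val hx) k
  exact (Submodule.Quotient.mk_eq_zero _).mp this

end LModule

/-- The data for induction from a subspace `H` closed under the bracket, given a basis modulo
`H`. -/
def InductionData.ofBasis {k G I M : Type*} [CommRing k] [LieRing G] [LieAlgebra k G]
    [AddCommGroup M] [Module k M] (H : Submodule k G) (hH : ∀ g ∈ H, ∀ h ∈ H, ⁅g, h⁆ ∈ H)
    (b : I → G) (B : Module.Basis I k (G ⧸ H)) (hb : ∀ i, H.mkQ (b i) = B i)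
    (θ : G →ₗ[k] Module.End k M)
    (hθ : ∀ g ∈ H, ∀ h ∈ H, ∀ m, θ ⁅g, h⁆ m = θ g (θ h m) - θ h (θ g m)) :
    InductionData k G I M :=
  have hc : ∀ g, (B.repr.toLinearMap ∘ₗ H.mkQ) g = 0 → g ∈ H := fun g hg => by
    rw [LinearMap.comp_apply, LinearEquiv.coe_coe, LinearEquiv.map_eq_zero_iff, Submodule.mkQ_apply,
      Submodule.Quotient.mk_eq_zero] at hg
    exact hg
  { b := b
    coord := B.repr.toLinearMap ∘ₗ H.mkQ
    coord_b := fun i => by rw [LinearMap.comp_apply, hb]; simp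
    coord_lie := fun g h hg hh => by
      rw [LinearMap.comp_apply, LinearEquiv.coe_coe, LinearEquiv.map_eq_zero_iff,
        Submodule.mkQ_apply, Submodule.Quotient.mk_eq_zero]
      exact hH g (hc g hg) h (hc h hh)
    θ := θ
    θ_lie := fun g h hg hh => hθ g (hc g hg) h (hc h hh) }

lemma InductionData.ofBasis_coord_eq_zero {k G I M : Type*} [CommRing k] [LieRing G]
    [LieAlgebra k G] [AddCommGroup M] [Module k M] (H : Submodule k G)
    (hH : ∀ g ∈ H, ∀ h ∈ H, ⁅g, h⁆ ∈ H) (b : I → G) (B : Module.Basis I k (G ⧸ H))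
    (hb : ∀ i, H.mkQ (b i) = B i) (θ : G →ₗ[k] Module.End k M)
    (hθ : ∀ g ∈ H, ∀ h ∈ H, ∀ m, θ ⁅g, h⁆ m = θ g (θ h m) - θ h (θ g m)) {g : G} :
    (InductionData.ofBasis H hH b B hb θ hθ).coord g = 0 ↔ g ∈ H := by
  change (B.repr.toLinearMap ∘ₗ H.mkQ) g = 0 ↔ _
  rw [LinearMap.comp_apply, LinearEquiv.coe_coe, LinearEquiv.map_eq_zero_iff, Submodule.mkQ_apply,
      Submodule.Quotient.mk_eq_zero]

/-! ### The degree filtration of the local Lie algebra. -/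

/-- The coefficients of the Laurent series vanish below `n`. -/
def VanishBelow (f : LaurentSeries ℂ) (n : ℤ) : Prop := ∀ i < n, f.coeff i = 0

namespace VanishBelow

lemma mono {f : LaurentSeries ℂ} {m n : ℤ} (h : VanishBelow f n) (hm : m ≤ n) : VanishBelow f m :=
  fun i hi => h i (hi.trans_le hm)

lemma mul {f g : LaurentSeries ℂ} {m n : ℤ} (hf : VanishBelow f m) (hg : VanishBelow g n) :
    VanishBelow (f * g) (m + n) := by
  intro i hi
  rw [HahnSeries.coeff_mul]
  refine Finset.sum_eq_zero fun p hp => ?_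
  have hs := (Finset.mem_antidiagonal.mp hp).2.2
  rcases lt_or_ge p.1 m with h | h
  · rw [hf _ h, zero_mul]
  · rw [hg _ (by omega), mul_zero]

lemma deriv_pow {f : LaurentSeries ℂ} {n : ℤ} (hf : VanishBelow f n) (k : ℕ) :
    VanishBelow ((laurentDeriv.toLin ^ k) f) (n - k) := by
  induction k with
  | zero => simpa using hf
  | succ k ih =>
    intro i hi
    rw [pow_succ', Module.End.mul_apply, laurentDeriv_coeff, ih (i + 1) (by push_cast at hi; omega),
      mul_zero]

lemma exists_vanishBelow (f : LaurentSeries ℂ) : ∃ n, VanishBelow f n :=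
  ⟨f.order, fun _ hi => HahnSeries.coeff_eq_zero_of_lt_order hi⟩

lemma single (n : ℤ) (a : ℂ) : VanishBelow (HahnSeries.single n a) n := fun i hi => by
  rw [HahnSeries.coeff_single, if_neg hi.ne]

end VanishBelow

namespace VertexLieAlgebra

variable {V : Type u} [AddCommGroup V] [Module ℂ V] (L : VertexLieAlgebra V)

/-- Since D cent = 0, the translation axiom at n + 1 reads (n + 1) cent_(n) b = 0. -/
lemma prod_cent (n : ℕ) (b : V) : L.prod n L.cent b = 0 := by
  have h := L.translation L.cent b (n + 1)
  rw [D_cent, map_zero, LinearMap.zero_apply, eq_comm, neg_eq_zero, smul_eq_zero] at h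
  exact h.resolve_left (by exact_mod_cast Nat.succ_ne_zero n)

lemma lie_cent (n : ℤ) (X : L.Loc) : ⁅L.mode L.cent n, X⁆ = 0 := by
  obtain ⟨x, rfl⟩ := L.rho_surjective _ X
  induction x with
  | zero => simp
  | add x y hx hy => rw [map_add, lie_add, hx, hy, add_zero]
  | tmul b g =>
    rw [mode, lie_rho, L.brk_tmul _ _ _ _ _ (N := 0) fun n _ => L.prod_cent n b]
    simp

lemma localRes_cent : L.localRes (L.mode L.cent (-1)) = 1 := by
  rw [mode, localRes_rho]; simp

lemma eps_gradeProj_zero (v : V) : L.eps (L.gradeProj 0 v) = L.eps v := by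
  induction v using L.D_pow_induction with
  | ha x y hx hy => simp only [map_add, hx, hy]
  | hc c => rw [map_smul, L.gradeProj_of_mem 0 L.cent_grade, if_pos rfl]
  | hD k l =>
    cases k with
    | zero => rw [pow_zero, Module.End.one_apply, L.eps_Lo l.2, L.eps_Lo (L.gradeProj_Lo 0 l.2)]
    | succ k => rw [pow_succ', Module.End.mul_apply, gradeProj_zero_D, eps_D, map_zero]

lemma eps_of_mem_grade {d : ℕ} (hd : d ≠ 0) {v : V} (hv : v ∈ L.grade d) : L.eps v = 0 := by
  rw [← eps_gradeProj_zero, L.gradeProj_of_mem 0 hv, if_neg hd, map_zero]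

/-- The subspace of the local Lie algebra spanned by the modes of degree at most `-K`. -/
def locFil (K : ℕ) : Submodule ℂ L.Loc :=
  Submodule.span ℂ {X | ∃ d : ℕ, ∃ a ∈ L.grade d, ∃ f : LaurentSeries ℂ,
    VanishBelow f (d - 1 + K) ∧ X = L.rho laurentDeriv (a ⊗ₜ f)}

lemma rho_mem_locFil {K d : ℕ} {a : V} (ha : a ∈ L.grade d) {f : LaurentSeries ℂ}
    (hf : VanishBelow f (d - 1 + K)) : L.rho laurentDeriv (a ⊗ₜ f) ∈ L.locFil K :=
  Submodule.subset_span ⟨d, a, ha, f, hf, rfl⟩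

lemma locFil_antitone : Antitone L.locFil := by
  intro K K' h
  refine Submodule.span_le.mpr ?_
  rintro _ ⟨d, a, ha, f, hf, rfl⟩
  exact L.rho_mem_locFil ha (hf.mono (by simpa using h))

/-- Degrees of modes add under the bracket: the n-th product costs n + 1 in degree while δ^n costs n
in order. Two elements of degree at most -K give one of degree at most -2K. -/
lemma lie_mem_locFil {K : ℕ} {X Y : L.Loc} (hX : X ∈ L.locFil K) (hY : Y ∈ L.locFil K) :
    ⁅X, Y⁆ ∈ L.locFil K := by
  induction hX using Submodule.span_induction with
  | zero => simp
  | add x y _ _ hx hy => rw [add_lie]; exact Submodule.add_mem _ hx hy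
  | smul c x _ hx => rw [smul_lie]; exact Submodule.smul_mem _ _ hx
  | mem X hX =>
  induction hY using Submodule.span_induction with
  | zero => simp
  | add x y _ _ hx hy => rw [lie_add]; exact Submodule.add_mem _ hx hy
  | smul c x _ hx => rw [lie_smul]; exact Submodule.smul_mem _ _ hx
  | mem Y hY =>
    obtain ⟨p, a, ha, f, hf, rfl⟩ := hX
    obtain ⟨q, b, hb, g, hg, rfl⟩ := hY
    obtain ⟨N, hN⟩ := L.locality a b
    rw [lie_rho, L.brk_tmul _ a b f g hN, map_sum]
    refine Submodule.sum_mem _ fun n _ => ?_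
    rw [map_smul]
    refine Submodule.smul_mem _ _ ?_
    rcases lt_or_ge (p + q) (n + 1) with h | h
    · rw [L.prod_grade_neg p q n h a ha b hb]; simp
    · obtain ⟨r, hr⟩ : ∃ r, r + n + 1 = p + q := ⟨p + q - (n + 1), by omega⟩
      refine L.rho_mem_locFil (L.prod_grade p q n r hr a ha b hb)
        (((hf.deriv_pow n).mul hg).mono ?_)
      omega

/-- `eps` sees only degree zero, where the series now start at t^K or later. The shift to K + 1
matters: cent(-1) has degree zero and belongs to `locFil 0`. -/
lemma localRes_locFil {K : ℕ} {X : L.Loc} (hX : X ∈ L.locFil (K + 1)) : L.localRes X = 0 := by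
  have : L.locFil (K + 1) ≤ LinearMap.ker L.localRes := by
    refine Submodule.span_le.mpr ?_
    rintro _ ⟨d, a, ha, f, hf, rfl⟩
    rw [SetLike.mem_coe, LinearMap.mem_ker, localRes_rho]
    by_cases hd : d = 0
    · subst hd
      rw [hf (-1) (by push_cast; omega), mul_zero]
    · rw [L.eps_of_mem_grade hd ha, zero_mul]
  exact this hX

lemma exists_rho_mem_locFil (K : ℕ) (a : V) :
    ∃ n, ∀ f, VanishBelow f n → L.rho laurentDeriv (a ⊗ₜ f) ∈ L.locFil K := by
  induction a using L.grade_induction with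
  | h0 => exact ⟨0, fun f _ => by simp⟩
  | ha x y hx hy =>
    obtain ⟨m, hm⟩ := hx
    obtain ⟨n, hn⟩ := hy
    refine ⟨max m n, fun f hf => ?_⟩
    rw [TensorProduct.add_tmul, map_add]
    exact Submodule.add_mem _ (hm f (hf.mono (le_max_left _ _))) (hn f (hf.mono (le_max_right _ _)))
  | hg d v hv => exact ⟨d - 1 + K, fun f hf => L.rho_mem_locFil hv hf⟩

/-- The Laurent series obtained by applying a functional to the `Lo` component of degree `d`. -/
def detect (d : ℕ) (φ : V →ₗ[ℂ] ℂ) : L.Lo ⊗[ℂ] LaurentSeries ℂ →ₗ[ℂ] LaurentSeries ℂ :=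
  (TensorProduct.lid ℂ (LaurentSeries ℂ)).toLinearMap ∘ₗ
    (φ ∘ₗ L.gradeProj d ∘ₗ L.Lo.subtype).rTensor (LaurentSeries ℂ)

lemma detect_tmul (d : ℕ) (φ : V →ₗ[ℂ] ℂ) (l : L.Lo) (f : LaurentSeries ℂ) :
    L.detect d φ (l ⊗ₜ f) = φ (L.gradeProj d l) • f := rfl

lemma eq_zero_of_gradeProj {v : V} (h : ∀ d, L.gradeProj d v = 0) : v = 0 := by
  have : (LinearEquiv.ofBijective (DirectSum.coeLinearMap L.grade) L.isInternal).symm v = 0 := by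
    refine DFinsupp.ext fun d => Subtype.ext ?_
    exact h d
  simpa using this

/-- Expanding `y` along a basis of the Laurent series reduces this to coefficients in `Lo`, which
are separated by degree projections and functionals. -/
lemma eq_zero_of_detect {y : L.Lo ⊗[ℂ] LaurentSeries ℂ} (h : ∀ d φ, L.detect d φ y = 0) :
    y = 0 := by
  classical
  let C := Module.Basis.ofVectorSpace ℂ (LaurentSeries ℂ)
  let e := TensorProduct.equivFinsuppOfBasisRight (M := L.Lo) C
  have hy : y = (e y).sum fun i l => l ⊗ₜ C i := by
    rw [← TensorProduct.equivFinsuppOfBasisRight_symm_apply]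
    exact (e.symm_apply_apply y).symm
  have h0 : e y = 0 := by
    ext i
    refine L.eq_zero_of_gradeProj fun d => ?_
    rw [← Module.forall_dual_apply_eq_zero_iff ℂ]
    intro φ
    have h1 := h d φ
    rw [hy, map_finsuppSum] at h1
    simp only [detect_tmul] at h1
    have h2 := congrArg (fun f => C.repr f i) h1
    by_cases h3 : e y i = 0
    · simp [h3]
    · simp [Finsupp.sum, Finsupp.single_apply] at h2
      exact h2 h3
  simpa using h0

/-- Removing D^k by integration by parts lowers both the degree of the `Lo` component and the order
of the series by k, so the bound is unchanged. -/
lemma detect_locFil {K d : ℕ} (φ : V →ₗ[ℂ] ℂ) {X : L.Loc} (hX : X ∈ L.locFil K) :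
    VanishBelow (L.detect d φ (L.toLo laurentDeriv X)) (d - 1 + K) := by
  induction hX using Submodule.span_induction with
  | zero => intro i _; simp
  | add x y _ _ hx hy =>
    intro i hi
    rw [map_add, map_add, HahnSeries.coeff_add, hx i hi, hy i hi, add_zero]
  | smul c x _ hx =>
    intro i hi
    rw [map_smul, map_smul, HahnSeries.coeff_smul, hx i hi, smul_zero]
  | mem X hX =>
    obtain ⟨p, a, ha, f, hf, rfl⟩ := hX
    intro i hi
    rw [toLo, liftRho_rho, toLoAux_tmul, map_finsuppSum, Finsupp.sum, HahnSeries.coeff_sum]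
    refine Finset.sum_eq_zero fun k hk => ?_
    obtain ⟨h1, h2⟩ := L.comps_mem_grade ha (Finsupp.mem_support_iff.mp hk)
    rw [map_smul, detect_tmul, L.gradeProj_of_mem d h2]
    split_ifs with h
    · rw [HahnSeries.coeff_smul, HahnSeries.coeff_smul, hf.deriv_pow k i (by omega)]
      simp
    · simp

/-- The filtration is separated modulo cent(-1): any given coefficient of a detected series falls
below the vanishing order once K is large, so the `Lo` component of X is zero. -/
lemma mem_span_cent_of_forall {X : L.Loc}
    (hX : ∀ K, X ∈ L.locFil (K + 1) ⊔ Submodule.span ℂ {L.mode L.cent (-1)}) :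
    X ∈ Submodule.span ℂ {L.mode L.cent (-1)} := by
  have h0 : L.toLo laurentDeriv X = 0 := by
    refine L.eq_zero_of_detect fun d φ => ?_
    ext n
    obtain ⟨K, hK⟩ : ∃ K : ℕ, n < d - 1 + ((K + 1 : ℕ) : ℤ) := ⟨n.toNat + 1, by omega⟩
    obtain ⟨Y, hY, _, hc, rfl⟩ := Submodule.mem_sup.mp (hX K)
    obtain ⟨c, rfl⟩ := Submodule.mem_span_singleton.mp hc
    rw [map_add, map_smul, mode, toLo_cent, smul_zero, add_zero]
    exact L.detect_locFil φ hY n hK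
  obtain ⟨f, hf⟩ := L.exists_eq_toLo_add laurentDeriv X
  rw [h0, map_zero, map_zero, zero_add, rho_cent] at hf
  rw [hf]
  exact Submodule.smul_mem _ _ (Submodule.mem_span_singleton_self _)

/-- The scalar action by the residue. -/
def resAction : L.Loc →ₗ[ℂ] Module.End ℂ ℂ := L.localRes.smulRight LinearMap.id

lemma resAction_apply (X : L.Loc) (m : ℂ) : L.resAction X m = L.localRes X * m := rfl

/-- The bracket lands in K itself, not just in K plus the centre. If the residue vanishes on K, it
is therefore a character of the sum. -/
lemma sup_cent_lie {K : Submodule ℂ L.Loc} (hK : ∀ X ∈ K, ∀ Y ∈ K, ⁅X, Y⁆ ∈ K) {X Y : L.Loc}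
    (hX : X ∈ K ⊔ Submodule.span ℂ {L.mode L.cent (-1)})
    (hY : Y ∈ K ⊔ Submodule.span ℂ {L.mode L.cent (-1)}) : ⁅X, Y⁆ ∈ K := by
  obtain ⟨x, hx, _, hc, rfl⟩ := Submodule.mem_sup.mp hX
  obtain ⟨y, hy, _, hc', rfl⟩ := Submodule.mem_sup.mp hY
  obtain ⟨c, rfl⟩ := Submodule.mem_span_singleton.mp hc
  obtain ⟨c', rfl⟩ := Submodule.mem_span_singleton.mp hc'
  rw [add_lie, smul_lie, lie_cent, smul_zero, add_zero, lie_add, lie_smul,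
    ← lie_skew x (L.mode L.cent (-1)), lie_cent, neg_zero, smul_zero, add_zero]
  exact hK x hx y hy

/-- The one-dimensional module over `K ⊕ ℂ cent`. -/
def scalarData {I : Type*} (K : Submodule ℂ L.Loc) (hK : ∀ X ∈ K, ∀ Y ∈ K, ⁅X, Y⁆ ∈ K)
    (hres : ∀ X ∈ K, L.localRes X = 0) (b : I → L.Loc)
    (B : Module.Basis I ℂ (L.Loc ⧸ (K ⊔ Submodule.span ℂ {L.mode L.cent (-1)})))
    (hb : ∀ i, Submodule.mkQ _ (b i) = B i) : InductionData ℂ L.Loc I ℂ :=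
  InductionData.ofBasis (K ⊔ Submodule.span ℂ {L.mode L.cent (-1)})
    (fun _ hX _ hY => Submodule.mem_sup_left (L.sup_cent_lie hK hX hY)) b B hb L.resAction
    (fun X hX Y hY m => by
      rw [resAction_apply, resAction_apply, resAction_apply, resAction_apply, resAction_apply,
        hres _ (L.sup_cent_lie hK hX hY)]
      ring)

lemma scalarData_coord {I : Type*} {K : Submodule ℂ L.Loc} {hK : ∀ X ∈ K, ∀ Y ∈ K, ⁅X, Y⁆ ∈ K}
    {hres : ∀ X ∈ K, L.localRes X = 0} {b : I → L.Loc}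
    {B : Module.Basis I ℂ (L.Loc ⧸ (K ⊔ Submodule.span ℂ {L.mode L.cent (-1)}))}
    {hb : ∀ i, Submodule.mkQ _ (b i) = B i} {X : L.Loc} :
    (L.scalarData K hK hres b B hb).coord X = 0 ↔
      X ∈ K ⊔ Submodule.span ℂ {L.mode L.cent (-1)} :=
  InductionData.ofBasis_coord_eq_zero _ _ _ _ _ _ _

end VertexLieAlgebra

/-- A finite family which is independent modulo an intersection of a decreasing sequence of
subspaces is independent modulo one of them. -/
lemma exists_linearIndepOn_mkQ {k G I : Type*} [Field k] [AddCommGroup G] [Module k G] (b : I → G)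
    (E : ℕ → Submodule k G) (hE : Antitone E) (E₀ : Submodule k G)
    (hE₀ : ∀ X, (∀ n, X ∈ E n) → X ∈ E₀) (hb : LinearIndependent k fun i => E₀.mkQ (b i))
    (W : Finset I) : ∃ n, LinearIndepOn k (fun i => (E n).mkQ (b i)) W := by
  let φ : (W → k) →ₗ[k] G := Fintype.linearCombination k fun i : W => b i
  have hφ : ∀ (E' : Submodule k G) (g : W → k),
      ∑ i, g i • E'.mkQ (b i) = E'.mkQ (φ g) := fun E' g => by
    rw [Fintype.linearCombination_apply, map_sum]
    simp only [map_smul]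
  -- The relations among the `b i`, i ∈ W, modulo `E n` form a decreasing chain of subspaces of the
  -- finite-dimensional space k^W. Once it is stationary, a relation modulo `E n` holds modulo every
  -- `E m`, hence modulo `E₀`.
  let f : ℕ →o (Submodule k (W → k))ᵒᵈ :=
    ⟨fun n => OrderDual.toDual ((E n).comap φ), fun m n h => Submodule.comap_mono (hE h)⟩
  obtain ⟨n, hn⟩ := IsArtinian.monotone_stabilizes f
  refine ⟨n, ?_⟩
  refine Fintype.linearIndependent_iff.mpr fun g hg => ?_
  have h1 : φ g ∈ E n := by
    have h := (hφ (E n) g).symm.trans hg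
    exact (Submodule.Quotient.mk_eq_zero _).mp h
  have h2 : φ g ∈ E₀ := hE₀ _ fun m => by
    rcases le_total n m with h | h
    · have h3 : (E n).comap φ = (E m).comap φ := hn m h
      have h4 : g ∈ (E n).comap φ := h1
      rw [h3] at h4
      exact h4
    · exact hE h h1
  have h3 := hb.comp (fun i : W => (i : I)) Subtype.val_injective
  refine Fintype.linearIndependent_iff.mp h3 g ?_
  refine (hφ E₀ g).trans ?_
  exact (Submodule.Quotient.mk_eq_zero _).mpr h2

/-! ### The universal module of level one and its smooth quotients. -/

namespace VertexLieAlgebra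

variable {V : Type u} [AddCommGroup V] [Module ℂ V] (L : VertexLieAlgebra V)

/-- The central subspace of the local Lie algebra. -/
abbrev centSpan (K : Submodule ℂ L.Loc) : Submodule ℂ L.Loc :=
  K ⊔ Submodule.span ℂ {L.mode L.cent (-1)}

/-- A basis of the local Lie algebra modulo its central subspace. -/
def locBasis : Module.Basis (Module.Basis.ofVectorSpaceIndex ℂ (L.Loc ⧸ L.centSpan ⊥)) ℂ
    (L.Loc ⧸ L.centSpan ⊥) := Module.Basis.ofVectorSpace ℂ _

/-- The index type of a basis of the local Lie algebra modulo its central subspace. -/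
abbrev LocIndex : Type u := Module.Basis.ofVectorSpaceIndex ℂ (L.Loc ⧸ L.centSpan ⊥)

/-- The induction construction needs some linear order on the index set; a well-ordering provides
one. -/
instance : LinearOrder L.LocIndex := IsWellOrder.linearOrder WellOrderingRel

/-- Lifts of the elements of a basis of the local Lie algebra modulo its central subspace. -/
def locLift (i : L.LocIndex) : L.Loc :=
  Function.surjInv (Submodule.mkQ_surjective (L.centSpan ⊥)) (L.locBasis i)

lemma mkQ_locLift (i : L.LocIndex) : (L.centSpan ⊥).mkQ (L.locLift i) = L.locBasis i :=
  Function.surjInv_eq (Submodule.mkQ_surjective (L.centSpan ⊥)) _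

/-- The data for the universal module of level one. -/
def freeData : InductionData ℂ L.Loc L.LocIndex ℂ :=
  L.scalarData ⊥ (fun X hX Y _ => by rw [(Submodule.mem_bot ℂ).mp hX]; simp)
    (fun X hX => by rw [(Submodule.mem_bot ℂ).mp hX]; simp) L.locLift L.locBasis L.mkQ_locLift

lemma freeData_coord {X : L.Loc} : L.freeData.coord X = 0 ↔
    X ∈ Submodule.span ℂ {L.mode L.cent (-1)} := by
  refine (L.scalarData_coord).trans ?_
  rw [bot_sup_eq]

/-- The universal module of level one over the local Lie algebra. -/
def freeModule : LModule L.Loc :=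
  LModule.ofRep (Multiset L.LocIndex →₀ ℂ) L.freeData.A L.freeData.A_lie

/-- The generator of the universal module. -/
def vac : L.freeModule := (Finsupp.single 0 1 : Multiset L.LocIndex →₀ ℂ)

lemma cent_lie_freeModule (v : L.freeModule) : ⁅L.mode L.cent (-1), v⁆ = v := by
  have h := L.freeData.A_central (L.lie_cent (-1)) (a := 1) (fun m => ?_) v
  · exact h.trans (one_smul ℂ (v : Multiset L.LocIndex →₀ ℂ))
  · rw [L.freeData.A_single_zero (L.freeData_coord.mpr (Submodule.mem_span_singleton_self _))]
    change Finsupp.single 0 (L.localRes _ * m) = _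
    rw [localRes_cent, one_mul, one_smul]

lemma freeModule_induction {p : L.freeModule → Prop} (h0 : ∀ c : ℂ, p (c • L.vac))
    (ha : ∀ x y, p x → p y → p (x + y)) (hl : ∀ (X : L.Loc) y, p y → p ⁅X, y⁆)
    (y : L.freeModule) : p y := by
  refine L.freeData.induction_A (p := p) (fun m => ?_) ha (fun i y hy => hl _ y hy) y
  have := h0 m
  rw [show m • L.vac = (Finsupp.single 0 m : Multiset L.LocIndex →₀ ℂ) by
    change m • (Finsupp.single 0 1 : Multiset L.LocIndex →₀ ℂ) = _
    simp] at this
  exact this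

/-- The submodules generated by the vectors `X . vac` with `X` of sufficiently negative degree. -/
def deepSub (K : ℕ) : LieSubmodule ℂ L.Loc L.freeModule :=
  LieSubmodule.lieSpan ℂ L.Loc {v | ∃ X ∈ L.locFil (K + 1), v = ⁅X, L.vac⁆}

lemma deepSub_antitone : Antitone L.deepSub := by
  intro K K' h
  refine LieSubmodule.lieSpan_mono ?_
  rintro _ ⟨X, hX, rfl⟩
  exact ⟨X, L.locFil_antitone (by omega) hX, rfl⟩

/-- For v = (b ⊗ g).y, commuting a ⊗ f past b ⊗ g leaves finitely many terms (a_(k) b) ⊗ (δ^k f) g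
acting on y. This is why the claim is stated for all `a` at once and for all series of high order
instead of powers of t. -/
lemma eventually_lie_mem_deepSub (K : ℕ) (v : L.freeModule) : ∀ a : V, ∃ n : ℤ,
    ∀ f, VanishBelow f n → ⁅L.rho laurentDeriv (a ⊗ₜ f), v⁆ ∈ L.deepSub K := by
  induction v using L.freeModule_induction with
  | h0 c =>
    intro a
    obtain ⟨n, hn⟩ := L.exists_rho_mem_locFil (K + 1) a
    refine ⟨n, fun f hf => ?_⟩
    rw [lie_smul]
    exact (L.deepSub K).smul_mem _ (LieSubmodule.subset_lieSpan ⟨_, hn f hf, rfl⟩)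
  | ha x y hx hy =>
    intro a
    obtain ⟨m, hm⟩ := hx a
    obtain ⟨n, hn⟩ := hy a
    refine ⟨max m n, fun f hf => ?_⟩
    rw [lie_add]
    exact (L.deepSub K).add_mem (hm f (hf.mono (le_max_left _ _)))
      (hn f (hf.mono (le_max_right _ _)))
  | hl X y hy =>
    intro a
    obtain ⟨x, rfl⟩ := L.rho_surjective _ X
    induction x with
    | zero => exact ⟨0, fun f _ => by simp⟩
    | add x₁ x₂ hx₁ hx₂ =>
      obtain ⟨m, hm⟩ := hx₁
      obtain ⟨n, hn⟩ := hx₂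
      refine ⟨max m n, fun f hf => ?_⟩
      rw [map_add, add_lie, lie_add]
      exact (L.deepSub K).add_mem (hm f (hf.mono (le_max_left _ _)))
        (hn f (hf.mono (le_max_right _ _)))
    | tmul b g =>
      obtain ⟨N, hN⟩ := L.locality a b
      obtain ⟨p, hp⟩ := VanishBelow.exists_vanishBelow g
      choose n hn using fun k : ℕ => hy (L.prod k a b)
      obtain ⟨n', hn'⟩ := hy a
      -- If f vanishes below q, then (δ^k f) g vanishes below q - k + p, which must reach `n k`.
      obtain ⟨q, hq⟩ : ∃ q : ℤ, ∀ k ∈ Finset.range N, n k + k - p ≤ q :=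
        ((Finset.range N).image fun k : ℕ => n k + k - p).bddAbove.imp fun q hq k hk =>
          hq (by simpa using ⟨k, by simpa using hk, rfl⟩)
      refine ⟨max n' q, fun f hf => ?_⟩
      rw [leibniz_lie, lie_rho, L.brk_tmul _ a b f g hN, map_sum, sum_lie]
      refine (L.deepSub K).add_mem ?_ ((L.deepSub K).lie_mem (hn' f (hf.mono (le_max_left _ _))))
      refine Submodule.sum_mem (L.deepSub K).toSubmodule fun k hk => ?_
      rw [map_smul, smul_lie]
      refine (L.deepSub K).smul_mem _ (hn k _ (((hf.deriv_pow k).mul hp).mono ?_))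
      have := hq k hk
      have := le_max_right n' q
      omega

lemma isSmooth_quotient (K : ℕ) : L.IsSmooth ⟨L.freeModule ⧸ L.deepSub K⟩ := by
  refine ⟨fun v => ?_, fun v a => ?_⟩
  · obtain ⟨v, rfl⟩ := Submodule.Quotient.mk_surjective _ v
    exact congrArg Submodule.Quotient.mk (L.cent_lie_freeModule v)
  · obtain ⟨v, rfl⟩ := Submodule.Quotient.mk_surjective _ v
    obtain ⟨n₀, h⟩ := L.eventually_lie_mem_deepSub K v a
    refine ⟨n₀, fun n hn => ?_⟩
    exact (Submodule.Quotient.mk_eq_zero _).mpr (h _ ((VanishBelow.single n 1).mono hn))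

/-- The submodules `deepSub` intersect trivially. -/
lemma exists_notMem_deepSub (u : L.freeModule) (hu : u ≠ 0) : ∃ K, u ∉ L.deepSub K := by
  classical
  let u' : Multiset L.LocIndex →₀ ℂ := u
  let W : Finset L.LocIndex := u'.support.biUnion Multiset.toFinset
  have hanti : Antitone fun K => L.centSpan (L.locFil (K + 1)) := fun K K' h =>
    sup_le_sup_right (L.locFil_antitone (by omega)) _
  -- W is the finite set of indices occurring in `u`. For large K the corresponding lifts are still
  -- independent modulo the filtration step and the centre.
  obtain ⟨K, hK⟩ := exists_linearIndepOn_mkQ L.locLift (fun K => L.centSpan (L.locFil (K + 1)))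
    hanti (L.centSpan ⊥)
    (fun X hX => Submodule.mem_sup_right (L.mem_span_cent_of_forall hX)) (by
      simp only [mkQ_locLift]
      exact L.locBasis.linearIndependent) W
  refine ⟨K, fun hmem => hu ?_⟩
  set E := L.centSpan (L.locFil (K + 1)) with hE
  -- W is enlarged within the given index set, so that a basis modulo E is made of the same lifts,
  -- with the inherited order.
  set I := hK.extend (Set.subset_univ _) with hI
  have hspan : ⊤ ≤ Submodule.span ℂ (Set.range fun i : I => E.mkQ (L.locLift i)) := by
    have h1 : Submodule.span ℂ (Set.range fun i : I => E.mkQ (L.locLift i)) =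
        Submodule.span ℂ (Set.range fun i => E.mkQ (L.locLift i)) := by
      have := hK.span_image_extend_eq_span_image (Set.subset_univ _)
      rw [Set.image_univ, ← hI] at this
      rw [← this, Set.image_eq_range]
    have h2 : Submodule.map (L.centSpan ⊥).mkQ (Submodule.span ℂ (Set.range L.locLift)) = ⊤ := by
      rw [Submodule.map_span, ← Set.range_comp, ← L.locBasis.span_eq]
      congr 2
      exact funext L.mkQ_locLift
    rw [Submodule.map_mkQ_eq_top] at h2
    have h3 : Submodule.map E.mkQ (Submodule.span ℂ (Set.range L.locLift)) = ⊤ := by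
      rw [Submodule.map_mkQ_eq_top, eq_top_iff, ← h2]
      exact sup_le_sup_right (sup_le_sup_right bot_le _) _
    rw [h1, ← h3, Submodule.map_span, ← Set.range_comp]
    rfl
  let B : Module.Basis I ℂ (L.Loc ⧸ E) := Module.Basis.mk (hK.linearIndepOn_extend _) hspan
  -- The module induced from the character of E that kills `locFil (K + 1)` and takes the value 1 on
  -- cent(-1). The universal module maps to it, and this map kills `deepSub K`.
  let Q : InductionData ℂ L.Loc I ℂ := L.scalarData (L.locFil (K + 1))
    (fun X hX Y hY => L.lie_mem_locFil hX hY) (fun X hX => L.localRes_locFil hX)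
    (fun i => L.locLift i) B
    (fun i => (Module.Basis.mk_apply (hK.linearIndepOn_extend _) hspan i).symm)
  have hQ : ∀ {X}, Q.coord X = 0 ↔ X ∈ E := L.scalarData_coord
  let φ : (Multiset L.LocIndex →₀ ℂ) →ₗ[ℂ] (Multiset I →₀ ℂ) :=
    L.freeData.extend Q.A (Finsupp.lsingle 0)
  have hφ : ∀ X y, φ (L.freeData.A X y) = Q.A X (φ y) :=
    L.freeData.extend_A Q.A (Finsupp.lsingle 0) Q.A_lie fun X hX m => by
      have : X ∈ E := Submodule.mem_sup_right (L.freeData_coord.mp hX)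
      exact (Q.A_single_zero (hQ.mpr this) m).symm
  -- Sorted words in I remain sorted in the larger index set, so both modules build these monomials
  -- by the same operators.
  have hφmap : ∀ (s : Multiset I) (m : ℂ),
      φ (Finsupp.single (s.map Subtype.val) m) = Finsupp.single s m := by
    intro s m
    induction s using InductionData.multiset_induction with
    | h0 => exact L.freeData.extend_zero _ _ m
    | hc j t ht ih =>
      have ht' : ∀ i ∈ t.map Subtype.val, (j : L.LocIndex) ≤ i := fun i hi => by
        obtain ⟨l, hl, rfl⟩ := Multiset.mem_map.mp hi
        exact ht l hl
      rw [Multiset.map_cons]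
      refine (L.freeData.extend_cons _ _ ht' m).trans ?_
      refine (congrArg _ (ih t le_rfl)).trans ?_
      exact Q.A_b ht m
  have hker : ∀ y ∈ L.deepSub K, φ y = 0 := by
    let ker : LieSubmodule ℂ L.Loc L.freeModule :=
      { (LinearMap.ker φ : Submodule ℂ (Multiset L.LocIndex →₀ ℂ)) with
        lie_mem := fun {X y} hy => by
          change φ (L.freeData.A X y) = 0
          exact (hφ X y).trans (by rw [show φ y = 0 from hy, map_zero]) }
    have hle : L.deepSub K ≤ ker := by
      refine LieSubmodule.lieSpan_le.mpr ?_
      rintro _ ⟨X, hX, rfl⟩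
      change φ (L.freeData.A X (Finsupp.single 0 1)) = 0
      rw [hφ, show φ (Finsupp.single 0 1) = Finsupp.single 0 1 from L.freeData.extend_zero _ _ 1,
        Q.A_single_zero (hQ.mpr (Submodule.mem_sup_left hX))]
      change Finsupp.single 0 (L.localRes X * 1) = 0
      rw [L.localRes_locFil hX, zero_mul, Finsupp.single_zero]
    exact fun y hy => hle hy
  have hφ' : ∀ y : Multiset I →₀ ℂ, φ (Finsupp.mapDomain (Multiset.map Subtype.val) y) = y := by
    intro y
    induction y using Finsupp.induction_linear with
    | zero => simp
    | add x y hx hy => rw [Finsupp.mapDomain_add, map_add, hx, hy]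
    | single s m => rw [Finsupp.mapDomain_single, hφmap]
  have hinj : Function.Injective (Multiset.map (Subtype.val : I → L.LocIndex)) :=
    Multiset.map_injective Subtype.val_injective
  -- All indices of `u` lie in W, hence in I. So `u` comes from the quotient's monomials, on which φ
  -- is a left inverse, and φ u = 0 forces u = 0.
  have hrange : ↑u'.support ⊆ Set.range (Multiset.map (Subtype.val : I → L.LocIndex)) := by
    intro s hs
    have hsI : ∀ i ∈ s, i ∈ I := fun i hi => by
      refine hK.subset_extend (Set.subset_univ _) ?_
      exact Finset.mem_biUnion.mpr ⟨s, hs, Multiset.mem_toFinset.mpr hi⟩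
    lift s to Multiset I using hsI
    exact ⟨s, rfl⟩
  have h1 := Finsupp.mapDomain_comapDomain _ hinj u' hrange
  have h2 := hφ' (Finsupp.comapDomain (Multiset.map Subtype.val) u' hinj.injOn)
  rw [h1] at h2
  rw [show φ u' = 0 from hker u hmem] at h2
  rw [← h2, Finsupp.mapDomain_zero] at h1
  exact h1.symm

/-- The universal module of level one embeds into an inverse limit of smooth modules. -/
lemma isPro_freeModule : IsPro L.IsSmooth L.freeModule :=
  Or.inr ⟨L.freeModule.quotientSystem L.deepSub L.deepSub_antitone, L.isSmooth_quotient,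
    L.freeModule.toLimit _ _, L.freeModule.toLimit_injective _ _ L.exists_notMem_deepSub⟩

end VertexLieAlgebra

/-! ### The invariant pairing, by induction and duality. -/

namespace VertexLieAlgebra

variable {V : Type u} [AddCommGroup V] [Module ℂ V] (L : VertexLieAlgebra V)

/-- The universal module of level one pairs invariantly and nontrivially with a representation of a
Lie algebra `H` over the local Lie algebra, when a lift of the central element acts as `-1`. -/
lemma exists_invariant_pairing {H M : Type*} [LieRing H] [LieAlgebra ℂ H] [AddCommGroup M]
    [Module ℂ M] (e : H →ₗ[ℂ] L.Loc) (he : ∀ X Y, e ⁅X, Y⁆ = ⁅e X, e Y⁆)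
    (θ : H →ₗ[ℂ] Module.End ℂ M) (hθ : ∀ X Y m, θ ⁅X, Y⁆ m = θ X (θ Y m) - θ Y (θ X m))
    (hker : ∀ X, e X = 0 → θ X = 0) {c : H} (hc : e c = L.mode L.cent (-1))
    (hcθ : ∀ m, θ c m = -m) {m : M} (hm : m ≠ 0) :
    ∃ β : L.freeModule →ₗ[ℂ] M →ₗ[ℂ] ℂ,
      (∀ X n m', β ⁅e X, n⁆ m' + β n (θ X m') = 0) ∧ β L.vac m ≠ 0 := by
  let E : Submodule ℂ L.Loc := LinearMap.range e
  -- By `hker` the action descends to the image E of `e`. Its linear extension to the whole local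
  -- Lie algebra is arbitrary, since the relations of the induction data concern only E.
  obtain ⟨θ', hθ'⟩ := LinearMap.exists_extend
    ((LinearMap.ker e).liftQ θ hker ∘ₗ (e.quotKerEquivRange.symm : E →ₗ[ℂ] _))
  have hθ'e : ∀ X, θ' (e X) = θ X := fun X => by
    have h := LinearMap.congr_fun hθ' ⟨e X, X, rfl⟩
    refine h.trans ?_
    have h1 : e.quotKerEquivRange.symm ⟨e X, X, rfl⟩ = (LinearMap.ker e).mkQ X := by
      rw [LinearEquiv.symm_apply_eq]
      rfl
    change (LinearMap.ker e).liftQ θ hker (e.quotKerEquivRange.symm ⟨e X, X, rfl⟩) = _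
    rw [h1]
    rfl
  let I := Module.Basis.ofVectorSpaceIndex ℂ (L.Loc ⧸ E)
  let B : Module.Basis I ℂ (L.Loc ⧸ E) := Module.Basis.ofVectorSpace ℂ _
  let _ : LinearOrder I := IsWellOrder.linearOrder WellOrderingRel
  let Q : InductionData ℂ L.Loc I M := InductionData.ofBasis E
    (by
      rintro _ ⟨X, rfl⟩ _ ⟨Y, rfl⟩
      exact ⟨⁅X, Y⁆, he X Y⟩)
    (fun i => Function.surjInv (Submodule.mkQ_surjective E) (B i)) B
    (fun i => Function.surjInv_eq (Submodule.mkQ_surjective E) _) θ'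
    (by
      rintro _ ⟨X, rfl⟩ _ ⟨Y, rfl⟩ m
      rw [← he, hθ'e, hθ'e, hθ'e, hθ])
  have hQ : ∀ X m, Q.A (e X) (Finsupp.single 0 m) = Finsupp.single 0 (θ X m) := fun X m => by
    have h : Q.coord (e X) = 0 := (InductionData.ofBasis_coord_eq_zero _ _ _ _ _ _ _).mpr ⟨X, rfl⟩
    rw [Q.A_single_zero h]
    exact congrArg _ (LinearMap.congr_fun (hθ'e X) m)
  have hQc : ∀ y, Q.A (L.mode L.cent (-1)) y = (-1 : ℂ) • y :=
    Q.A_central (L.lie_cent (-1)) fun m => by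
      rw [← hc, hQ, hcθ, neg_one_smul, Finsupp.single_neg]
  -- This is where PBW enters: M sits injectively in degree zero of the induced module, so a
  -- functional can be nonzero at `m`.
  obtain ⟨φ, hφ⟩ : ∃ φ : Module.Dual ℂ (Multiset I →₀ M), φ (Finsupp.single 0 m) ≠ 0 := by
    by_contra! h
    exact hm (Finsupp.single_eq_zero.mp ((Module.forall_dual_apply_eq_zero_iff ℂ _).mp h))
  -- In the contragredient representation cent(-1) acts as 1, the level of the universal module, so
  -- vac ↦ φ extends to a module map.
  let ρ : L.Loc →ₗ[ℂ] Module.End ℂ (Module.Dual ℂ (Multiset I →₀ M)) :=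
    -(Module.Dual.transpose ∘ₗ Q.A)
  have hρ : ∀ X ψ y, ρ X ψ y = -ψ (Q.A X y) := fun X ψ y => rfl
  let f : (Multiset L.LocIndex →₀ ℂ) →ₗ[ℂ] Module.Dual ℂ (Multiset I →₀ M) :=
    L.freeData.extend ρ (LinearMap.toSpanSingleton ℂ _ φ)
  have hf : ∀ X n, f (L.freeData.A X n) = ρ X (f n) :=
    L.freeData.extend_A ρ _
      (fun X Y ψ => by
        refine LinearMap.ext fun y => ?_
        rw [LinearMap.sub_apply]
        simp only [hρ]
        rw [Q.A_lie, map_sub]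
        ring)
      (fun X hX a => by
        obtain ⟨t, rfl⟩ := Submodule.mem_span_singleton.mp (L.freeData_coord.mp hX)
        refine LinearMap.ext fun y => ?_
        have h1 : Q.A (t • L.mode L.cent (-1)) y = -(t • y) := by
          rw [map_smul, LinearMap.smul_apply, hQc, neg_one_smul, smul_neg]
        rw [hρ, h1]
        change (((L.localRes (t • L.mode L.cent (-1))) * a) • φ) y = -((a • φ) (-(t • y)))
        rw [map_smul, localRes_cent]
        simp only [LinearMap.smul_apply, map_smul, map_neg, smul_eq_mul]
        ring)
  refine ⟨(LinearMap.lcomp ℂ ℂ (Finsupp.lsingle 0)) ∘ₗ f, fun X n m' => ?_, ?_⟩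
  · change f (L.freeData.A (e X) n) (Finsupp.single 0 m') + f n (Finsupp.single 0 (θ X m')) = 0
    have h := LinearMap.congr_fun (hf (e X) n) (Finsupp.single 0 m')
    rw [hρ, hQ] at h
    exact (congrArg (· + _) h).trans (neg_add_cancel _)
  · change f (Finsupp.single 0 1) (Finsupp.single 0 m) ≠ 0
    rw [show f (Finsupp.single 0 1) = φ from
      (L.freeData.extend_zero _ _ 1).trans (one_smul ℂ φ)]
    exact hφ

namespace CyclicAction

variable {L} (Γ : L.CyclicAction)

section Global

variable {S : Set ℂ} (hS : ∀ w, Γ.ω⁻¹ * w ∈ S → w ∈ S) (hfin : S.Finite)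

/-- Laurent expansion on the invariants with vanishing sum of residues. -/
def expandInv (w : ℂ) : Γ.globResInv hS hfin →ₗ[ℂ] L.Loc :=
  L.expandAt S w ∘ₗ (Γ.globResInv hS hfin).toSubmodule.subtype

lemma expandInv_lie (w : ℂ) (X Y : Γ.globResInv hS hfin) :
    Γ.expandInv hS hfin w ⁅X, Y⁆ = ⁅Γ.expandInv hS hfin w X, Γ.expandInv hS hfin w Y⁆ :=
  L.expandAt_lie S w X Y

/-- If there are only two orbits of poles, then an invariant element is determined by its Laurent
expansion at one of the points. -/
lemma expandInv_eq_zero {v w : ℂ} (hw : w ∈ S)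
    (hvw : ∀ u ∈ S, ∃ k : ℕ, u = Γ.ω ^ k * v ∨ u = Γ.ω ^ k * w) {X : Γ.globResInv hS hfin}
    (h : Γ.expandInv hS hfin v X = 0) : Γ.expandInv hS hfin w X = 0 := by
  have h1 : L.resAt S v X = 0 := (congrArg L.localRes h).trans (map_zero _)
  have h2 : L.resAt S w X = 0 := Γ.resAt_eq_zero hS hfin hw hvw X.2 h1
  exact (L.expandAt_eq_resAt_smul h w).trans ((congrArg (· • _) h2).trans (zero_smul ℂ _))

/-- Laurent expansion at the origin, with values in the invariants. -/
def expandInvZero : Γ.globResInv hS hfin →ₗ[ℂ] Γ.LocInv :=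
  (L.expandAt S 0).restrict (p := (Γ.globResInv hS hfin).toSubmodule)
    (q := Γ.LocInv.toSubmodule) fun X hX => by
      change Γ.twistLoc _ = _
      rw [← Γ.expandAt_zero_twistGlob S hS, hX.1]

lemma expandInvZero_lie (X Y : Γ.globResInv hS hfin) : Γ.expandInvZero hS hfin ⁅X, Y⁆ =
    ⁅Γ.expandInvZero hS hfin X, Γ.expandInvZero hS hfin Y⁆ :=
  Subtype.ext (L.expandAt_lie S 0 X Y)

end Global

lemma norm_ω : ‖Γ.ω‖ = 1 := Γ.isPrimitiveRoot.norm'_eq_one Γ.T_pos.ne'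

end CyclicAction

end VertexLieAlgebra

/-! ### Invariant pairings as functionals on coinvariants. -/

/-- The multilinear form on a family indexed by two elements which is given by a bilinear form. -/
def MultilinearMap.ofOptionFinOne {E : Option (Fin 1) → Type*} [∀ i, AddCommGroup (E i)]
    [∀ i, Module ℂ (E i)] (β : E (some 0) →ₗ[ℂ] E none →ₗ[ℂ] ℂ) : MultilinearMap ℂ E ℂ where
  toFun m := β (m (some 0)) (m none)
  map_update_add' m i x y := by
    match i with
    | none => simp
    | some 0 => simp
  map_update_smul' m i c x := by
    match i with
    | none => simp
    | some 0 => simp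

/-- The multilinear map on a family indexed by one element which is given by a linear map. -/
def MultilinearMap.ofFinOne {E : Fin 1 → Type*} {W : Type*} [∀ i, AddCommGroup (E i)]
    [∀ i, Module ℂ (E i)] [AddCommGroup W] [Module ℂ W] (f : E 0 →ₗ[ℂ] W) :
    MultilinearMap ℂ E W where
  toFun m := f (m 0)
  map_update_add' m i x y := by
    match i with
    | 0 => simp
  map_update_smul' m i c x := by
    match i with
    | 0 => simp

namespace VertexLieAlgebra

variable {V : Type u} [AddCommGroup V] [Module ℂ V] {L : VertexLieAlgebra V}

namespace CyclicAction

lemma actAt_tprod {ι : Type} [Fintype ι] [DecidableEq ι] (M : ι → LModule L.Loc) (i : ι)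
    (X : L.Loc) (m : ∀ j, M j) : actAt M i X (PiTensorProduct.tprod ℂ m) =
      PiTensorProduct.tprod ℂ (Function.update m i ⁅X, m i⁆) := by
  rw [actAt, PiTensorProduct.map_tprod]
  congr 1
  ext j
  rcases eq_or_ne j i with rfl | h
  · simp
  · simp [h]

variable (Γ : L.CyclicAction)

/-- An invariant pairing of the modules at two points detects vectors in the coinvariants. -/
lemma coinvClass_ne_zero (z : Option (Fin 1) → ℂ) (M : Option (Fin 1) → LModule L.Loc)
    (β : M (some 0) →ₗ[ℂ] M none →ₗ[ℂ] ℂ)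
    (hβ : ∀ X ∈ Γ.globInv z, ∀ n m, β ⁅L.expandAt (Γ.orbits z) (z (some 0)) X, n⁆ m +
      β n ⁅L.expandAt (Γ.orbits z) (z none) X, m⁆ = 0) (m : ∀ i, M i)
    (hm : β (m (some 0)) (m none) ≠ 0) : Γ.coinvClass z M m ≠ 0 := by
  intro h
  let F : (⨂[ℂ] i, M i) →ₗ[ℂ] ℂ := PiTensorProduct.lift (MultilinearMap.ofOptionFinOne β)
  have hF : ∀ m, F (PiTensorProduct.tprod ℂ m) = β (m (some 0)) (m none) := fun m =>
    PiTensorProduct.lift.tprod _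
  -- On pure tensors the sum of the two local actions pairs to the left side of `hβ`; linearity
  -- gives the rest.
  have hle : Γ.coinvRel z M ≤ LinearMap.ker F := by
    refine Submodule.span_le.mpr ?_
    rintro _ ⟨X, hX, u, rfl⟩
    rw [SetLike.mem_coe, LinearMap.mem_ker]
    induction u using PiTensorProduct.induction_on with
    | smul_tprod r m =>
      simp only [map_smul, ← Finset.smul_sum, map_sum, actAt_tprod, hF]
      rw [Fintype.sum_option, Fin.sum_univ_one]
      have := hβ X hX (m (some 0)) (m none)
      simp only [Function.update_self, ne_eq, reduceCtorEq, not_false_eq_true,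
        Function.update_of_ne]
      rw [add_comm, this, smul_zero]
    | add x y hx hy =>
      simp only [map_add, Finset.sum_add_distrib, hx, hy, add_zero]
  refine hm ?_
  rw [← hF]
  exact hle ((Submodule.Quotient.mk_eq_zero _).mp h)

/-- An invariant pairing of the modules at a point and at the origin detects vectors in the
coinvariants. -/
lemma coinvClass₀_ne_zero (z : Fin 1 → ℂ) (M : Fin 1 → LModule L.Loc) (M₀ : LModule Γ.LocInv)
    (β : M 0 →ₗ[ℂ] M₀ →ₗ[ℂ] ℂ)
    (hβ : ∀ X : Γ.globInv₀ z, ∀ n m, β ⁅L.expandAt (insert 0 (Γ.orbits z)) (z 0) X, n⁆ m +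
      β n ⁅Γ.expandZero z X, m⁆ = 0) (m : ∀ i, M i) (m₀ : M₀)
    (hm : β (m 0) m₀ ≠ 0) : Γ.coinvClass₀ z M M₀ m m₀ ≠ 0 := by
  intro h
  let F : ((⨂[ℂ] i, M i) ⊗[ℂ] M₀) →ₗ[ℂ] ℂ :=
    TensorProduct.lift (PiTensorProduct.lift (MultilinearMap.ofFinOne β))
  have hF : ∀ m m₀, F (PiTensorProduct.tprod ℂ m ⊗ₜ m₀) = β (m 0) m₀ := fun m m₀ => by
    rw [TensorProduct.lift.tmul, PiTensorProduct.lift.tprod]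
    rfl
  have hle : Γ.coinvRel₀ z M M₀ ≤ LinearMap.ker F := by
    refine Submodule.span_le.mpr ?_
    rintro _ ⟨X, u, rfl⟩
    rw [SetLike.mem_coe, LinearMap.mem_ker, Fin.sum_univ_one]
    induction u with
    | zero => simp
    | add x y hx hy =>
      simp only [map_add] at hx hy ⊢
      linear_combination hx + hy
    | tmul t m₀ =>
      induction t using PiTensorProduct.induction_on with
      | smul_tprod r m =>
        rw [LinearMap.rTensor_tmul, LinearMap.lTensor_tmul, map_smul, actAt_tprod,
          ← TensorProduct.smul_tmul', ← TensorProduct.smul_tmul', ← smul_add, map_smul, map_add, hF,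
          hF, Function.update_self, LieModule.toEnd_apply_apply, hβ, smul_zero]
      | add x y hx hy =>
        simp only [TensorProduct.add_tmul, map_add] at hx hy ⊢
        linear_combination hx + hy
  refine hm ?_
  rw [← hF]
  exact hle ((Submodule.Quotient.mk_eq_zero _).mp h)

end CyclicAction

end VertexLieAlgebra

/-! ### Detection of a vector by one further marked point. -/

namespace VertexLieAlgebra

variable {V : Type u} [AddCommGroup V] [Module ℂ V] {L : VertexLieAlgebra V}

namespace CyclicAction

variable (Γ : L.CyclicAction)

/-- Γ acts by numbers of modulus one, so points of different modulus have disjoint orbits. -/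
lemma ne_ω_pow_mul {v w : ℂ} (h : ‖v‖ ≠ ‖w‖) (k : ℕ) : v ≠ Γ.ω ^ k * w := by
  rintro rfl
  rw [norm_mul, norm_pow, norm_ω, one_pow, one_mul] at h
  exact h rfl

/-- A nonzero vector of a smooth module is detected by the coinvariants with the universal module at
one further point. -/
lemma exists_coinvClass_ne_zero {x y : ℂ} (hx : x ≠ 0) (hy : y ≠ 0) (hxy : ‖x‖ ≠ ‖y‖)
    (M : LModule L.Loc) (hM : L.IsSmooth M) {m : M} (hm : m ≠ 0) :
    Γ.coinvClass (addPoint x fun _ : Fin 1 => y) (addModule M fun _ => L.freeModule)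
      (addVector m fun _ => L.vac) ≠ 0 := by
  set z : Option (Fin 1) → ℂ := addPoint x fun _ : Fin 1 => y
  have hfin := Γ.finite_orbits z
  have hS := Γ.orbits_stable z
  have hxz : ∀ k, Γ.ω ^ k * x ∈ Γ.orbits z := Γ.mem_orbits z none
  have hyz : ∀ k, Γ.ω ^ k * y ∈ Γ.orbits z := Γ.mem_orbits z (some 0)
  have hvw : ∀ u ∈ Γ.orbits z, ∃ k : ℕ, u = Γ.ω ^ k * y ∨ u = Γ.ω ^ k * x := by
    rintro _ ⟨i, k, rfl⟩
    match i with
    | none => exact ⟨k, Or.inr rfl⟩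
    | some _ => exact ⟨k, Or.inl rfl⟩
  -- This element expands to cent(-1) at `y` and to -cent(-1) at `x`, which gives the action by -1
  -- required for the pairing.
  let c : Γ.globResInv hS hfin := ⟨Γ.orbitPole _ y hyz - Γ.orbitPole _ x hxz, by
    rw [mem_globResInv, map_sub, map_sub, twistGlob_orbitPole, twistGlob_orbitPole,
      globRes_orbitPole, globRes_orbitPole, sub_self]
    exact ⟨rfl, rfl⟩⟩
  let θ : Γ.globResInv hS hfin →ₗ[ℂ] Module.End ℂ M :=
    (LieModule.toEnd ℂ L.Loc M : L.Loc →ₗ[ℂ] _) ∘ₗ Γ.expandInv hS hfin x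
  have hθ : ∀ X m, θ X m = ⁅Γ.expandInv hS hfin x X, m⁆ := fun X m => rfl
  obtain ⟨β, hβ, hβm⟩ := L.exists_invariant_pairing (Γ.expandInv hS hfin y)
    (Γ.expandInv_lie hS hfin y) θ
    (fun X Y m => by rw [hθ, hθ, hθ, hθ, hθ, expandInv_lie, lie_lie])
    (fun X hX => by
      ext m
      have hxz0 : x ∈ Γ.orbits z := by simpa using hxz 0
      rw [hθ, Γ.expandInv_eq_zero hS hfin hxz0 hvw hX, zero_lie, LinearMap.zero_apply])
    (c := c) (by
      change L.expandAt _ y (Γ.orbitPole _ y hyz - Γ.orbitPole _ x hxz) = _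
      rw [map_sub, expandAt_orbitPole_self Γ hy,
        expandAt_orbitPole_of_ne Γ (Γ.ne_ω_pow_mul hxy.symm), sub_zero])
    (fun m => by
      change ⁅L.expandAt _ x (Γ.orbitPole _ y hyz - Γ.orbitPole _ x hxz), m⁆ = _
      rw [map_sub, expandAt_orbitPole_self Γ hx,
        expandAt_orbitPole_of_ne Γ (Γ.ne_ω_pow_mul hxy), zero_sub, neg_lie, hM.1]) hm
  exact Γ.coinvClass_ne_zero z (addModule M fun _ => L.freeModule) β
    (fun X hX n m => hβ ⟨X, Γ.globInv_le z hfin hX⟩ n m) _ hβm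

/-- A nonzero vector of a smooth module at the origin is detected by the coinvariants with the
universal module at one further point. -/
lemma exists_coinvClass₀_ne_zero {y : ℂ} (hy : y ≠ 0) (M₀ : LModule Γ.LocInv)
    (hM₀ : Γ.IsSmooth₀ M₀) {m₀ : M₀} (hm₀ : m₀ ≠ 0) :
    Γ.coinvClass₀ (fun _ : Fin 1 => y) (fun _ => L.freeModule) M₀ (fun _ => L.vac) m₀ ≠ 0 := by
  set z : Fin 1 → ℂ := fun _ => y
  have hfin : (insert 0 (Γ.orbits z)).Finite := (Γ.finite_orbits z).insert 0
  have hS := Γ.insert_orbits_stable z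
  have h0z : (0 : ℂ) ∈ insert 0 (Γ.orbits z) := Set.mem_insert _ _
  have hyz : ∀ k, Γ.ω ^ k * y ∈ insert 0 (Γ.orbits z) := fun k =>
    Set.mem_insert_of_mem _ (Γ.mem_orbits z 0 k)
  -- The origin is an orbit by itself, so the criterion for two orbits applies with w = 0.
  have hvw : ∀ u ∈ insert 0 (Γ.orbits z), ∃ k : ℕ, u = Γ.ω ^ k * y ∨ u = Γ.ω ^ k * 0 := by
    rintro _ (rfl | ⟨i, k, rfl⟩)
    · exact ⟨0, Or.inr (by simp)⟩
    · exact ⟨k, Or.inl rfl⟩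
  have hT : (Γ.T : ℂ) ≠ 0 := Nat.cast_ne_zero.mpr Γ.T_pos.ne'
  -- The T residues along the orbit of `y` must be balanced at the single point 0. There the element
  -- acts as -T cent(-1), which at level 1/T is again -1.
  let c : Γ.globResInv hS hfin := ⟨Γ.orbitPole _ y hyz - (Γ.T : ℂ) • L.centPole _ 0 h0z, by
    rw [mem_globResInv, map_sub, map_sub, twistGlob_orbitPole, map_smul, map_smul,
      globRes_orbitPole, globRes_centPole, Γ.twistGlob_centPole _ hS 0 h0z (by rwa [mul_zero])]
    simp⟩
  let θ : Γ.globResInv hS hfin →ₗ[ℂ] Module.End ℂ M₀ :=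
    (LieModule.toEnd ℂ Γ.LocInv M₀ : Γ.LocInv →ₗ[ℂ] _) ∘ₗ Γ.expandInvZero hS hfin
  have hθ : ∀ X m, θ X m = ⁅Γ.expandInvZero hS hfin X, m⁆ := fun X m => rfl
  have hy0 : ∀ k : ℕ, (0 : ℂ) ≠ Γ.ω ^ k * y := Γ.ne_ω_pow_mul (by
    rw [norm_zero]
    exact (norm_ne_zero_iff.mpr hy).symm)
  obtain ⟨β, hβ, hβm⟩ := L.exists_invariant_pairing (Γ.expandInv hS hfin y)
    (Γ.expandInv_lie hS hfin y) θ
    (fun X Y m => by rw [hθ, hθ, hθ, hθ, hθ, expandInvZero_lie, lie_lie])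
    (fun X hX => by
      ext m
      have h1 : Γ.expandInvZero hS hfin X = 0 :=
        Subtype.ext (Γ.expandInv_eq_zero hS hfin h0z hvw hX)
      rw [hθ, h1, zero_lie, LinearMap.zero_apply])
    (c := c) (by
      change L.expandAt _ y (Γ.orbitPole _ y hyz - (Γ.T : ℂ) • L.centPole _ 0 h0z) = _
      rw [map_sub, expandAt_orbitPole_self Γ hy, map_smul, expandAt_centPole, if_neg hy, zero_smul,
        smul_zero, sub_zero])
    (fun m => by
      have h1 : Γ.expandInvZero hS hfin c = -((Γ.T : ℂ) • Γ.centInv) := by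
        refine Subtype.ext ?_
        change L.expandAt _ 0 (Γ.orbitPole _ y hyz - (Γ.T : ℂ) • L.centPole _ 0 h0z) =
          -((Γ.T : ℂ) • L.mode L.cent (-1))
        rw [map_sub, expandAt_orbitPole_of_ne Γ hy0, map_smul, expandAt_centPole, if_pos rfl,
          one_smul, zero_sub]
      rw [hθ, h1, neg_lie, smul_lie, hM₀.1, smul_smul, mul_one_div_cancel hT, one_smul]) hm₀
  exact Γ.coinvClass₀_ne_zero z (fun _ => L.freeModule) M₀ β
    (fun X n m => hβ ⟨X, Γ.globInv₀_le z hfin X.2⟩ n m) _ m₀ hβm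

end CyclicAction

end VertexLieAlgebra

end

/-- If a vector of a smooth module has vanishing class in every space of cyclotomic coinvariants,
for all choices of the other marked points, modules and vectors, then it is zero. -/
theorem proposition3p5 {V : Type u} [AddCommGroup V] [Module ℂ V] (L : VertexLieAlgebra V)
    (Γ : L.CyclicAction) :
    (∀ x : ℂ, x ≠ 0 → ∀ M : LModule L.Loc, L.IsSmooth M → ∀ m : M,
      (∀ (N : ℕ) (z : Fin N → ℂ), Γ.Admissible (addPoint x z) →
        ∀ P : Fin N → LModule L.Loc, (∀ i, IsPro L.IsSmooth (P i)) → ∀ p : ∀ i, P i,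
          Γ.coinvClass (addPoint x z) (addModule M P) (addVector m p) = 0 ∧
          ∀ P₀ : LModule Γ.LocInv, IsPro Γ.IsSmooth₀ P₀ → ∀ p₀ : P₀,
            Γ.coinvClass₀ (addPoint x z) (addModule M P) P₀ (addVector m p) p₀ = 0) →
      m = 0) ∧
    (∀ M₀ : LModule Γ.LocInv, Γ.IsSmooth₀ M₀ → ∀ m₀ : M₀,
      (∀ (N : ℕ) (z : Fin N → ℂ), Γ.Admissible z →
        ∀ P : Fin N → LModule L.Loc, (∀ i, IsPro L.IsSmooth (P i)) → ∀ p : ∀ i, P i,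
          Γ.coinvClass₀ z P M₀ p m₀ = 0) →
      m₀ = 0) := by
  refine ⟨fun x hx M hM m h => ?_, fun M₀ hM₀ m₀ h => ?_⟩
  · by_contra hm
    -- The extra point 2x is nonzero and has a modulus different from that of x, so the two orbits
    -- are disjoint.
    have hy : 2 * x ≠ 0 := mul_ne_zero two_ne_zero hx
    have hxy : ‖x‖ ≠ ‖2 * x‖ := by
      have := norm_pos_iff.mpr hx
      rw [norm_mul, RCLike.norm_ofNat]
      linarith
    refine Γ.exists_coinvClass_ne_zero hx hy hxy M hM hm
      -- The coinvariants without a module at the origin already suffice.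
      (h 1 (fun _ => 2 * x) ⟨?_, ?_⟩ _ (fun _ => L.isPro_freeModule) _).1
    · rintro (_ | _)
      exacts [hx, hy]
    · rintro (_ | i) (_ | j) hij
      · exact absurd rfl hij
      · exact Γ.ne_ω_pow_mul hxy
      · exact Γ.ne_ω_pow_mul hxy.symm
      · exact absurd (congrArg some (Subsingleton.elim i j)) hij
  · by_contra hm₀
    exact Γ.exists_coinvClass₀_ne_zero one_ne_zero M₀ hM₀ hm₀
      (h 1 (fun _ => 1) ⟨fun _ => one_ne_zero, fun i j hij => absurd (Subsingleton.elim i j) hij⟩ _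
        (fun _ => L.isPro_freeModule) _)
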